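/- Let $S$ be a countable set and let $p(x,y)=p(y,x)\ge 0$, $x,y\in S$, be symmetric jump rates with $\sup_x\sum_y p(x,y)<\infty$. Let $X_t$ be the continuous-time Markov chain on $S$ with jump rates $p$, and write $P^x$ for its law started at $x$. Consider the stirring process: a label $x$ is placed at each site $x\in S$ at time $0$, every unordered pair $\{x,y\}$ of sites carries an independent Poisson clock of rate $p(x,y)$, and whenever the clock of $\{x,y\}$ rings the labels at $x$ and $y$ switch places. Let $\xi^x_t$ be the position at time $t$ of the label $x$, and $L_t(x)$ the label at site $x$ at time $t$. For a deterministic $\eta\in\{0,1\}^S$ the symmetric exclusion process started from $\eta$ is $\eta_t(x)=\eta(L_t(x))$. Let $S=A\cup B$ be a partition that is balanced: there is $c>0$ such that for every $x\in S$ $$c<\liminf_{t\to\infty}P^x(X_t\in A)\le\limsup_{t\to\infty}P^x(X_t\in A)<1-c .$$ Suppose that $$\mathbb E\Big(\sum_{x\in B}1_{\{\xi^x_t\in A\}}\Big)<\infty\quad\text{for all }t\ge 0,\qquad \sup_{t\ge0}\mathbb E\Big(\sum_{x:\,\eta(x)=1}(1-\eta_t(x))\Big)=\infty .$$ Then for every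 $t\ge 0$ the two series in the definition of the current from $A$ to $B$, $$W^\eta_t=\sum_{x\in A}\eta(x)1_{\{\xi^x_t\in B\}}-\sum_{x\in B}\eta(x)1_{\{\xi^x_t\in A\}},$$ converge almost surely, $W^\eta_t$ is square integrable, and $$\operatorname{Var} W^\eta_t\longrightarrow\infty\qquad\text{as }t\to\infty .$$ -/

import Mathlib

open MeasureTheory ProbabilityTheory Filter Topology
open scoped NNReal ENNReal Nat

noncomputable section

namespace SEP

/-! ### The one-particle Markov chain -/

section Chain

variable {S : Type*}

/-- The generator `(U f)(x) = ∑_y p(x,y) (f(y) - f(x))` of the Markov chain on `S` with jump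
rates `p`, acting on bounded functions. -/
def generator (p : S → S → ℝ≥0) (f : S → ℝ) (x : S) : ℝ :=
  ∑' y, (p x y : ℝ) * (f y - f x)

/-- The transition semigroup `U(t) = e^{tU} = ∑_n tⁿ/n! Uⁿ` on bounded functions (the total jump
rates are bounded, so that `U` is a bounded operator and all the series converge absolutely).
Thus `semigroup p t f x = 𝔼^x f(X_t)`. -/
def semigroup (p : S → S → ℝ≥0) (t : ℝ≥0) (f : S → ℝ) (x : S) : ℝ :=
  ∑' n : ℕ, (t : ℝ) ^ n / (n ! : ℝ) * ((generator p)^[n] f) x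

/-- `P^x(X_t ∈ A)` for the Markov chain `X` with jump rates `p`. -/
def chainProb (p : S → S → ℝ≥0) (t : ℝ≥0) (x : S) (A : Set S) : ℝ :=
  semigroup p t (A.indicator 1) x

/-- The partition of `S` into `A` and its complement is balanced: for some `c > 0` and all `x`,
`c < liminf P^x(X_t ∈ A)` and `limsup P^x(X_t ∈ A) < 1 - c` as `t → ∞`. -/
def IsBalanced (p : S → S → ℝ≥0) (A : Set S) : Prop :=
  ∃ c : ℝ, 0 < c ∧ ∀ x : S,
    c < liminf (fun t : ℝ≥0 => chainProb p t x A) atTop ∧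
    limsup (fun t : ℝ≥0 => chainProb p t x A) atTop < 1 - c

end Chain

/-! ### Poisson clocks and the stirring process -/

section Stirring

variable {S Ω : Type*} [MeasurableSpace Ω]

/-- A Poisson (counting) process of rate `r`. -/
structure IsPoissonProcess (N : ℝ≥0 → Ω → ℕ) (r : ℝ≥0) (P : Measure Ω) : Prop where
  measurable : ∀ t, Measurable (N t)
  zero : ∀ᵐ ω ∂P, N 0 ω = 0
  monotone : ∀ᵐ ω ∂P, Monotone fun t => N t ω
  right_continuous : ∀ᵐ ω ∂P, ∀ t, ∀ᶠ s in 𝓝[>] t, N s ω = N t ω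
  indep_increments : HasIndepIncrements N P
  law_increments : ∀ s t, s ≤ t →
    P.map (fun ω => N t ω - N s ω) = poissonMeasure (r * (t - s))

/-- The times at which a clock rings: the jump times of its counting process. -/
def ringTimes (N : ℝ≥0 → Ω → ℕ) (ω : Ω) : Set ℝ≥0 :=
  {t | 0 < t ∧ ∀ s < t, N s ω < N t ω}

/-- `f` is the path of a label that starts at `x` when the clock of the unordered pair `{a, b}`
rings at the times in `R s(a, b)`: it is right-continuous and piecewise constant, and if it sits
at `a` just before time `t`, then it goes to `b` at time `t` if the clock of `{a, b}` rings at
`t`, and stays at `a` if no clock of a pair containing `a` rings at `t`. -/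
structure IsLabelPath (R : Sym2 S → Set ℝ≥0) (x : S) (f : ℝ≥0 → S) : Prop where
  start : f 0 = x
  right_continuous : ∀ t, ∀ᶠ s in 𝓝[>] t, f s = f t
  jump : ∀ t, 0 < t → ∃ a, (∀ᶠ s in 𝓝[<] t, f s = a) ∧
    (∀ b, t ∈ R s(a, b) → f t = b) ∧ ((∀ b, t ∉ R s(a, b)) → f t = a)

/-- The stirring process with rates `p`, driven by independent Poisson clocks `N s(x, y)` of
rates `p x y`, one for each unordered pair: almost surely, whenever the clock of `{x, y}` rings,
the labels at `x` and `y` switch places. Here `ξ t x` is the position at time `t` of the label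
that starts at `x`. (A clock with `x = y` has no effect.) -/
structure IsStirringProcess (p : S → S → ℝ≥0) (N : Sym2 S → ℝ≥0 → Ω → ℕ)
    (ξ : ℝ≥0 → S → Ω → S) (P : Measure Ω) : Prop where
  poisson : ∀ x y, IsPoissonProcess (N s(x, y)) (p x y) P
  indep : iIndepFun (fun (e : Sym2 S) (ω : Ω) (t : ℝ≥0) => N e t ω) P
  measurable : ∀ t x y, MeasurableSet {ω | ξ t x ω = y}
  path : ∀ᵐ ω ∂P, ∀ x, IsLabelPath (fun e => ringTimes (N e) ω) x (fun t => ξ t x ω)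

open Classical in
/-- `L_t(x)`: the label occupying the site `x` at time `t`. (Almost surely each site carries
exactly one label; the value `x` for a site without label is immaterial.) -/
def labelAt (ξ : ℝ≥0 → S → Ω → S) (t : ℝ≥0) (x : S) (ω : Ω) : S :=
  if h : ∃ u, ξ t u ω = x then h.choose else x

/-- The symmetric exclusion process `η_t(x) = η(L_t(x))` started from `η`. -/
def exclusion (ξ : ℝ≥0 → S → Ω → S) (η : S → ℝ) (t : ℝ≥0) (x : S) (ω : Ω) : ℝ :=
  η (labelAt ξ t x ω)

/-- The net current from `A` to `B` up to time `t`: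
`W_t = ∑_{x ∈ A} η(x) 1{ξ_t^x ∈ B} - ∑_{x ∈ B} η(x) 1{ξ_t^x ∈ A}`. -/
def current (ξ : ℝ≥0 → S → Ω → S) (η : S → ℝ) (A B : Set S) (t : ℝ≥0) (ω : Ω) : ℝ :=
  ∑' x : A, η x * B.indicator 1 (ξ t x ω) - ∑' x : B, η x * A.indicator 1 (ξ t x ω)

end Stirring

end SEP

end

/-!
The variance of the current is bounded below by the Dirichlet energy that the one-particle
semigroup dissipates when it is applied to the initial configuration, and the second hypothesis
says that this energy is infinite.

*From clocks to semigroups.* A system of jumps (`JumpSystem`) has a bounded generator on the bounded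
functions and a semigroup `semi`. A path driven by independent Poisson clocks agrees, for a fine
mesh, with a discrete chain in which a jump takes place when its clock is the only relevant one to
ring in a time step, and the error of the chain against the semigroup is of second order in each
step. Hence the clocks determine the law of the process at each time
(`JumpSystem.integral_eq_semi`). This is applied to a pair of labels of the stirring process, which
form a system of jumps `joint`.

*Negative correlation.* Write `T`, `V`, `U` for the semigroups of one label, of two labels, and of
two independent labels. The generators `V'` and `U'` of `V` and `U` differ by a sum over pairs of
sites,
`((V' - U') (f ⊗ f)) (x, y) = ∑ r(e) (f(ex) - f(x)) (f(ey) - f(y))`, which is nonpositive off the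
diagonal, and two labels never meet; by Duhamel's formula the locations of distinct labels are
negatively correlated (`semi_joint_tens_le`). Therefore the current, centered, is a series of
negatively correlated variables whose variances are summable. The sum of the variances is finite
because, by the symmetry of the rates, as many labels are expected to cross from `A` to `B` as from
`B` to `A`. Fatou's lemma gives the square integrability, and bounds the variances of finite parts
of the series by `2 Var W + 2` (`eventually_variance_sum_le`).

*The lower bound.* Duhamel's formula in the other order, and the symmetry of `T`, give
`Var W_t = ∫ ∑ r(e) Δ_e(t - s) (T_s η(a) - T_s η(b))² ds`, the sum being over pairs `e = {a, b}`,
where `Δ_e(s)` is the second moment of `1_B(ξ_s^a) - 1_B(ξ_s^b)` (`le_sum_cov` for a finite set of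
labels). By negative correlation `Δ_e(s) ≥ h_a (1 - h_b) + h_b (1 - h_a)` with
`h_a = P^a(X_s ∈ B)`, which for a balanced partition is bounded away from zero for large `s`.

*The energy.* By the same formula on the diagonal,
`∑_x T_t η(x) (1 - T_t η(x)) = 2 ∫ ∑ r(e) (T_s η(a) - T_s η(b))² ds`, integrated up to time `t`,
and the left side equals the sum of `1 - T_{2t} η(x)` over the occupied sites `x`, which is the
expected number of these sites that are empty at time `2t` (`exists_energy_gt`,
`IsStirringProcess.lintegral_exclusion_le`). That number is unbounded by hypothesis. So for any `M`
finitely many pairs and a finite time carry an energy larger than `M`, and the variance exceeds a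
fixed multiple of `M`, up to a constant, at all large times.
-/

noncomputable section

namespace SEP

/-! ### Bounded functions -/

/-- The Banach space of bounded real functions on `E`, with the supremum norm. It is a copy of
`ℓ^∞`, on which no structure other than that of a Banach space is visible. -/
def BddFun (E : Type*) : Type _ := lp (fun _ : E => ℝ) ∞

namespace BddFun

variable {E : Type*}

instance : NormedAddCommGroup (BddFun E) := inferInstanceAs (NormedAddCommGroup (lp _ ∞))

instance : NormedSpace ℝ (BddFun E) := inferInstanceAs (NormedSpace ℝ (lp (fun _ : E => ℝ) ∞))

instance : CompleteSpace (BddFun E) := inferInstanceAs (CompleteSpace (lp (fun _ : E => ℝ) ∞))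

instance : FunLike (BddFun E) E ℝ where
  coe f := f.1
  coe_injective _ _ h := Subtype.ext h

/-- A bounded function from a function and a bound. -/
def of (f : E → ℝ) (C : ℝ) (h : ∀ x, |f x| ≤ C) : BddFun E :=
  ⟨f, memℓp_infty ⟨C, by rintro _ ⟨x, rfl⟩; exact h x⟩⟩

lemma of_apply (f : E → ℝ) (C : ℝ) (h : ∀ x, |f x| ≤ C) (x : E) : of f C h x = f x := rfl

@[ext] lemma ext {f g : BddFun E} (h : ∀ x, f x = g x) : f = g := DFunLike.ext f g h

@[simp] lemma zero_apply (x : E) : (0 : BddFun E) x = 0 := rfl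

@[simp] lemma add_apply (f g : BddFun E) (x : E) : (f + g) x = f x + g x := rfl

@[simp] lemma sub_apply (f g : BddFun E) (x : E) : (f - g) x = f x - g x := rfl

@[simp] lemma neg_apply (f : BddFun E) (x : E) : (-f) x = -f x := rfl

@[simp] lemma smul_apply (c : ℝ) (f : BddFun E) (x : E) : (c • f) x = c * f x := rfl

lemma abs_apply_le (f : BddFun E) (x : E) : |f x| ≤ ‖f‖ := lp.norm_apply_le_norm (by simp) f x

lemma norm_le {f : BddFun E} {C : ℝ} (hC : 0 ≤ C) (h : ∀ x, |f x| ≤ C) : ‖f‖ ≤ C :=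
  lp.norm_le_of_forall_le hC h

lemma norm_of_le (f : E → ℝ) (C : ℝ) (h : ∀ x, |f x| ≤ C) (hC : 0 ≤ C) : ‖of f C h‖ ≤ C :=
  norm_le hC h

lemma abs_sub_le_two_mul_norm (f : BddFun E) (x y : E) : |f x - f y| ≤ 2 * ‖f‖ :=
  (abs_sub _ _).trans (by linarith [f.abs_apply_le x, f.abs_apply_le y])

/-- Evaluation at a point, as a continuous linear functional. -/
def eval (x : E) : BddFun E →L[ℝ] ℝ :=
  LinearMap.mkContinuous ⟨⟨fun f => f x, fun _ _ => rfl⟩, fun _ _ => rfl⟩ 1 fun f => by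
    rw [one_mul]; exact f.abs_apply_le x

lemma eval_apply (x : E) (f : BddFun E) : eval x f = f x := rfl

@[simp] lemma sum_apply {α : Type*} (s : Finset α) (F : α → BddFun E) (x : E) :
    (∑ a ∈ s, F a) x = ∑ a ∈ s, F a x := map_sum (eval x) F s

/-- The indicator function of a set. -/
def ind (A : Set E) : BddFun E := of (A.indicator 1) 1 fun x => by by_cases h : x ∈ A <;> simp [h]

lemma ind_apply (A : Set E) (x : E) : ind A x = A.indicator 1 x := rfl

lemma ind_singleton_comm (x y : E) : ind {x} y = ind {y} x := by
  by_cases h : x = y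
  · rw [h]
  · simp [ind_apply, h, Ne.symm h]

lemma ind_nonneg (A : Set E) (x : E) : 0 ≤ ind A x :=
  Set.indicator_nonneg (fun _ _ => zero_le_one) x

end BddFun

/-! ### Operators on bounded functions -/

section Operators

variable {E : Type*}

/-- An operator on bounded functions that is continuous for bounded pointwise convergence, that
is, an operator given by a kernel. -/
def BPContinuous (T : BddFun E →L[ℝ] BddFun E) : Prop :=
  ∀ (F : ℕ → BddFun E) (f : BddFun E) (C : ℝ), (∀ n, ‖F n‖ ≤ C) →
    (∀ z, Tendsto (fun n => F n z) atTop (𝓝 (f z))) →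
    ∀ z, Tendsto (fun n => T (F n) z) atTop (𝓝 (T f z))

/-- The operator has a symmetric kernel `(a, b) ↦ T 1_a (b)`. -/
def IsSymmKernel (T : BddFun E →L[ℝ] BddFun E) : Prop :=
  ∀ a b, T (BddFun.ind {a}) b = T (BddFun.ind {b}) a

variable {T T' : BddFun E →L[ℝ] BddFun E}

lemma BPContinuous.one : BPContinuous (1 : BddFun E →L[ℝ] BddFun E) :=
  fun _ _ _ _ h z => h z

lemma BPContinuous.mul (h : BPContinuous T) (h' : BPContinuous T') : BPContinuous (T * T') := by
  intro F f C hC hF z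
  refine h (fun n => T' (F n)) (T' f) (‖T'‖ * C) (fun n => ?_) (h' F f C hC hF) z
  exact (T'.le_opNorm _).trans (by gcongr; exact hC n)

lemma BPContinuous.pow (h : BPContinuous T) (n : ℕ) : BPContinuous (T ^ n) := by
  induction n with
  | zero => simpa using BPContinuous.one
  | succ n ih => rw [pow_succ]; exact ih.mul h

lemma BPContinuous.tendsto (h : BPContinuous T) {α : Type*} {l : Filter α}
    [l.IsCountablyGenerated] {F : α → BddFun E} {f : BddFun E} {C : ℝ} (hC : ∀ n, ‖F n‖ ≤ C)
    (hF : ∀ z, Tendsto (fun n => F n z) l (𝓝 (f z))) (z : E) :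
    Tendsto (fun n => T (F n) z) l (𝓝 (T f z)) :=
  tendsto_of_seq_tendsto fun u hu => h (fun n => F (u n)) f C (fun _ => hC _)
    (fun z => (hF z).comp hu) z

lemma hasSum_exp_smul_apply (T : BddFun E →L[ℝ] BddFun E) (t : ℝ) (f : BddFun E) (z : E) :
    HasSum (fun n : ℕ => t ^ n / (n ! : ℝ) * (T ^ n) f z) (NormedSpace.exp (t • T) f z) := by
  have h := NormedSpace.exp_series_hasSum_exp' (𝕂 := ℝ) (t • T)
  have h2 := (((BddFun.eval z).comp
    (ContinuousLinearMap.apply ℝ (BddFun E) f)).hasSum h)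
  convert h2 using 2 with n
  · rw [smul_pow]
    simp only [ContinuousLinearMap.comp_apply, ContinuousLinearMap.apply_apply,
      smul_apply, BddFun.eval_apply, BddFun.smul_apply]
    ring
  · rfl

lemma norm_exp_smul_le (T : BddFun E →L[ℝ] BddFun E) (t : ℝ) :
    ‖NormedSpace.exp (t • T)‖ ≤ Real.exp (|t| * ‖T‖) := by
  have h := NormedSpace.exp_series_hasSum_exp' (𝕂 := ℝ) (t • T)
  have h2 := NormedSpace.exp_series_hasSum_exp' (𝕂 := ℝ) (|t| * ‖T‖)
  rw [← Real.exp_eq_exp_ℝ] at h2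
  rw [← h.tsum_eq, ← h2.tsum_eq]
  refine tsum_of_norm_bounded h2.summable.hasSum fun n => ?_
  rw [norm_smul, smul_eq_mul, Real.norm_of_nonneg (by positivity)]
  gcongr
  rcases n with _ | n
  · simpa using! (ContinuousLinearMap.norm_id_le (𝕜 := ℝ) (E := BddFun E))
  · refine (norm_pow_le' _ (Nat.succ_pos n)).trans ?_
    rw [norm_smul, Real.norm_eq_abs]

lemma norm_pow_apply_le (T : BddFun E →L[ℝ] BddFun E) (n : ℕ) (f : BddFun E) :
    ‖(T ^ n) f‖ ≤ ‖T‖ ^ n * ‖f‖ := by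
  induction n with
  | zero => simp
  | succ n ih =>
    rw [pow_succ', mul_apply_eq_comp]
    calc _ ≤ ‖T‖ * ‖(T ^ n) f‖ := T.le_opNorm _
      _ ≤ ‖T‖ * (‖T‖ ^ n * ‖f‖) := by gcongr
      _ = _ := by ring

lemma BPContinuous.exp (h : BPContinuous T) (t : ℝ) :
    BPContinuous (NormedSpace.exp (t • T)) := by
  intro F f C hC hF z
  simp_rw [← (hasSum_exp_smul_apply T t _ z).tsum_eq]
  have hs : Summable fun n : ℕ => (|t| * ‖T‖) ^ n / (n ! : ℝ) * C :=
    (Real.summable_pow_div_factorial _).mul_right C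
  refine tendsto_tsum_of_dominated_convergence hs
    (fun k => ((h.pow k) F f C hC hF z).const_mul _) (Eventually.of_forall fun n k => ?_)
  rw [norm_mul, norm_div, norm_pow, Real.norm_eq_abs, Real.norm_natCast, mul_pow]
  calc _ ≤ |t| ^ k / (k ! : ℝ) * (‖T‖ ^ k * C) := by
        gcongr
        exact (BddFun.abs_apply_le _ z).trans ((norm_pow_apply_le T k _).trans
          (by gcongr; exact hC n))
    _ = _ := by ring

lemma sum_smul_ind_apply (f : BddFun E) (s : Finset E) (z : E) :
    (∑ w ∈ s, f w • BddFun.ind {w}) z = (s : Set E).indicator f z := by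
  classical
  simp only [BddFun.sum_apply, BddFun.smul_apply, BddFun.ind_apply]
  by_cases hz : z ∈ s
  · rw [Finset.sum_eq_single z]
    · simp [hz]
    · intro b _ hb; simp [Set.indicator, hb.symm]
    · simp [hz]
  · rw [Set.indicator_of_notMem (by simpa using hz)]
    refine Finset.sum_eq_zero fun w hw => ?_
    have : z ≠ w := fun h => hz (h ▸ hw)
    simp [Set.indicator, this]

/-- Bounded pointwise continuity makes the operator an integral against its kernel
`(w, z) ↦ T 1_w (z)`. -/
lemma BPContinuous.hasSum_apply [Countable E] (h : BPContinuous T) (f : BddFun E) (z : E) :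
    HasSum (fun w => f w * T (BddFun.ind {w}) z) (T f z) := by
  have key := h.tendsto (l := atTop) (F := fun s : Finset E => ∑ w ∈ s, f w • BddFun.ind {w})
    (f := f) (C := ‖f‖) (fun s => ?_) (fun y => ?_) z
  · simpa [HasSum, map_sum] using key
  · refine BddFun.norm_le (norm_nonneg _) fun y => ?_
    rw [sum_smul_ind_apply]
    exact (norm_indicator_le_norm_self (f : E → ℝ) y).trans (f.abs_apply_le y)
  · simp_rw [sum_smul_ind_apply]
    refine tendsto_const_nhds.congr' ?_
    filter_upwards [eventually_ge_atTop {y}] with s hs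
    rw [Set.indicator_of_mem]
    exact Finset.mem_coe.2 (hs (Finset.mem_singleton_self y))

lemma IsSymmKernel.mul [Countable E] (h : IsSymmKernel T) (h' : IsSymmKernel T')
    (hb : BPContinuous T) (hb' : BPContinuous T') (hc : Commute T T') :
    IsSymmKernel (T * T') := by
  intro a b
  have h1 := hb.hasSum_apply (T' (BddFun.ind {a})) b
  have h2 := hb'.hasSum_apply (T (BddFun.ind {b})) a
  rw [mul_apply_eq_comp, hc.eq, mul_apply_eq_comp]
  refine h1.unique ?_
  convert h2 using 2 with w
  rw [h w b, h' a w, mul_comm]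

lemma IsSymmKernel.one : IsSymmKernel (1 : BddFun E →L[ℝ] BddFun E) :=
  fun a b => BddFun.ind_singleton_comm a b

lemma IsSymmKernel.exp [Countable E] (h : IsSymmKernel T) (hb : BPContinuous T) (t : ℝ) :
    IsSymmKernel (NormedSpace.exp (t • T)) := by
  have hp : ∀ n, IsSymmKernel (T ^ n) := fun n => by
    induction n with
    | zero => simpa using IsSymmKernel.one
    | succ n ih =>
      rw [pow_succ]; exact ih.mul h (hb.pow n) hb (Commute.pow_self T n)
  intro a b
  rw [← (hasSum_exp_smul_apply T t _ b).tsum_eq, ← (hasSum_exp_smul_apply T t _ a).tsum_eq]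
  exact tsum_congr fun n => by rw [hp n a b]

/-- A positive operator with a symmetric kernel is self-adjoint for the counting measure. -/
lemma IsSymmKernel.tsum_mul_apply [Countable E] (h : IsSymmKernel T) (hb : BPContinuous T)
    (hpos : ∀ f : BddFun E, (∀ z, 0 ≤ f z) → ∀ z, 0 ≤ T f z) {f g : BddFun E}
    (hf : ∀ z, 0 ≤ f z) (hg : ∀ z, 0 ≤ g z) :
    ∑' z, ENNReal.ofReal (f z * T g z) = ∑' z, ENNReal.ofReal (T f z * g z) := by
  have hk : ∀ w z, 0 ≤ T (BddFun.ind {w}) z := fun w z =>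
    hpos _ (fun y => Set.indicator_nonneg (fun _ _ => zero_le_one) y) z
  have key : ∀ {f : BddFun E}, (∀ z, 0 ≤ f z) → ∀ z, ENNReal.ofReal (T f z) =
      ∑' w, ENNReal.ofReal (f w) * ENNReal.ofReal (T (BddFun.ind {w}) z) := by
    intro f hf z
    have h1 := hb.hasSum_apply f z
    rw [← h1.tsum_eq, ENNReal.ofReal_tsum_of_nonneg (fun w => mul_nonneg (hf w) (hk w z))
      h1.summable]
    exact tsum_congr fun w => ENNReal.ofReal_mul (hf w)
  simp_rw [fun z => ENNReal.ofReal_mul (q := T g z) (hf z),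
    fun z => ENNReal.ofReal_mul (q := g z) (hpos f hf z), key hf, key hg,
    ← ENNReal.tsum_mul_left, ← ENNReal.tsum_mul_right]
  rw [ENNReal.tsum_comm]
  refine tsum_congr fun w => tsum_congr fun z => ?_
  rw [h w z]; ring

end Operators

/-! ### Markov semigroups of systems of jumps -/

/-- Jumps of a state in `E`: the jump `e` takes the state `z` to `act e z`, at rate `rate e`. The
total rate of the jumps that change a given state is at most `bound`. -/
structure JumpSystem (E ι : Type*) where
  /-- the rate of each jump -/
  rate : ι → ℝ≥0
  /-- the effect of each jump -/
  act : ι → E → E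
  /-- a bound for the total rate of the effective jumps out of a state -/
  bound : ℝ≥0
  sum_le : ∀ z, ∑' e, {e | act e z ≠ z}.indicator (fun e => (rate e : ℝ≥0∞)) e ≤ bound

namespace JumpSystem

variable {E ι : Type*} (D : JumpSystem E ι)

/-- The rate of the jump `e` if it changes the state `z`, and zero otherwise. -/
def moveRate (z : E) (e : ι) : ℝ := {e | D.act e z ≠ z}.indicator (fun e => (D.rate e : ℝ)) e

lemma moveRate_nonneg (z : E) (e : ι) : 0 ≤ D.moveRate z e :=
  Set.indicator_nonneg (fun _ _ => NNReal.coe_nonneg _) _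

lemma ofReal_moveRate (z : E) (e : ι) : ENNReal.ofReal (D.moveRate z e) =
    {e | D.act e z ≠ z}.indicator (fun e => (D.rate e : ℝ≥0∞)) e := by
  by_cases h : D.act e z ≠ z <;> simp [moveRate, h]

lemma summable_moveRate (z : E) : Summable (D.moveRate z) := by
  have h : ∑' e, ENNReal.ofReal (D.moveRate z e) ≠ ∞ := by
    simp_rw [ofReal_moveRate]
    exact ne_top_of_le_ne_top ENNReal.coe_ne_top (D.sum_le z)
  have := ENNReal.summable_toReal h
  simpa only [ENNReal.toReal_ofReal (D.moveRate_nonneg z _)] using this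

lemma tsum_moveRate_le (z : E) : ∑' e, D.moveRate z e ≤ D.bound := by
  have h := D.sum_le z
  simp_rw [← ofReal_moveRate] at h
  rw [← ENNReal.ofReal_tsum_of_nonneg (D.moveRate_nonneg z) (D.summable_moveRate z)] at h
  rw [← ENNReal.ofReal_coe_nnreal] at h
  exact (ENNReal.ofReal_le_ofReal_iff D.bound.coe_nonneg).1 h

lemma rate_mul_eq (z : E) (e : ι) {x : ℝ} (hx : D.act e z = z → x = 0) :
    (D.rate e : ℝ) * x = D.moveRate z e * x := by
  by_cases h : D.act e z = z
  · simp [hx h]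
  · simp [moveRate, h]

lemma abs_rate_mul_le (z : E) (e : ι) {x C : ℝ} (hx : D.act e z = z → x = 0) (hC : |x| ≤ C) :
    |(D.rate e : ℝ) * x| ≤ D.moveRate z e * C := by
  rw [D.rate_mul_eq z e hx, abs_mul, abs_of_nonneg (D.moveRate_nonneg z e)]
  exact mul_le_mul_of_nonneg_left hC (D.moveRate_nonneg z e)

lemma summable_rate_mul_sub (f : BddFun E) (z : E) :
    Summable fun e => (D.rate e : ℝ) * (f (D.act e z) - f z) :=
  Summable.of_norm_bounded ((D.summable_moveRate z).mul_right (2 * ‖f‖)) fun e =>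
    D.abs_rate_mul_le z e (fun h => by simp [h]) (f.abs_sub_le_two_mul_norm _ _)

lemma abs_tsum_rate_mul_sub_le (f : BddFun E) (z : E) :
    |∑' e, (D.rate e : ℝ) * (f (D.act e z) - f z)| ≤ 2 * D.bound * ‖f‖ := by
  have h : ∀ e, ‖(D.rate e : ℝ) * (f (D.act e z) - f z)‖ ≤ D.moveRate z e * (2 * ‖f‖) := fun e =>
    D.abs_rate_mul_le z e (fun h => by simp [h]) (f.abs_sub_le_two_mul_norm _ _)
  refine (tsum_of_norm_bounded ((D.summable_moveRate z).mul_right (2 * ‖f‖)).hasSum h).trans ?_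
  rw [tsum_mul_right]
  calc _ ≤ (D.bound : ℝ) * (2 * ‖f‖) := by gcongr; exact D.tsum_moveRate_le z
    _ = _ := by ring

/-- The generator `f ↦ ∑_e r(e) (f ∘ act e - f)` of a system of jumps. -/
def gen : BddFun E →L[ℝ] BddFun E :=
  LinearMap.mkContinuous
    { toFun := fun f => BddFun.of
        (fun z => ∑' e, (D.rate e : ℝ) * (f (D.act e z) - f z)) (2 * D.bound * ‖f‖)
        (D.abs_tsum_rate_mul_sub_le f)
      map_add' := fun f g => by
        ext z
        simp only [BddFun.of_apply, BddFun.add_apply]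
        rw [← (D.summable_rate_mul_sub f z).tsum_add (D.summable_rate_mul_sub g z)]
        exact tsum_congr fun e => by ring
      map_smul' := fun c f => by
        ext z
        simp only [BddFun.of_apply, BddFun.smul_apply, RingHom.id_apply]
        rw [← tsum_mul_left]
        exact tsum_congr fun e => by ring }
    (2 * D.bound) fun f => BddFun.norm_of_le _ _ (D.abs_tsum_rate_mul_sub_le f) (by positivity)

lemma gen_apply (f : BddFun E) (z : E) :
    D.gen f z = ∑' e, (D.rate e : ℝ) * (f (D.act e z) - f z) := rfl

lemma hasSum_gen (f : BddFun E) (z : E) :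
    HasSum (fun e => (D.rate e : ℝ) * (f (D.act e z) - f z)) (D.gen f z) :=
  (D.summable_rate_mul_sub f z).hasSum

lemma norm_gen_le : ‖D.gen‖ ≤ 2 * D.bound := LinearMap.mkContinuous_norm_le _ (by positivity) _

lemma bpContinuous_gen : BPContinuous D.gen := by
  intro F f C hC hF z
  simp_rw [gen_apply]
  refine tendsto_tsum_of_dominated_convergence ((D.summable_moveRate z).mul_right (2 * C))
    (fun e => ((hF _).sub (hF _)).const_mul _) (Eventually.of_forall fun n e => ?_)
  exact D.abs_rate_mul_le z e (fun h => by simp [h])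
    (((F n).abs_sub_le_two_mul_norm _ _).trans (by linarith [hC n]))

lemma isSymmKernel_gen (h : ∀ e z, D.act e (D.act e z) = z) : IsSymmKernel D.gen := by
  intro a b
  rw [gen_apply, gen_apply]
  refine tsum_congr fun e => ?_
  have h1 : BddFun.ind {a} (D.act e b) = BddFun.ind {b} (D.act e a) := by
    by_cases h' : D.act e b = a
    · simp [BddFun.ind_apply, ← h', h]
    · have h'' : D.act e a ≠ b := fun h'' => h' (by rw [← h'', h])
      simp [BddFun.ind_apply, h', h'']
  rw [h1, BddFun.ind_singleton_comm a b]

/-- The Markov semigroup `e^{tG}` of a system of jumps. -/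
def semi (t : ℝ) : BddFun E →L[ℝ] BddFun E := NormedSpace.exp (t • D.gen)

lemma semi_zero : D.semi 0 = 1 := by simp [semi]

lemma semi_add (s t : ℝ) : D.semi (s + t) = D.semi s * D.semi t := by
  unfold semi
  let _ : NormedAlgebra ℚ (BddFun E →L[ℝ] BddFun E) := NormedAlgebra.restrictScalars ℚ ℝ _
  rw [add_smul, NormedSpace.exp_add_of_commute]
  exact ((Commute.refl D.gen).smul_left s).smul_right t

lemma bpContinuous_semi (t : ℝ) : BPContinuous (D.semi t) := D.bpContinuous_gen.exp t

lemma hasDerivAt_semi (t : ℝ) : HasDerivAt D.semi (D.semi t * D.gen) t :=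
  hasDerivAt_exp_smul_const D.gen t

lemma hasDerivAt_semi' (t : ℝ) : HasDerivAt D.semi (D.gen * D.semi t) t :=
  hasDerivAt_exp_smul_const' D.gen t

lemma continuous_semi : Continuous D.semi :=
  continuous_iff_continuousAt.2 fun t => (D.hasDerivAt_semi t).continuousAt

/-- A function killed by the generator is invariant. -/
lemma semi_apply_of_gen_eq_zero {f : BddFun E} (hf : D.gen f = 0) (t : ℝ) : D.semi t f = f := by
  ext z
  refine (hasSum_exp_smul_apply D.gen t f z).unique ?_
  convert hasSum_single (f := fun n : ℕ => t ^ n / (n ! : ℝ) * (D.gen ^ n) f z) 0 ?_ using 1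
  · simp
  · intro n hn
    obtain ⟨m, rfl⟩ := Nat.exists_eq_succ_of_ne_zero hn
    simp [pow_succ, hf]

/-- A map that intertwines the jumps intertwines the semigroups. -/
lemma semi_comp {E' : Type*} (D' : JumpSystem E' ι)
    (π : E → E') (hrate : D.rate = D'.rate) (hπ : ∀ e z, π (D.act e z) = D'.act e (π z))
    {f : BddFun E} {g : BddFun E'} (hfg : ∀ z, f z = g (π z)) (t : ℝ) (z : E) :
    D.semi t f z = D'.semi t g (π z) := by
  have hpow : ∀ n, ∀ z, (D.gen ^ n) f z = (D'.gen ^ n) g (π z) := fun n => by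
    induction n with
    | zero => simpa using hfg
    | succ n ih =>
      intro z
      simp only [pow_succ', mul_apply_eq_comp, gen_apply, hrate, ih, hπ]
  refine (hasSum_exp_smul_apply D.gen t f z).unique ?_
  simp_rw [hpow]
  exact hasSum_exp_smul_apply D'.gen t g (π z)

end JumpSystem

/-! ### Paths driven by clocks, and their discretization -/

namespace JumpSystem

variable {E ι : Type*} (D : JumpSystem E ι)

/-- `z` is a path of the system of jumps when the jump `e` is attempted at the times in `R e`: it
is right-continuous and piecewise constant, and if exactly one of the attempted jumps at time `t`
would change the left limit, then the path makes this jump; if there is none, it stays. Nothing is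
required if there are several, which has probability zero for independent Poisson clocks. -/
structure IsPath (R : ι → Set ℝ≥0) (z : ℝ≥0 → E) : Prop where
  right_continuous : ∀ t, ∀ᶠ s in 𝓝[>] t, z s = z t
  jump : ∀ t, 0 < t → ∃ w, (∀ᶠ s in 𝓝[<] t, z s = w) ∧
    (∀ e, t ∈ R e → D.act e w ≠ w → (∀ e', t ∈ R e' → D.act e' w ≠ w → e' = e) →
      z t = D.act e w) ∧
    ((∀ e, t ∈ R e → D.act e w = w) → z t = w)

variable {D} {R : ι → Set ℝ≥0} {z : ℝ≥0 → E}

/-- A path stays where it is as long as no jump that would move it is attempted. -/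
lemma IsPath.eq_of_no_jump (h : D.IsPath R z) {s u : ℝ≥0} (hsu : s ≤ u)
    (hR : ∀ e, D.act e (z s) ≠ z s → ∀ τ ∈ R e, s < τ → u < τ) : z u = z s := by
  -- the first time at which the path differs from `z s`
  by_contra hne
  set B : Set ℝ≥0 := {v | s ≤ v ∧ z v ≠ z s} with hB
  have hBu : u ∈ B := ⟨hsu, hne⟩
  have hbdd : BddBelow B := OrderBot.bddBelow B
  set τ := sInf B with hτ
  have hτu : τ ≤ u := csInf_le hbdd hBu
  have hsτ : s ≤ τ := le_csInf ⟨u, hBu⟩ fun v hv => hv.1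
  have hbefore : ∀ v, s ≤ v → v < τ → z v = z s := fun v hv hvτ => by
    by_contra hv'
    exact absurd (csInf_le hbdd ⟨hv, hv'⟩) (not_le.2 hvτ)
  have hzτ : z τ = z s := by
    rcases hsτ.eq_or_lt with h0 | h0
    · rw [← h0]
    · obtain ⟨w, hw, -, hstay⟩ := h.jump τ (lt_of_le_of_lt (zero_le) h0)
      have : NeBot (𝓝[<] τ) := nhdsLT_neBot_of_exists_lt ⟨s, h0⟩
      have hw' : z s = w := by
        have h2 : ∀ᶠ v in 𝓝[<] τ, s < v :=
          Filter.mem_of_superset (Ioo_mem_nhdsLT h0) fun v hv => hv.1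
        obtain ⟨v, hv1, hv2, hv3⟩ := (hw.and (h2.and self_mem_nhdsWithin)).exists
        rw [← hv1, hbefore v hv2.le hv3]
      rw [hw']
      refine hstay fun e he => ?_
      by_contra hmove
      rw [← hw'] at hmove
      exact absurd (hR e hmove τ he h0) (not_lt.2 hτu)
  have hr := h.right_continuous τ
  rw [hzτ] at hr
  have hτlt : τ < u := lt_of_le_of_ne hτu fun heq => hne (heq ▸ hzτ)
  obtain ⟨b, hb, hb'⟩ := (mem_nhdsGT_iff_exists_Ioo_subset' hτlt).1 hr
  have : b ≤ sInf B := le_csInf ⟨u, hBu⟩ fun v hv => by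
    by_contra hvb
    push Not at hvb
    have hτv : τ ≤ v := csInf_le hbdd hv
    rcases hτv.eq_or_lt with h0 | h0
    · exact hv.2 (h0 ▸ hzτ)
    · exact hv.2 (hb' ⟨h0, hvb⟩)
  exact absurd this (not_le.2 hb)

/-- A path makes the only relevant jump that is attempted over a period of time. -/
lemma IsPath.eq_act_of_jump (h : D.IsPath R z) {s τ : ℝ≥0} (hsτ : s < τ) {e : ι} (he : τ ∈ R e)
    (hmove : D.act e (z s) ≠ z s)
    (hR : ∀ e', D.act e' (z s) ≠ z s → ∀ τ' ∈ R e', s < τ' → τ' ≤ τ → e' = e ∧ τ' = τ) :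
    z τ = D.act e (z s) := by
  obtain ⟨w, hw, hjump, -⟩ := h.jump τ (lt_of_le_of_lt (zero_le) hsτ)
  have : NeBot (𝓝[<] τ) := nhdsLT_neBot_of_exists_lt ⟨s, hsτ⟩
  have hw' : z s = w := by
    have h2 : ∀ᶠ v in 𝓝[<] τ, s < v :=
      Filter.mem_of_superset (Ioo_mem_nhdsLT hsτ) fun v hv => hv.1
    obtain ⟨v, hv1, hv2, hv3⟩ := (hw.and (h2.and self_mem_nhdsWithin)).exists
    rw [← hv1]
    refine (h.eq_of_no_jump hv2.le fun e' he' τ' hτ' hs => ?_).symm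
    by_contra hle
    push Not at hle
    have := (hR e' he' τ' hτ' hs (hle.trans (le_of_lt hv3))).2
    exact absurd hle (not_le.2 (this ▸ hv3))
  rw [hw'] at hmove hR ⊢
  exact hjump e he hmove fun e' he' hm => (hR e' hm τ he' hsτ le_rfl).1

/-- A path visits finitely many states in a bounded period of time, by compactness. -/
lemma IsPath.finite_image (h : D.IsPath R z) (t : ℝ≥0) : (z '' Set.Icc 0 t).Finite := by
  have key : ∀ x ∈ Set.Icc 0 t, ∃ U ∈ 𝓝[Set.Icc 0 t] x, (z '' U).Finite := by
    intro x _
    have h1 : ∃ U ∈ 𝓝[>] x, z '' U ⊆ {z x} :=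
      ⟨_, h.right_continuous x, by rintro _ ⟨s, hs, rfl⟩; exact hs⟩
    have h2 : ∃ U ∈ 𝓝[<] x, (z '' U).Finite := by
      rcases eq_or_lt_of_le (zero_le : 0 ≤ x) with h0 | h0
      · refine ⟨∅, ?_, by simp⟩
        have : Set.Iio x = ∅ := by
          rw [← h0]
          exact Set.eq_empty_of_forall_notMem fun y hy => absurd (Set.mem_Iio.1 hy) not_lt_zero
        rw [this, nhdsWithin_empty]
        exact mem_bot
      · obtain ⟨w, hw, -⟩ := h.jump x h0
        exact ⟨_, hw, (Set.finite_singleton w).subset (by rintro _ ⟨s, hs, rfl⟩; exact hs)⟩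
    obtain ⟨U1, hU1, hf1⟩ := h1
    obtain ⟨U2, hU2, hf2⟩ := h2
    refine ⟨U2 ∪ {x} ∪ U1, mem_nhdsWithin_of_mem_nhds ?_, ?_⟩
    · rw [← nhdsLT_sup_nhdsGE, ← Set.Ioi_insert, nhdsWithin_insert]
      refine ⟨Filter.mem_of_superset hU2 fun y hy => Or.inl (Or.inl hy), ?_, ?_⟩
      · exact Or.inl (Or.inr rfl)
      · exact Filter.mem_of_superset hU1 fun y hy => Or.inr hy
    · rw [Set.image_union, Set.image_union]
      exact (hf2.union ((Set.finite_singleton x).image z)).union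
        ((Set.finite_singleton _).subset hf1)
  exact isCompact_Icc.induction_on (p := fun U => (z '' U).Finite) (by simp)
    (fun s t hst ht => ht.subset (Set.image_mono hst))
    (fun s t hs ht => by rw [Set.image_union]; exact hs.union ht) key

variable (D)

open Classical in
/-- The state after a time step from the state `w` in which the jumps in `ρ` are attempted: if
exactly one of them changes `w`, then it takes place; otherwise nothing happens. -/
def step (w : E) (ρ : Set ι) : E :=
  if h : ∃! e, e ∈ ρ ∧ D.act e w ≠ w then D.act h.choose w else w

lemma step_of_unique {w : E} {ρ : Set ι} {e : ι} (he : e ∈ ρ) (hm : D.act e w ≠ w)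
    (hu : ∀ e' ∈ ρ, D.act e' w ≠ w → e' = e) : D.step w ρ = D.act e w := by
  have h : ∃! e, e ∈ ρ ∧ D.act e w ≠ w := ⟨e, ⟨he, hm⟩, fun e' h' => hu e' h'.1 h'.2⟩
  have h2 : h.choose = e := hu _ h.choose_spec.1.1 h.choose_spec.1.2
  rw [step, dif_pos h, h2]

lemma step_of_not {w : E} {ρ : Set ι} (h : ¬ ∃! e, e ∈ ρ ∧ D.act e w ≠ w) : D.step w ρ = w := by
  rw [step, dif_neg h]

/-- The chain that moves by `step`, with the jumps in `ρ k` attempted in the `k`-th step. -/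
def chain (w : E) (ρ : ℕ → Set ι) : ℕ → E
  | 0 => w
  | k + 1 => D.step (chain w ρ k) (ρ k)

variable {D}

/-- For a fine mesh the discrete chain agrees with the path. -/
lemma IsPath.eventually_chain_eq (h : D.IsPath R z) (t : ℝ≥0)
    (hfin : ∀ w, {e | D.act e w ≠ w ∧ ∃ τ ∈ R e, τ ≤ t}.Finite)
    (hfin' : ∀ e, {τ ∈ R e | τ ≤ t}.Finite)
    (hsim : ∀ e e', e ≠ e' → ∀ τ ∈ R e, τ ≤ t → τ ∉ R e') :
    ∀ᶠ n : ℕ in atTop, D.chain (z 0)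
      (fun k => {e | ∃ τ ∈ R e, k * (t / n) < τ ∧ τ ≤ (k + 1 : ℕ) * (t / n)}) n = z t := by
  -- only the jumps in the finite set `J` matter, and they are attempted at the finitely many times
  -- in `T`, which have a least distance `δ`
  have hW := h.finite_image t
  set W := z '' Set.Icc 0 t with hWdef
  set J : Set ι := ⋃ w ∈ W, {e | D.act e w ≠ w ∧ ∃ τ ∈ R e, τ ≤ t} with hJdef
  have hJ : J.Finite := hW.biUnion fun w _ => hfin w
  set T : Set ℝ≥0 := ⋃ e ∈ J, {τ ∈ R e | τ ≤ t} with hTdef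
  have hT : T.Finite := hJ.biUnion fun e _ => hfin' e
  obtain ⟨δ, hδ, hgap⟩ : ∃ δ : ℝ, 0 < δ ∧ ∀ x ∈ T, ∀ y ∈ T, x ≠ y → δ ≤ dist x y := by
    by_cases hnt : T.Nontrivial
    · exact ⟨T.infsep, hT.infsep_pos_iff_nontrivial.2 hnt, fun x hx y hy hxy =>
        by
        have : Finite T := hT
        exact Set.infsep_le_dist_of_mem hx hy hxy⟩
    · exact ⟨1, one_pos, fun x hx y hy hxy =>
        absurd (Set.not_nontrivial_iff.1 hnt hx hy) hxy⟩
  have hlim : Tendsto (fun n : ℕ => (t : ℝ) / n) atTop (𝓝 0) :=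
    tendsto_const_div_atTop_nhds_zero_nat _
  filter_upwards [hlim.eventually_lt_const hδ, eventually_gt_atTop 0] with n hn hn0
  have hn0' : (n : ℝ≥0) ≠ 0 := by exact_mod_cast hn0.ne'
  have hmul : (n : ℝ≥0) * (t / n) = t := mul_div_cancel₀ t hn0'
  set d : ℝ≥0 := t / n with hd
  have hle : ∀ k ≤ n, (k : ℝ≥0) * d ≤ t := fun k hk => by
    rw [← hmul]; gcongr
  have hsucc : ∀ k : ℕ, ((k + 1 : ℕ) : ℝ≥0) * d = k * d + d := fun k => by push_cast; ring
  have hmemJ : ∀ v ≤ t, ∀ e, D.act e (z v) ≠ z v → ∀ τ ∈ R e, τ ≤ t → e ∈ J := by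
    intro v hv e hm τ hτ hτt
    exact Set.mem_biUnion (⟨v, ⟨zero_le, hv⟩, rfl⟩ : z v ∈ W) ⟨hm, τ, hτ, hτt⟩
  -- at most one relevant attempt in each interval
  have huniq : ∀ s, s + d ≤ t → ∀ e ∈ J, ∀ e' ∈ J, ∀ τ ∈ R e, ∀ τ' ∈ R e', s < τ → τ ≤ s + d →
      s < τ' → τ' ≤ s + d → e' = e ∧ τ' = τ := by
    intro s hs e he e' he' τ hτ τ' hτ' h1 h2 h3 h4
    have hττ : τ' = τ := by
      by_contra hne
      have hT1 : τ ∈ T := Set.mem_biUnion he ⟨hτ, h2.trans hs⟩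
      have hT2 : τ' ∈ T := Set.mem_biUnion he' ⟨hτ', h4.trans hs⟩
      have hg := hgap τ' hT2 τ hT1 hne
      rw [NNReal.dist_eq] at hg
      have h1' : (s : ℝ) < τ := h1
      have h2' : (τ : ℝ) ≤ s + d := by exact_mod_cast h2
      have h3' : (s : ℝ) < τ' := h3
      have h4' : (τ' : ℝ) ≤ s + d := by exact_mod_cast h4
      have hn' : (d : ℝ) < δ := by simpa [hd] using hn
      have : |(τ' : ℝ) - τ| < δ := by rw [abs_lt]; constructor <;> linarith
      linarith
    refine ⟨?_, hττ⟩
    by_contra hne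
    exact hsim e' e hne τ' hτ' (h4.trans hs) (hττ ▸ hτ)
  have main : ∀ k ≤ n, D.chain (z 0)
      (fun k => {e | ∃ τ ∈ R e, k * d < τ ∧ τ ≤ (k + 1 : ℕ) * d}) k = z (k * d) := by
    intro k
    induction k with
    | zero => intro _; simp [chain]
    | succ k ih =>
      intro hk
      rw [chain, ih (by omega)]
      have hkt : k * d + d ≤ t := by rw [← hsucc]; exact hle _ hk
      have hkt' : k * d ≤ t := hle _ (by omega)
      rw [hsucc k]
      by_cases hex : ∃ e, (∃ τ ∈ R e, k * d < τ ∧ τ ≤ k * d + d) ∧ D.act e (z (k * d)) ≠ z (k * d)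
      · obtain ⟨e, ⟨τ, hτ, h1, h2⟩, hm⟩ := hex
        have heJ := hmemJ _ hkt' e hm τ hτ (h2.trans hkt)
        have hu : ∀ e', D.act e' (z (k * d)) ≠ z (k * d) → ∀ τ' ∈ R e', k * d < τ' →
            τ' ≤ k * d + d → e' = e ∧ τ' = τ := fun e' hm' τ' hτ' h3 h4 =>
          huniq _ hkt e heJ e' (hmemJ _ hkt' e' hm' τ' hτ' (h4.trans hkt)) τ hτ τ' hτ' h1 h2 h3 h4
        rw [D.step_of_unique (e := e) (by exact ⟨τ, hτ, h1, h2⟩) hm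
          (by rintro e' ⟨τ', hτ', h3, h4⟩ hm'; exact (hu e' hm' τ' hτ' h3 h4).1)]
        have hzτ := h.eq_act_of_jump h1 hτ hm
          fun e' hm' τ' hτ' h3 h4 => hu e' hm' τ' hτ' h3 (h4.trans h2)
        rw [← hzτ]
        refine (h.eq_of_no_jump h2 fun e' hm' τ' hτ' h3 => ?_).symm
        by_contra h4
        push Not at h4
        have he'J := hmemJ τ (h2.trans hkt) e' hm' τ' hτ' (h4.trans hkt)
        exact absurd (huniq _ hkt e heJ e' he'J τ hτ τ' hτ' h1 h2 (h1.trans h3) h4).2 h3.ne'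
      · rw [D.step_of_not]
        · refine (h.eq_of_no_jump le_self_add fun e hm τ hτ h1 => ?_).symm
          by_contra h2
          push Not at h2
          exact hex ⟨e, ⟨τ, hτ, h1, h2⟩, hm⟩
        · rintro ⟨e, ⟨⟨τ, hτ, h1, h2⟩, hm⟩, -⟩
          exact hex ⟨e, ⟨τ, hτ, h1, h2⟩, hm⟩
  rw [main n le_rfl, hmul]

end JumpSystem

/-! ### Ring times of Poisson clocks -/

section Clocks

/-- A counting process has a jump in `(s, u]` if and only if it increases. -/
lemma exists_ringTime_iff {f : ℝ≥0 → ℕ} (hmono : Monotone f)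
    (hcont : ∀ t, ∀ᶠ s in 𝓝[>] t, f s = f t) {s u : ℝ≥0} :
    (∃ τ, (0 < τ ∧ ∀ v < τ, f v < f τ) ∧ s < τ ∧ τ ≤ u) ↔ f s < f u := by
  constructor
  · rintro ⟨τ, ⟨-, hτ⟩, h1, h2⟩
    exact (hτ s h1).trans_le (hmono h2)
  intro h
  -- the first time at which the counting process exceeds its value at `s`
  set B : Set ℝ≥0 := {v | f s < f v} with hB
  have hBu : u ∈ B := h
  have hbdd : BddBelow B := OrderBot.bddBelow B
  set τ := sInf B
  have hτu : τ ≤ u := csInf_le hbdd hBu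
  have hsB : ∀ v ∈ B, s < v := fun v hv => by
    by_contra hvs
    exact absurd (hmono (not_lt.1 hvs)) (not_le.2 hv)
  have hsτ : s ≤ τ := le_csInf ⟨u, hBu⟩ fun v hv => (hsB v hv).le
  have hτB : f s < f τ := by
    by_contra hle
    have heq : f τ = f s := le_antisymm (not_lt.1 hle) (hmono hsτ)
    have hr := hcont τ
    have hτlt : τ < u := lt_of_le_of_ne hτu fun h' => by rw [h'] at heq; omega
    obtain ⟨b, hb, hb'⟩ := (mem_nhdsGT_iff_exists_Ioo_subset' hτlt).1 hr
    have : b ≤ τ := le_csInf ⟨u, hBu⟩ fun v hv => by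
      by_contra hvb
      push Not at hvb
      have hvτ : τ ≤ v := csInf_le hbdd hv
      have hv' : f s < f v := hv
      rcases hvτ.eq_or_lt with h0 | h0
      · rw [← h0] at hv'; omega
      · have h5 : f v = f τ := hb' ⟨h0, hvb⟩
        omega
    exact absurd this (not_le.2 hb)
  have hlt : s < τ := hsB τ hτB
  refine ⟨τ, ⟨lt_of_le_of_lt zero_le hlt, fun v hv => ?_⟩, hlt, hτu⟩
  have : v ∉ B := fun hvB => absurd (csInf_le hbdd hvB) (not_le.2 hv)
  exact (not_lt.1 this).trans_lt hτB

variable {Ω : Type*}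

lemma finite_ringTimes_inter {N : ℝ≥0 → Ω → ℕ} {ω : Ω} (hmono : Monotone fun t => N t ω)
    (t : ℝ≥0) : {τ ∈ ringTimes N ω | τ ≤ t}.Finite := by
  refine Set.Finite.of_finite_image (f := fun τ => N τ ω)
    ((Set.finite_Iic (N t ω)).subset ?_) ?_
  · rintro _ ⟨τ, hτ, rfl⟩
    exact hmono hτ.2
  · intro τ hτ τ' hτ' heq
    rcases lt_trichotomy τ τ' with h | h | h
    · exact absurd heq (hτ'.1.2 τ h).ne
    · exact h
    · exact absurd heq (hτ.1.2 τ' h).ne'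

lemma exp_neg_bounds {x : ℝ} (hx : 0 ≤ x) :
    1 - Real.exp (-x) ≤ x ∧ x - x ^ 2 ≤ 1 - Real.exp (-x) := by
  constructor
  · linarith [Real.add_one_le_exp (-x)]
  · by_cases h1 : x ≤ 1
    · have := Real.abs_exp_sub_one_sub_id_le (x := -x) (by rw [abs_neg, abs_of_nonneg hx]; exact h1)
      have := (abs_le.1 this).2
      nlinarith
    · have : Real.exp (-x) ≤ 1 := Real.exp_le_one_iff.2 (by linarith)
      nlinarith

namespace IsPoissonProcess

variable [MeasurableSpace Ω] {P : Measure Ω} {N : ℝ≥0 → Ω → ℕ} {r : ℝ≥0}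

lemma measurableSet_lt (h : IsPoissonProcess N r P) (s t : ℝ≥0) :
    MeasurableSet {ω | N s ω < N t ω} := _root_.measurableSet_lt (h.measurable s) (h.measurable t)

lemma measureReal_lt (h : IsPoissonProcess N r P) {s t : ℝ≥0} (hst : s ≤ t) :
    P.real {ω | N s ω < N t ω} = 1 - Real.exp (-(r * (t - s) : ℝ≥0)) := by
  have hm : Measurable fun ω => N t ω - N s ω := (h.measurable t).sub (h.measurable s)
  have h1 : {ω | N s ω < N t ω} = (fun ω => N t ω - N s ω) ⁻¹' {0}ᶜ := by
    ext ω; simp; omega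
  rw [h1, ← map_measureReal_apply hm (measurableSet_singleton 0).compl, h.law_increments s t hst,
    probReal_compl_eq_one_sub (measurableSet_singleton 0), poissonMeasure_real_singleton]
  simp

lemma measureReal_lt_le (h : IsPoissonProcess N r P) {s t : ℝ≥0} (hst : s ≤ t) :
    P.real {ω | N s ω < N t ω} ≤ r * (t - s : ℝ≥0) := by
  rw [h.measureReal_lt hst]
  exact_mod_cast (exp_neg_bounds (NNReal.coe_nonneg _)).1

lemma le_measureReal_lt (h : IsPoissonProcess N r P) {s t : ℝ≥0} (hst : s ≤ t) :
    r * (t - s : ℝ≥0) - (r * (t - s : ℝ≥0) : ℝ) ^ 2 ≤ P.real {ω | N s ω < N t ω} := by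
  rw [h.measureReal_lt hst]
  exact_mod_cast (exp_neg_bounds (NNReal.coe_nonneg _)).2

end IsPoissonProcess

end Clocks

/-! ### The Euler scheme -/

namespace JumpSystem

variable {E ι : Type*} (D : JumpSystem E ι) {Ω : Type*} [MeasurableSpace Ω] {P : Measure Ω}
  [IsProbabilityMeasure P]

/-- A random set of attempted jumps over a time step of length `h`: the attempts are pairwise
independent, with the probabilities of Poisson clocks up to second order in `h`. -/
structure IsAttemptSet (ρ : Ω → Set ι) (h : ℝ) (P : Measure Ω) : Prop where
  measurableSet : ∀ e, MeasurableSet {ω | e ∈ ρ ω}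
  prob_le : ∀ e, P.real {ω | e ∈ ρ ω} ≤ D.rate e * h
  le_prob : ∀ e, D.rate e * h - (D.rate e * h) ^ 2 ≤ P.real {ω | e ∈ ρ ω}
  prob_inter_le : ∀ e e', e ≠ e' →
    P.real {ω | e ∈ ρ ω ∧ e' ∈ ρ ω} ≤ P.real {ω | e ∈ ρ ω} * P.real {ω | e' ∈ ρ ω}

variable {D} [Countable ι]

lemma measurableSet_unique_attempt {Ω : Type*} [MeasurableSpace Ω] {ρ : Ω → Set ι}
    (hρ : ∀ e, MeasurableSet {ω | e ∈ ρ ω}) (w : E) (e : ι) :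
    MeasurableSet {ω | e ∈ ρ ω ∧ D.act e w ≠ w ∧ ∀ e', e' ∈ ρ ω → D.act e' w ≠ w → e' = e} := by
  have : {ω | e ∈ ρ ω ∧ D.act e w ≠ w ∧ ∀ e', e' ∈ ρ ω → D.act e' w ≠ w → e' = e} =
      {ω | e ∈ ρ ω} ∩ ({_ω | D.act e w ≠ w} ∩
      ⋂ e', ({ω | e' ∈ ρ ω}ᶜ ∪ {_ω | D.act e' w ≠ w → e' = e})) := by
    ext ω; simp [imp_iff_not_or]
  rw [this]
  exact (hρ e).inter ((MeasurableSet.const _).inter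
    (MeasurableSet.iInter fun e' => (hρ e').compl.union (MeasurableSet.const _)))

lemma measurable_step {Ω : Type*} [MeasurableSpace Ω] [MeasurableSpace E] [Countable E]
    {ρ : Ω → Set ι} (hρ : ∀ e, MeasurableSet {ω | e ∈ ρ ω}) (w : E) :
    Measurable fun ω => D.step w (ρ ω) := by
  refine measurable_to_countable' fun x => ?_
  set A : ι → Set Ω := fun e =>
    {ω | e ∈ ρ ω ∧ D.act e w ≠ w ∧ ∀ e', e' ∈ ρ ω → D.act e' w ≠ w → e' = e} with hA
  have hAm : ∀ e, MeasurableSet (A e) := measurableSet_unique_attempt hρ w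
  have : (fun ω => D.step w (ρ ω)) ⁻¹' {x} =
      (⋃ e, (A e ∩ {_ω | D.act e w = x})) ∪ ((⋃ e, A e)ᶜ ∩ {_ω | w = x}) := by
    ext ω
    by_cases hex : ∃ e, ω ∈ A e
    · obtain ⟨e, he⟩ := hex
      have h1 : D.step w (ρ ω) = D.act e w := D.step_of_unique he.1 he.2.1 he.2.2
      simp only [Set.mem_preimage, h1, Set.mem_singleton_iff, Set.mem_union, Set.mem_iUnion,
        Set.mem_inter_iff, Set.mem_compl_iff, Set.mem_ofPred_eq]
      constructor
      · exact fun h => Or.inl ⟨e, he, h⟩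
      · rintro (⟨e', he', h⟩ | ⟨h, -⟩)
        · rwa [← he.2.2 e' he'.1 he'.2.1]
        · exact absurd ⟨e, he⟩ h
    · have h1 : D.step w (ρ ω) = w := D.step_of_not fun ⟨e, h2, h3⟩ =>
        hex ⟨e, h2.1, h2.2, fun e' h4 h5 => h3 e' ⟨h4, h5⟩⟩
      simp only [Set.mem_preimage, h1, Set.mem_singleton_iff, Set.mem_union, Set.mem_iUnion,
        Set.mem_inter_iff, Set.mem_compl_iff, Set.mem_ofPred_eq]
      constructor
      · exact fun h => Or.inr ⟨hex, h⟩
      · rintro (⟨e', he', h⟩ | ⟨-, h⟩)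
        · exact absurd ⟨e', he'⟩ hex
        · exact h
  rw [this]
  exact (MeasurableSet.iUnion fun e => (hAm e).inter (MeasurableSet.const _)).union
    ((MeasurableSet.iUnion hAm).compl.inter (MeasurableSet.const _))

/-- One step of the chain agrees with the generator up to an error of second order. -/
lemma IsAttemptSet.abs_integral_step_sub_le {ρ : Ω → Set ι} {h : ℝ} (hh : 0 ≤ h)
    (hρ : D.IsAttemptSet ρ h P) (f : BddFun E) (w : E) :
    |∫ ω, f (D.step w (ρ ω)) ∂P - (f w + h * D.gen f w)| ≤ 4 * (D.bound * h) ^ 2 * ‖f‖ := by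
  -- the event that `e` is the only attempted jump that changes `w`
  set A : ι → Set Ω := fun e =>
    {ω | e ∈ ρ ω ∧ D.act e w ≠ w ∧ ∀ e', e' ∈ ρ ω → D.act e' w ≠ w → e' = e} with hA
  have hAmeas : ∀ e, MeasurableSet (A e) := measurableSet_unique_attempt hρ.measurableSet w
  have hAρ : ∀ e, P.real (A e) ≤ P.real {ω | e ∈ ρ ω} := fun e =>
    measureReal_mono fun ω hω => hω.1
  have hK : ∀ e, 0 ≤ (D.rate e : ℝ) * h := fun e => mul_nonneg (NNReal.coe_nonneg _) hh
  have hbound : ∀ v, ∑' e, D.moveRate v e ≤ D.bound := D.tsum_moveRate_le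
  have hrate : ∀ e, D.act e w ≠ w → (D.rate e : ℝ) = D.moveRate w e := fun e he => by
    simp [moveRate, he]
  have hrate_le : ∀ e, D.act e w ≠ w → (D.rate e : ℝ) ≤ D.bound := fun e he => by
    rw [hrate e he]
    exact ((D.summable_moveRate w).le_tsum e fun e' _ => D.moveRate_nonneg w e').trans (hbound w)
  -- the event differs from the event that `e` is attempted by a second-order probability
  have hAlow : ∀ e, D.act e w ≠ w →
      P.real {ω | e ∈ ρ ω} - D.rate e * h * (D.bound * h) ≤ P.real (A e) := by
    intro e he
    set C : ι → Set Ω := fun e' => {ω | e ∈ ρ ω ∧ e' ∈ ρ ω ∧ D.act e' w ≠ w ∧ e' ≠ e}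
    have hC : ∀ e', P.real (C e') ≤ D.rate e * h * (D.moveRate w e' * h) := by
      intro e'
      by_cases hcase : D.act e' w ≠ w ∧ e' ≠ e
      · calc P.real (C e') ≤ P.real {ω | e ∈ ρ ω ∧ e' ∈ ρ ω} :=
              measureReal_mono fun ω hω => ⟨hω.1, hω.2.1⟩
          _ ≤ _ := hρ.prob_inter_le e e' hcase.2.symm
          _ ≤ _ := by
            rw [← hrate e' hcase.1]
            exact mul_le_mul (hρ.prob_le e) (hρ.prob_le e') measureReal_nonneg (hK e)
      · have : C e' = ∅ := by
          ext ω; simp only [C, Set.mem_ofPred_eq, Set.mem_empty_iff_false, iff_false]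
          exact fun hω => hcase hω.2.2
        rw [this, measureReal_empty]
        exact mul_nonneg (hK e) (mul_nonneg (D.moveRate_nonneg _ _) hh)
    have hsum : Summable fun e' => D.rate e * h * (D.moveRate w e' * h) :=
      ((D.summable_moveRate w).mul_right h).mul_left _
    have hunion : P.real (⋃ e', C e') ≤ D.rate e * h * (D.bound * h) := by
      have h1 : P (⋃ e', C e') ≤ ENNReal.ofReal (∑' e', D.rate e * h * (D.moveRate w e' * h)) := by
        rw [ENNReal.ofReal_tsum_of_nonneg (fun e' => measureReal_nonneg.trans (hC e')) hsum]
        refine (measure_iUnion_le C).trans (ENNReal.tsum_le_tsum fun e' => ?_)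
        rw [← ofReal_measureReal]
        exact ENNReal.ofReal_le_ofReal (hC e')
      have h2 := ENNReal.toReal_mono ENNReal.ofReal_ne_top h1
      rw [ENNReal.toReal_ofReal (tsum_nonneg fun e' => measureReal_nonneg.trans (hC e'))] at h2
      refine h2.trans ?_
      rw [tsum_mul_left, tsum_mul_right]
      exact mul_le_mul_of_nonneg_left (mul_le_mul_of_nonneg_right (hbound w) hh) (hK e)
    have hcover : {ω | e ∈ ρ ω} ⊆ A e ∪ ⋃ e', C e' := by
      intro ω hω
      by_cases hu : ∀ e', e' ∈ ρ ω → D.act e' w ≠ w → e' = e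
      · exact Or.inl ⟨hω, he, hu⟩
      · push Not at hu
        obtain ⟨e', h1, h2, h3⟩ := hu
        exact Or.inr (Set.mem_iUnion.2 ⟨e', hω, h1, h2, h3⟩)
    have := (measureReal_mono hcover (μ := P)).trans (measureReal_union_le _ _)
    linarith
  set c : ι → ℝ := fun e => f (D.act e w) - f w with hc
  have hc0 : ∀ e, D.act e w = w → c e = 0 := fun e he => by simp [hc, he]
  have hcle : ∀ e, |c e| ≤ 2 * ‖f‖ := fun e => f.abs_sub_le_two_mul_norm _ _
  have hpoint : ∀ ω, f (D.step w (ρ ω)) - f w = ∑' e, (A e).indicator (fun _ => c e) ω := by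
    intro ω
    by_cases hex : ∃! e, e ∈ ρ ω ∧ D.act e w ≠ w
    · obtain ⟨e, ⟨he, hm⟩, hu⟩ := hex
      have hωA : ω ∈ A e := ⟨he, hm, fun e' h1 h2 => hu e' ⟨h1, h2⟩⟩
      rw [D.step_of_unique he hm fun e' h1 h2 => hu e' ⟨h1, h2⟩, tsum_eq_single e,
        Set.indicator_of_mem hωA]
      intro e' hne
      exact Set.indicator_of_notMem (fun hω' => hne (hu e' ⟨hω'.1, hω'.2.1⟩)) _
    · rw [D.step_of_not hex, sub_self, eq_comm]
      convert tsum_zero with e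
      refine Set.indicator_of_notMem (fun hω' => hex ⟨e, ⟨hω'.1, hω'.2.1⟩, ?_⟩) _
      exact fun e' h' => hω'.2.2 e' h'.1 h'.2
  have hterm_le : ∀ e, |P.real (A e) * c e| ≤ D.moveRate w e * (h * (2 * ‖f‖)) := by
    intro e
    by_cases he : D.act e w = w
    · rw [hc0 e he, mul_zero, abs_zero]
      exact mul_nonneg (D.moveRate_nonneg _ _) (mul_nonneg hh (by positivity))
    · rw [abs_mul, abs_of_nonneg measureReal_nonneg, ← hrate e he, ← mul_assoc]
      exact mul_le_mul ((hAρ e).trans (hρ.prob_le e)) (hcle e) (abs_nonneg _) (hK e)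
  have hint : ∀ e, ∫ ω, (A e).indicator (fun _ => c e) ω ∂P = P.real (A e) * c e := fun e => by
    rw [integral_indicator_const _ (hAmeas e), smul_eq_mul]
  have hsumA : HasSum (fun e => P.real (A e) * c e) (∫ ω, f (D.step w (ρ ω)) ∂P - f w) := by
    have key := hasSum_integral_of_summable_integral_norm (μ := P)
      (F := fun e ω => (A e).indicator (fun _ => c e) ω)
      (fun e => (integrable_const _).indicator (hAmeas e)) ?_
    · simp_rw [hint, ← hpoint] at key
      -- the integrand is a limit of measurable functions
      have hm : AEStronglyMeasurable (fun ω => f (D.step w (ρ ω)) - f w) P := by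
        simp_rw [hpoint]
        exact (Measurable.tsum (f := fun e ω => (A e).indicator (fun _ => c e) ω)
          fun e => measurable_const.indicator (hAmeas e)).aestronglyMeasurable
      have hm' : AEStronglyMeasurable (fun ω => f (D.step w (ρ ω))) P := by
        simpa using hm.add_const (f w)
      have hi : Integrable (fun ω => f (D.step w (ρ ω))) P :=
        Integrable.of_bound hm' ‖f‖ (Eventually.of_forall fun ω => f.abs_apply_le _)
      have e1 : ∫ ω, (f (D.step w (ρ ω)) - f w) ∂P = ∫ ω, f (D.step w (ρ ω)) ∂P - f w := by
        rw [integral_sub hi (integrable_const _)]; simp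
      rw [← e1]
      exact key
    · refine Summable.of_nonneg_of_le (fun e => by positivity) (fun e => ?_)
        ((D.summable_moveRate w).mul_right (h * (2 * ‖f‖)))
      simp_rw [norm_indicator_eq_indicator_norm]
      rw [integral_indicator_const _ (hAmeas e), smul_eq_mul, Real.norm_eq_abs,
        ← abs_of_nonneg (measureReal_nonneg (μ := P) (s := A e)), ← abs_mul]
      exact hterm_le e
  have hsumG := (D.hasSum_gen f w).mul_left h
  have hdiff := hsumA.sub hsumG
  rw [show ∫ ω, f (D.step w (ρ ω)) ∂P - f w - h * D.gen f w =
    ∫ ω, f (D.step w (ρ ω)) ∂P - (f w + h * D.gen f w) by ring] at hdiff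
  have hs : HasSum (fun e => D.moveRate w e * (D.bound * h ^ 2 * (4 * ‖f‖)))
      ((∑' e, D.moveRate w e) * (D.bound * h ^ 2 * (4 * ‖f‖))) :=
    (D.summable_moveRate w).hasSum.mul_right _
  rw [← hdiff.tsum_eq, ← Real.norm_eq_abs]
  refine (tsum_of_norm_bounded hs fun e => ?_).trans ?_
  · rw [← mul_assoc h, mul_comm h, ← sub_mul, Real.norm_eq_abs]
    by_cases he : D.act e w = w
    · rw [hc0 e he, mul_zero, abs_zero]
      exact mul_nonneg (D.moveRate_nonneg _ _) (by positivity)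
    · rw [abs_mul, ← hrate e he]
      have h1 : |P.real (A e) - D.rate e * h| ≤ D.rate e * (D.bound * h ^ 2 * 2) := by
        have h3 : (D.rate e * h) ^ 2 ≤ D.rate e * (D.bound * h ^ 2) := by
          have := mul_le_mul_of_nonneg_left (hrate_le e he)
            (mul_nonneg (D.rate e).coe_nonneg (sq_nonneg h))
          nlinarith
        rw [abs_le]
        constructor
        · nlinarith [hAlow e he, hρ.le_prob e]
        · have : 0 ≤ D.rate e * (D.bound * h ^ 2 * 2 : ℝ) := by positivity
          linarith [hAρ e, hρ.prob_le e]
      calc _ ≤ D.rate e * (D.bound * h ^ 2 * 2) * (2 * ‖f‖) :=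
            mul_le_mul h1 (hcle e) (abs_nonneg _) (by positivity)
        _ = _ := by ring
  · calc _ ≤ (D.bound : ℝ) * (D.bound * h ^ 2 * (4 * ‖f‖)) :=
          mul_le_mul_of_nonneg_right (hbound w) (by positivity)
      _ = _ := by ring

end JumpSystem

/-! ### The law of a process driven by Poisson clocks -/

namespace JumpSystem

variable {E ι : Type*} (D : JumpSystem E ι)

lemma norm_semi_le (t : ℝ) : ‖D.semi t‖ ≤ Real.exp (|t| * (2 * D.bound)) :=
  (norm_exp_smul_le D.gen t).trans (Real.exp_le_exp.2
    (mul_le_mul_of_nonneg_left D.norm_gen_le (abs_nonneg t)))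

lemma abs_semi_sub_le {h : ℝ} (hh : 0 ≤ h) (f : BddFun E) (w : E) :
    |D.semi h f w - (f w + h * D.gen f w)| ≤
      4 * (D.bound * h) ^ 2 * Real.exp (h * (2 * D.bound)) * ‖f‖ := by
  have h1 := hasSum_exp_smul_apply D.gen h f w
  rw [← hasSum_nat_add_iff' 2] at h1
  have h2 : HasSum (fun n : ℕ => (h * (2 * D.bound)) ^ n / (n ! : ℝ) *
      (4 * (D.bound * h) ^ 2 * ‖f‖)) (Real.exp (h * (2 * D.bound)) *
      (4 * (D.bound * h) ^ 2 * ‖f‖)) := by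
    rw [Real.exp_eq_exp_ℝ]
    exact (NormedSpace.expSeries_div_hasSum_exp (𝔸 := ℝ) _).mul_right _
  have h3 : D.semi h f w - (f w + h * D.gen f w) = NormedSpace.exp (h • D.gen) f w -
      ∑ n ∈ Finset.range 2, h ^ n / (n ! : ℝ) * (D.gen ^ n) f w := by
    simp [Finset.sum_range_succ, semi]
  rw [h3, ← h1.tsum_eq, ← Real.norm_eq_abs]
  refine (tsum_of_norm_bounded h2 fun n => ?_).trans (le_of_eq (by ring))
  have h4 : |(D.gen ^ (n + 2)) f w| ≤ (2 * D.bound) ^ (n + 2) * ‖f‖ :=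
    (BddFun.abs_apply_le _ w).trans ((norm_pow_apply_le D.gen (n + 2) f).trans (by
      gcongr; exact D.norm_gen_le))
  have h5 : (n ! : ℝ) ≤ ((n + 2)! : ℝ) := by exact_mod_cast Nat.factorial_le (by omega)
  rw [Real.norm_eq_abs, abs_mul, abs_div, abs_pow, Nat.abs_cast, abs_of_nonneg hh]
  calc h ^ (n + 2) / ((n + 2)! : ℝ) * |(D.gen ^ (n + 2)) f w|
      ≤ h ^ (n + 2) / (n ! : ℝ) * ((2 * D.bound) ^ (n + 2) * ‖f‖) := by gcongr
    _ = _ := by ring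

variable {Ω : Type*} [MeasurableSpace Ω] {P : Measure Ω} [IsProbabilityMeasure P] [Countable ι]
  {N : ι → ℝ≥0 → Ω → ℕ}

/-- The number of rings of a clock in the `k`-th interval of length `h`. -/
def ringCount (N : ι → ℝ≥0 → Ω → ℕ) (h : ℝ≥0) (k : ℕ) (ω : Ω) (e : ι) : ℕ :=
  N e ((k + 1 : ℕ) * h) ω - N e (k * h) ω

variable {D}

omit [IsProbabilityMeasure P] [Countable ι] in
lemma measurable_ringCount (hN : ∀ e, IsPoissonProcess (N e) (D.rate e) P) (h : ℝ≥0) (k : ℕ)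
    (e : ι) : Measurable fun ω => ringCount N h k ω e :=
  ((hN e).measurable _).sub ((hN e).measurable _)

omit [IsProbabilityMeasure P] [Countable ι] in
lemma iIndepFun_ringCount (hN : ∀ e, IsPoissonProcess (N e) (D.rate e) P)
    (hind : iIndepFun (fun e ω (t : ℝ≥0) => N e t ω) P) (h : ℝ≥0) :
    iIndepFun (fun (q : ι × ℕ) ω => ringCount N h q.2 ω q.1) P := by
  refine iIndepFun_uncurry' (X := fun e k ω => ringCount N h k ω e)
    (fun e k => measurable_ringCount hN h k e) ?_ fun e => ?_
  · refine hind.comp (fun _ (g : ℝ≥0 → ℕ) (k : ℕ) => g ((k + 1 : ℕ) * h) - g (k * h)) fun e => ?_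
    exact measurable_pi_lambda _ fun k => (measurable_pi_apply _).sub (measurable_pi_apply _)
  · refine (hN e).indep_increments.nat (t := fun k : ℕ => (k : ℝ≥0) * h) fun i j hij => ?_
    dsimp only
    gcongr

lemma isAttemptSet_ringCount (hN : ∀ e, IsPoissonProcess (N e) (D.rate e) P)
    (hind : iIndepFun (fun e ω (t : ℝ≥0) => N e t ω) P) (h : ℝ≥0) (k : ℕ) :
    D.IsAttemptSet (fun ω => {e | 0 < ringCount N h k ω e}) h P := by
  have hlt : ∀ e, {ω | e ∈ {e | 0 < ringCount N h k ω e}} =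
      {ω | N e (k * h) ω < N e ((k + 1 : ℕ) * h) ω} := fun e => by
    ext ω; simp [ringCount]
  have hle : (k : ℝ≥0) * h ≤ (k + 1 : ℕ) * h := by gcongr; omega
  have hsub : ((k + 1 : ℕ) : ℝ≥0) * h - k * h = h := by
    push_cast; rw [add_mul, one_mul, add_tsub_cancel_left]
  refine ⟨fun e => ?_, fun e => ?_, fun e => ?_, fun e e' hne => ?_⟩
  · rw [hlt]; exact (hN e).measurableSet_lt _ _
  · rw [hlt]; simpa only [hsub] using (hN e).measureReal_lt_le hle
  · rw [hlt]; simpa only [hsub] using (hN e).le_measureReal_lt hle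
  · have hi := (iIndepFun_ringCount hN hind h).indepFun (i := (e, k)) (j := (e', k))
      (by simp [hne])
    have := hi.measure_inter_preimage_eq_mul (Set.Ioi 0) (Set.Ioi 0) measurableSet_Ioi
      measurableSet_Ioi
    simp only [measureReal_def, ← ENNReal.toReal_mul]
    exact le_of_eq (congrArg ENNReal.toReal this)

lemma measurable_uncurry_step [Countable E] [MeasurableSpace E] [DiscreteMeasurableSpace E] :
    Measurable fun q : E × (ι → ℕ) => D.step q.1 {e | 0 < q.2 e} :=
  measurable_from_prod_countable_right fun w =>
    measurable_step (fun e => measurable_pi_apply e measurableSet_Ioi) w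

/-- A step with attempts that are independent of the current state can be averaged separately. -/
lemma integral_step_of_indepFun [Countable E] [MeasurableSpace E] [DiscreteMeasurableSpace E]
    {Y : Ω → E} {Δ : Ω → ι → ℕ} (hY : Measurable Y) (hΔ : Measurable Δ) (hi : IndepFun Y Δ P)
    (g : BddFun E) :
    ∫ ω, g (D.step (Y ω) {e | 0 < Δ ω e}) ∂P =
      ∫ ω, ∫ ω', g (D.step (Y ω) {e | 0 < Δ ω' e}) ∂P ∂P := by
  set F : E × (ι → ℕ) → ℝ := fun q => g (D.step q.1 {e | 0 < q.2 e}) with hF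
  have hFm : Measurable F := (measurable_of_countable (g : E → ℝ)).comp measurable_uncurry_step
  have hlaw := (indepFun_iff_map_prod_eq_prod_map_map hY.aemeasurable hΔ.aemeasurable).1 hi
  have : IsProbabilityMeasure (P.map Y) := Measure.isProbabilityMeasure_map hY.aemeasurable
  have : IsProbabilityMeasure (P.map Δ) := Measure.isProbabilityMeasure_map hΔ.aemeasurable
  calc ∫ ω, F (Y ω, Δ ω) ∂P = ∫ q, F q ∂(P.map fun ω => (Y ω, Δ ω)) :=
        (integral_map (hY.prodMk hΔ).aemeasurable hFm.aestronglyMeasurable).symm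
    _ = ∫ w, ∫ δ, F (w, δ) ∂(P.map Δ) ∂(P.map Y) := by
        rw [hlaw]
        exact integral_prod _ (Integrable.of_bound hFm.aestronglyMeasurable ‖g‖
          (Eventually.of_forall fun q => g.abs_apply_le _))
    _ = ∫ ω, ∫ δ, F (Y ω, δ) ∂(P.map Δ) ∂P :=
        integral_map hY.aemeasurable (measurable_of_countable _).aestronglyMeasurable
    _ = _ := by
        congr 1 with ω
        exact integral_map hΔ.aemeasurable
          (hFm.comp measurable_prodMk_left).aestronglyMeasurable

variable (D) in
/-- The Euler chain of mesh `h`, which attempts in each step the jumps whose clocks ring during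
the corresponding interval of length `h`. -/
def euler (N : ι → ℝ≥0 → Ω → ℕ) (h : ℝ≥0) (w : E) (k : ℕ) (ω : Ω) : E :=
  D.chain w (fun k => {e | 0 < ringCount N h k ω e}) k

omit [MeasurableSpace Ω] in
/-- The first `k` steps depend on the rings in the first `k` intervals only. -/
lemma measurable_euler [Countable E] [MeasurableSpace E] [DiscreteMeasurableSpace E]
    (h : ℝ≥0) (w : E) (k : ℕ) :
    Measurable[⨆ q ∈ {q : ι × ℕ | q.2 < k},
      MeasurableSpace.comap (fun ω => ringCount N h q.2 ω q.1) inferInstance]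
      (D.euler N h w k) := by
  induction k with
  | zero => exact measurable_const
  | succ k ih =>
    have hle : (⨆ q ∈ {q : ι × ℕ | q.2 < k},
        MeasurableSpace.comap (fun ω => ringCount N h q.2 ω q.1) inferInstance) ≤
        (⨆ q ∈ {q : ι × ℕ | q.2 < k + 1},
        MeasurableSpace.comap (fun ω => ringCount N h q.2 ω q.1) inferInstance) :=
      biSup_mono fun q (hq : q.2 < k) => Nat.lt_succ_of_lt hq
    have h1 := ih.mono hle le_rfl
    have h2 : Measurable[⨆ q ∈ {q : ι × ℕ | q.2 < k + 1},
        MeasurableSpace.comap (fun ω => ringCount N h q.2 ω q.1) inferInstance]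
        (ringCount N h k) := by
      refine @measurable_pi_lambda _ _ _ (_) _ _ fun e => ?_
      refine Measurable.mono (comap_measurable (fun ω => ringCount N h k ω e)) ?_ le_rfl
      exact le_biSup (fun q : ι × ℕ =>
        MeasurableSpace.comap (fun ω => ringCount N h q.2 ω q.1) inferInstance)
        (show (e, k) ∈ {q : ι × ℕ | q.2 < k + 1} from Nat.lt_succ_self k)
    exact (measurable_uncurry_step (D := D)).comp (h1.prodMk h2)

/-- The error of the Euler chain against the semigroup: a sum of `n` errors of second order. -/
lemma abs_integral_euler_sub_le [Countable E] (hN : ∀ e, IsPoissonProcess (N e) (D.rate e) P)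
    (hind : iIndepFun (fun e ω (t : ℝ≥0) => N e t ω) P) (h : ℝ≥0) (w : E) (f : BddFun E)
    (n : ℕ) :
    |∫ ω, f (D.euler N h w n ω) ∂P - D.semi (n * h) f w| ≤
      n * (4 * (D.bound * h) ^ 2 * (1 + Real.exp (h * (2 * D.bound)))) *
        Real.exp (n * h * (2 * D.bound)) * ‖f‖ := by
  let _ : MeasurableSpace E := ⊤
  set C : ℝ := 4 * (D.bound * h) ^ 2 * (1 + Real.exp (h * (2 * D.bound))) with hC
  set Q : ℝ := Real.exp (n * h * (2 * D.bound)) * ‖f‖ with hQ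
  have hmeas : ∀ k, Measurable (D.euler N h w k) := fun k =>
    (measurable_euler h w k).mono (iSup₂_le fun q _ =>
      (measurable_ringCount hN h q.2 q.1).comap_le) le_rfl
  have hΔ : ∀ k, Measurable (ringCount N h k) := fun k =>
    measurable_pi_lambda _ fun e => measurable_ringCount hN h k e
  have hindep : ∀ k, IndepFun (D.euler N h w k) (ringCount N h k) P := fun k => by
    have hdisj : Disjoint {q : ι × ℕ | q.2 < k} {q : ι × ℕ | q.2 = k} :=
      Set.disjoint_left.2 fun q (h1 : q.2 < k) (h2 : q.2 = k) => by omega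
    have hI := indep_iSup_of_disjoint
      (fun q : ι × ℕ => (measurable_ringCount hN h q.2 q.1).comap_le)
      ((iIndepFun_iff_iIndep _ _ _).1 (iIndepFun_ringCount hN hind h)) hdisj
    rw [IndepFun_iff_Indep]
    refine indep_of_indep_of_le_left (indep_of_indep_of_le_right hI ?_)
      (measurable_euler h w k).comap_le
    refine Measurable.comap_le ?_
    refine @measurable_pi_lambda _ _ _ (_) _ _ fun e => ?_
    refine Measurable.mono (comap_measurable (fun ω => ringCount N h k ω e)) ?_ le_rfl
    exact le_biSup (fun q : ι × ℕ =>
      MeasurableSpace.comap (fun ω => ringCount N h q.2 ω q.1) inferInstance)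
      (show (e, k) ∈ {q : ι × ℕ | q.2 = k} from rfl)
  have hint : ∀ k (g : BddFun E), Integrable (fun ω => g (D.euler N h w k ω)) P := fun k g =>
    Integrable.of_bound ((measurable_of_countable (g : E → ℝ)).comp
      (hmeas k)).aestronglyMeasurable ‖g‖ (Eventually.of_forall fun ω => g.abs_apply_le _)
  -- one step of the chain differs from the semigroup by a second-order error
  have hstep : ∀ k (g : BddFun E), |∫ ω, g (D.euler N h w (k + 1) ω) ∂P -
      ∫ ω, D.semi h g (D.euler N h w k ω) ∂P| ≤ C * ‖g‖ := by
    intro k g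
    have e1 : ∫ ω, g (D.euler N h w (k + 1) ω) ∂P =
        ∫ ω, ∫ ω', g (D.step (D.euler N h w k ω) {e | 0 < ringCount N h k ω' e}) ∂P ∂P :=
      integral_step_of_indepFun (hmeas k) (hΔ k) (hindep k) g
    have hloc : ∀ v, |∫ ω', g (D.step v {e | 0 < ringCount N h k ω' e}) ∂P - D.semi h g v| ≤
        C * ‖g‖ := by
      intro v
      have a1 := (isAttemptSet_ringCount hN hind h k).abs_integral_step_sub_le
        (NNReal.coe_nonneg h) g v
      have a2 := D.abs_semi_sub_le (NNReal.coe_nonneg h) g v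
      rw [abs_sub_comm] at a2
      refine (abs_sub_le _ (g v + h * D.gen g v) _).trans ((add_le_add a1 a2).trans ?_)
      rw [hC]
      exact le_of_eq (by ring)
    rw [e1, ← integral_sub _ (hint k _), ← Real.norm_eq_abs]
    · refine (norm_integral_le_of_norm_le_const (C := C * ‖g‖)
        (Eventually.of_forall fun ω => hloc _)).trans ?_
      simp
    · refine Integrable.of_bound ((measurable_of_countable (fun v : E =>
        ∫ ω', g (D.step v {e | 0 < ringCount N h k ω' e}) ∂P)).comp
        (hmeas k)).aestronglyMeasurable ‖g‖ (Eventually.of_forall fun ω => ?_)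
      refine (norm_integral_le_of_norm_le_const (C := ‖g‖)
        (Eventually.of_forall fun ω => g.abs_apply_le _)).trans ?_
      simp
  -- run the chain for `k` steps and the semigroup for the remaining time
  have main : ∀ k ≤ n, |∫ ω, D.semi ((n - k : ℕ) * h) f (D.euler N h w k ω) ∂P -
      D.semi (n * h) f w| ≤ k * (C * Q) := by
    intro k
    induction k with
    | zero => intro _; simp [euler, chain]
    | succ k ih =>
      intro hk
      have e2 : D.semi ((n - k : ℕ) * h) f = D.semi h (D.semi ((n - (k + 1) : ℕ) * h) f) := by
        rw [← mul_apply_eq_comp, ← D.semi_add]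
        have : n - k = n - (k + 1) + 1 := by omega
        rw [this]; push_cast; ring_nf
      have hg : ‖D.semi ((n - (k + 1) : ℕ) * h) f‖ ≤ Q := by
        refine ((D.semi _).le_opNorm f).trans ?_
        rw [hQ]
        gcongr
        refine (D.norm_semi_le _).trans (Real.exp_le_exp.2 ?_)
        rw [abs_of_nonneg (by positivity)]
        gcongr
        omega
      have s1 := hstep k (D.semi ((n - (k + 1) : ℕ) * h) f)
      rw [← e2] at s1
      have hC0 : 0 ≤ C := by positivity
      have s2 := mul_le_mul_of_nonneg_left hg hC0
      have := abs_sub_le (∫ ω, D.semi ((n - (k + 1) : ℕ) * h) f (D.euler N h w (k + 1) ω) ∂P)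
        (∫ ω, D.semi ((n - k : ℕ) * h) f (D.euler N h w k ω) ∂P) (D.semi (n * h) f w)
      have := ih (by omega)
      push_cast at *
      linarith
  have := main n le_rfl
  simp only [Nat.sub_self, Nat.cast_zero, zero_mul, semi_zero, one_apply_eq_self] at this
  refine this.trans (le_of_eq ?_)
  rw [hQ]; ring

end JumpSystem

namespace JumpSystem

variable {E ι : Type*} {D : JumpSystem E ι} {Ω : Type*} [MeasurableSpace Ω] {P : Measure Ω}
  [IsProbabilityMeasure P] [Countable ι] {N : ι → ℝ≥0 → Ω → ℕ}

lemma exists_mesh_interval {t τ : ℝ≥0} (h0 : 0 < τ) (ht : τ ≤ t) {n : ℕ} (hn : 0 < n) :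
    ∃ k < n, (k : ℝ≥0) * (t / n) < τ ∧ τ ≤ (k + 1 : ℕ) * (t / n) := by
  have hn' : (n : ℝ≥0) ≠ 0 := by exact_mod_cast hn.ne'
  have hex : ∃ k : ℕ, τ ≤ (k : ℝ≥0) * (t / n) := ⟨n, by rwa [mul_div_cancel₀ t hn']⟩
  classical
  have h1 := Nat.find_spec hex
  have hne : Nat.find hex ≠ 0 := fun h => by
    rw [h] at h1
    simp only [Nat.cast_zero, zero_mul] at h1
    exact absurd h1 (not_le.2 h0)
  obtain ⟨k, hk⟩ := Nat.exists_eq_succ_of_ne_zero hne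
  have hkn : Nat.find hex ≤ n := Nat.find_min' hex (by rwa [mul_div_cancel₀ t hn'])
  refine ⟨k, by omega, ?_, ?_⟩
  · exact not_le.1 (Nat.find_min hex (show k < Nat.find hex by omega))
  · rw [hk] at h1; exact h1

/-- Independent Poisson clocks almost surely never ring simultaneously. -/
lemma ae_disjoint_ringTimes (hN : ∀ e, IsPoissonProcess (N e) (D.rate e) P)
    (hind : iIndepFun (fun e ω (t : ℝ≥0) => N e t ω) P) (t : ℝ≥0) {e e' : ι} (hne : e ≠ e') :
    ∀ᵐ ω ∂P, ∀ τ ∈ ringTimes (N e) ω, τ ≤ t → τ ∉ ringTimes (N e') ω := by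
  set good : Set Ω := {ω | (Monotone fun t => N e t ω) ∧ (∀ t, ∀ᶠ s in 𝓝[>] t, N e s ω = N e t ω) ∧
    (Monotone fun t => N e' t ω) ∧ (∀ t, ∀ᶠ s in 𝓝[>] t, N e' s ω = N e' t ω)} with hgood
  set B : Set Ω := {ω | ω ∈ good ∧ ∃ τ ∈ ringTimes (N e) ω, τ ≤ t ∧ τ ∈ ringTimes (N e') ω}
    with hB
  -- in a mesh of size `t / n` the probability of a common interval is of order `1 / n`
  have hbound : ∀ n : ℕ, 0 < n → P.real B ≤ (D.rate e * t * (D.rate e' * t) : ℝ) * (1 / n) := by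
    intro n hn
    have hρ := isAttemptSet_ringCount hN hind (t / n)
    have hsub : B ⊆ ⋃ k ∈ Finset.range n, {ω | 0 < ringCount N (t / n) k ω e ∧
        0 < ringCount N (t / n) k ω e'} := by
      rintro ω ⟨⟨m1, c1, m2, c2⟩, τ, hτ, hτt, hτ'⟩
      obtain ⟨k, hk, h1, h2⟩ := exists_mesh_interval hτ.1 hτt hn
      refine Set.mem_biUnion (Finset.mem_coe.2 (Finset.mem_range.2 hk)) ⟨?_, ?_⟩
      · exact tsub_pos_iff_lt.2 ((exists_ringTime_iff m1 c1).1 ⟨τ, hτ, h1, h2⟩)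
      · exact tsub_pos_iff_lt.2 ((exists_ringTime_iff m2 c2).1 ⟨τ, hτ', h1, h2⟩)
    have hn' : (n : ℝ) ≠ 0 := by exact_mod_cast hn.ne'
    calc P.real B ≤ _ := measureReal_mono hsub (measure_ne_top _ _)
      _ ≤ ∑ k ∈ Finset.range n, P.real {ω | 0 < ringCount N (t / n) k ω e ∧
          0 < ringCount N (t / n) k ω e'} := measureReal_biUnion_finset_le _ _
      _ ≤ ∑ k ∈ Finset.range n, ((D.rate e : ℝ) * ((t / n : ℝ≥0) : ℝ)) *
          ((D.rate e' : ℝ) * ((t / n : ℝ≥0) : ℝ)) := by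
          refine Finset.sum_le_sum fun k _ => ((hρ k).prob_inter_le e e' hne).trans ?_
          exact mul_le_mul ((hρ k).prob_le e) ((hρ k).prob_le e') measureReal_nonneg
            (by positivity)
      _ = _ := by
          rw [Finset.sum_const, Finset.card_range, nsmul_eq_mul]
          push_cast
          field_simp
  have hlim : Tendsto (fun n : ℕ => (D.rate e * t * (D.rate e' * t) : ℝ) * (1 / n)) atTop
      (𝓝 0) := by
    simpa using (tendsto_one_div_atTop_nhds_zero_nat (𝕜 := ℝ)).const_mul
      (D.rate e * t * (D.rate e' * t) : ℝ)
  have hB0 : P.real B = 0 := le_antisymm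
    (ge_of_tendsto hlim ((eventually_gt_atTop 0).mono hbound)) measureReal_nonneg
  have hB0' : P B = 0 := by
    rwa [measureReal_eq_zero_iff] at hB0
  filter_upwards [(hN e).monotone, (hN e).right_continuous, (hN e').monotone,
    (hN e').right_continuous, measure_eq_zero_iff_ae_notMem.1 hB0']
    with ω m1 c1 m2 c2 hω τ hτ hτt hτ'
  exact hω ⟨⟨m1, c1, m2, c2⟩, τ, hτ, hτt, hτ'⟩

/-- Almost surely, only finitely many of the jumps that would move a given state are attempted
before time `t`. -/
lemma ae_finite_ringing [Countable E] (hN : ∀ e, IsPoissonProcess (N e) (D.rate e) P) (t : ℝ≥0) :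
    ∀ᵐ ω ∂P, ∀ w, {e | D.act e w ≠ w ∧ ∃ τ ∈ ringTimes (N e) ω, τ ≤ t}.Finite := by
  rw [ae_all_iff]
  intro w
  have hs : ∑' e, P {ω | D.act e w ≠ w ∧ N e 0 ω < N e t ω} ≠ ∞ := by
    have hle : ∀ e, P {ω | D.act e w ≠ w ∧ N e 0 ω < N e t ω} ≤
        ENNReal.ofReal (D.moveRate w e * t) := by
      intro e
      by_cases he : D.act e w = w
      · simp [he]
      · have h1 := (hN e).measureReal_lt_le (zero_le : (0 : ℝ≥0) ≤ t)
        simp only [tsub_zero] at h1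
        rw [show D.moveRate w e = D.rate e by simp [moveRate, he]]
        simp only [ne_eq, he, not_false_iff, true_and]
        rw [← ofReal_measureReal]
        exact ENNReal.ofReal_le_ofReal h1
    refine ne_top_of_le_ne_top ?_ (ENNReal.tsum_le_tsum hle)
    rw [← ENNReal.ofReal_tsum_of_nonneg
      (fun e => mul_nonneg (D.moveRate_nonneg w e) (NNReal.coe_nonneg t))
      ((D.summable_moveRate w).mul_right _)]
    exact ENNReal.ofReal_ne_top
  have hmono : ∀ᵐ ω ∂P, ∀ e, Monotone fun t => N e t ω := ae_all_iff.2 fun e => (hN e).monotone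
  have hcont : ∀ᵐ ω ∂P, ∀ e t, ∀ᶠ s in 𝓝[>] t, N e s ω = N e t ω :=
    ae_all_iff.2 fun e => (hN e).right_continuous
  filter_upwards [ae_finite_setOfPred_mem hs, hmono, hcont] with ω hω hm hc
  refine hω.subset ?_
  rintro e ⟨he, τ, hτ, hτt⟩
  exact ⟨he, (exists_ringTime_iff (hm e) (hc e)).1 ⟨τ, hτ, hτ.1, hτt⟩⟩

/-- The transition probabilities of a process driven by independent Poisson clocks are given by
the semigroup of the system of jumps. -/
theorem integral_eq_semi [Countable E] (hN : ∀ e, IsPoissonProcess (N e) (D.rate e) P)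
    (hind : iIndepFun (fun e ω (t : ℝ≥0) => N e t ω) P) {Z : ℝ≥0 → Ω → E} {w : E}
    (hstart : ∀ᵐ ω ∂P, Z 0 ω = w)
    (hpath : ∀ᵐ ω ∂P, D.IsPath (fun e => ringTimes (N e) ω) fun t => Z t ω)
    (f : BddFun E) (t : ℝ≥0) : ∫ ω, f (Z t ω) ∂P = D.semi t f w := by
  let _ : MeasurableSpace E := ⊤
  have hsim : ∀ᵐ ω ∂P, ∀ e e', e ≠ e' → ∀ τ ∈ ringTimes (N e) ω, τ ≤ t →
      τ ∉ ringTimes (N e') ω := by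
    rw [ae_all_iff]; intro e
    rw [ae_all_iff]; intro e'
    by_cases hne : e = e'
    · exact Eventually.of_forall fun ω h => absurd hne h
    · filter_upwards [ae_disjoint_ringTimes hN hind t hne] with ω hω _ using hω
  have hmono : ∀ᵐ ω ∂P, ∀ e, Monotone fun t => N e t ω := ae_all_iff.2 fun e => (hN e).monotone
  have hcont : ∀ᵐ ω ∂P, ∀ e t, ∀ᶠ s in 𝓝[>] t, N e s ω = N e t ω :=
    ae_all_iff.2 fun e => (hN e).right_continuous
  have hconv : ∀ᵐ ω ∂P, Tendsto (fun n : ℕ => f (D.euler N (t / n) w n ω)) atTop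
      (𝓝 (f (Z t ω))) := by
    filter_upwards [hstart, hpath, hsim, hmono, hcont, ae_finite_ringing hN t]
      with ω h0 hp hs hm hc hf
    refine tendsto_const_nhds.congr' ?_
    filter_upwards [hp.eventually_chain_eq t hf (fun e => finite_ringTimes_inter (hm e) t) hs]
      with n hn
    rw [← hn, h0, euler]
    congr 2
    funext k
    ext e
    exact (exists_ringTime_iff (hm e) (hc e)).trans tsub_pos_iff_lt.symm
  have hmeas : ∀ n : ℕ, AEStronglyMeasurable (fun ω => f (D.euler N (t / n) w n ω)) P := fun n =>
    ((measurable_of_countable (f : E → ℝ)).comp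
      ((measurable_euler (t / n) w n).mono (iSup₂_le fun q _ =>
      (measurable_ringCount hN _ q.2 q.1).comap_le) le_rfl)).aestronglyMeasurable
  -- the expectations along the Euler chains converge to both sides
  have h1 := tendsto_integral_of_dominated_convergence (fun _ => ‖f‖) hmeas (integrable_const _)
    (fun n => Eventually.of_forall fun ω => f.abs_apply_le _) hconv
  have h2 : Tendsto (fun n : ℕ => ∫ ω, f (D.euler N (t / n) w n ω) ∂P) atTop
      (𝓝 (D.semi t f w)) := by
    rw [tendsto_iff_norm_sub_tendsto_zero]
    set C : ℝ := 4 * (D.bound * t) ^ 2 * (1 + Real.exp (t * (2 * D.bound))) *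
      Real.exp (t * (2 * D.bound)) * ‖f‖ with hC
    have hlim : Tendsto (fun n : ℕ => C * (1 / n)) atTop (𝓝 0) := by
      simpa using (tendsto_one_div_atTop_nhds_zero_nat (𝕜 := ℝ)).const_mul C
    refine squeeze_zero' (Eventually.of_forall fun _ => norm_nonneg _) ?_ hlim
    filter_upwards [eventually_gt_atTop 0] with n hn
    have hn' : (n : ℝ) ≠ 0 := by exact_mod_cast hn.ne'
    have hn1 : (1 : ℝ) ≤ n := by exact_mod_cast hn
    have key := abs_integral_euler_sub_le hN hind (t / n) w f n
    have hnt : (n : ℝ) * ((t / n : ℝ≥0) : ℝ) = t := by push_cast; field_simp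
    rw [hnt] at key
    refine key.trans ?_
    have hle : ((t / n : ℝ≥0) : ℝ) ≤ t := by
      push_cast; exact div_le_self (NNReal.coe_nonneg t) hn1
    calc _ ≤ n * (4 * (D.bound * ((t / n : ℝ≥0) : ℝ)) ^ 2 * (1 + Real.exp (t * (2 * D.bound)))) *
          Real.exp (t * (2 * D.bound)) * ‖f‖ := by gcongr
      _ = _ := by rw [hC]; push_cast; field_simp
  exact tendsto_nhds_unique h1 h2

end JumpSystem

/-! ### Positivity, and perturbation of semigroups -/

namespace JumpSystem

variable {E ι : Type*} (D : JumpSystem E ι)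

lemma semi_nonneg {t : ℝ} (ht : 0 ≤ t) {f : BddFun E} (hf : ∀ z, 0 ≤ f z) (z : E) :
    0 ≤ D.semi t f z := by
  -- adding a multiple of the identity makes the generator a positive operator
  set A : BddFun E →L[ℝ] BddFun E := D.gen + (D.bound : ℝ) • 1 with hA
  have hApos : ∀ f : BddFun E, (∀ z, 0 ≤ f z) → ∀ z, 0 ≤ A f z := by
    intro f hf z
    have h1 : HasSum (fun e => D.moveRate z e * f (D.act e z) - D.moveRate z e * f z)
        (D.gen f z) := by
      convert D.hasSum_gen f z using 2 with e
      rw [D.rate_mul_eq z e (fun h => by rw [h, sub_self]), mul_sub]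
    have h2 : HasSum (fun e => D.moveRate z e * f z) ((∑' e, D.moveRate z e) * f z) :=
      (D.summable_moveRate z).hasSum.mul_right _
    have h3 := (h1.add h2).nonneg fun e => by
      have := mul_nonneg (D.moveRate_nonneg z e) (hf (D.act e z))
      linarith
    have h4 := mul_le_mul_of_nonneg_right (D.tsum_moveRate_le z) (hf z)
    simp only [hA, add_apply, smul_apply, one_apply_eq_self, BddFun.add_apply, BddFun.smul_apply]
    linarith
  have hpow : ∀ n, ∀ f : BddFun E, (∀ z, 0 ≤ f z) → ∀ z, 0 ≤ (A ^ n) f z := fun n => by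
    induction n with
    | zero => intro f hf z; simpa using hf z
    | succ n ih =>
      intro f hf z
      rw [pow_succ, mul_apply_eq_comp]
      exact ih _ (hApos f hf) z
  have hexp : 0 ≤ NormedSpace.exp (t • A) f z :=
    (hasSum_exp_smul_apply A t f z).nonneg fun n =>
      mul_nonneg (by positivity) (hpow n f hf z)
  let _ : NormedAlgebra ℚ (BddFun E →L[ℝ] BddFun E) := NormedAlgebra.restrictScalars ℚ ℝ _
  have hsplit : t • A = t • D.gen + algebraMap ℝ (BddFun E →L[ℝ] BddFun E) (t * D.bound) := by
    rw [hA, smul_add, smul_smul, Algebra.algebraMap_eq_smul_one]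
  rw [hsplit, NormedSpace.exp_add_of_commute (Algebra.commutes _ _).symm,
    ← NormedSpace.algebraMap_exp_comm, ← Real.exp_eq_exp_ℝ, Algebra.algebraMap_eq_smul_one,
    mul_smul_comm, mul_one] at hexp
  exact nonneg_of_mul_nonneg_right hexp (Real.exp_pos _)

lemma semi_mono {t : ℝ} (ht : 0 ≤ t) {f g : BddFun E} (hfg : ∀ z, f z ≤ g z) (z : E) :
    D.semi t f z ≤ D.semi t g z := by
  have := D.semi_nonneg ht (f := g - f) (fun z => by simpa using hfg z) z
  rw [map_sub, BddFun.sub_apply] at this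
  linarith

lemma semi_one (t : ℝ) : D.semi t (BddFun.ind Set.univ) = BddFun.ind Set.univ := by
  refine D.semi_apply_of_gen_eq_zero ?_ t
  ext z
  simp [gen_apply, BddFun.ind_apply]

lemma semi_ind_compl (t : ℝ) (A : Set E) (z : E) :
    D.semi t (BddFun.ind Aᶜ) z = 1 - D.semi t (BddFun.ind A) z := by
  have h : BddFun.ind Aᶜ = BddFun.ind Set.univ - BddFun.ind A := by
    ext x; by_cases hx : x ∈ A <;> simp [BddFun.ind_apply, hx]
  rw [h, map_sub, semi_one]
  simp [BddFun.ind_apply]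

lemma semi_ind_nonneg {t : ℝ} (ht : 0 ≤ t) (A : Set E) (z : E) :
    0 ≤ D.semi t (BddFun.ind A) z := D.semi_nonneg ht (BddFun.ind_nonneg A) z

lemma semi_ind_le_one {t : ℝ} (ht : 0 ≤ t) (A : Set E) (z : E) :
    D.semi t (BddFun.ind A) z ≤ 1 := by
  have := D.semi_ind_nonneg ht Aᶜ z
  rw [semi_ind_compl] at this
  linarith

lemma continuous_semi_apply {α : Type*} [TopologicalSpace α] {τ : α → ℝ} (hτ : Continuous τ)
    {F : α → BddFun E} (hF : Continuous F) (z : E) :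
    Continuous fun a => D.semi (τ a) (F a) z :=
  (BddFun.eval z).continuous.comp ((D.continuous_semi.comp hτ).clm_apply hF)

/-- Duhamel's formula: the difference of two semigroups. -/
lemma semi_sub_semi_eq_integral {κ : Type*} (D' : JumpSystem E κ) (f : BddFun E) (t : ℝ) (z : E) :
    D'.semi t f z - D.semi t f z =
      ∫ r in (0 : ℝ)..t, D.semi r ((D'.gen - D.gen) (D'.semi (t - r) f)) z := by
  have hsub : ∀ r, HasDerivAt (fun r : ℝ => t - r) (-1) r := fun r => by
    simpa using (hasDerivAt_id r).const_sub t
  have hd : ∀ r, HasDerivAt (fun r => -(D.semi r (D'.semi (t - r) f) z))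
      (D.semi r ((D'.gen - D.gen) (D'.semi (t - r) f)) z) r := by
    intro r
    have h1 : HasDerivAt (fun r => D'.semi (t - r) f) (-(D'.gen (D'.semi (t - r) f))) r := by
      have := ((D'.hasDerivAt_semi' (t - r)).scomp r (hsub r)).clm_apply (hasDerivAt_const r f)
      simpa using this
    have h2 := (D.hasDerivAt_semi r).clm_apply h1
    have h3 : HasDerivAt (fun r => -(D.semi r (D'.semi (t - r) f) z)) _ r :=
      ((BddFun.eval z).hasFDerivAt.comp_hasDerivAt r h2).neg
    refine h3.congr_deriv ?_
    simp [BddFun.eval_apply]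
    ring
  have hc : Continuous fun r => D.semi r ((D'.gen - D.gen) (D'.semi (t - r) f)) z := by
    refine D.continuous_semi_apply continuous_id ?_ z
    exact (D'.gen - D.gen).continuous.comp
      ((D'.continuous_semi.comp (continuous_const.sub continuous_id)).clm_apply continuous_const)
  rw [intervalIntegral.integral_eq_sub_of_hasDerivAt (fun r _ => hd r) (hc.intervalIntegrable _ _)]
  simp [semi_zero]
  ring

end JumpSystem

/-! ### Products of functions, and pairs of particles -/

namespace BddFun

variable {S : Type*}

lemma abs_mul_apply_le (f g : BddFun S) (q : S × S) : |f q.1 * g q.2| ≤ ‖f‖ * ‖g‖ := by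
  rw [abs_mul]
  exact mul_le_mul (f.abs_apply_le _) (g.abs_apply_le _) (abs_nonneg _) (norm_nonneg _)

/-- The tensor product `(x, y) ↦ f x * g y` of two bounded functions, as a continuous bilinear
map. -/
def tens : BddFun S →L[ℝ] BddFun S →L[ℝ] BddFun (S × S) :=
  LinearMap.mkContinuous₂ (LinearMap.mk₂ ℝ
    (fun f g => of (fun q => f q.1 * g q.2) (‖f‖ * ‖g‖) (abs_mul_apply_le f g))
    (fun f f' g => by ext q; simp [of_apply, add_mul])
    (fun c f g => by ext q; simp [of_apply, mul_assoc])
    (fun f g g' => by ext q; simp [of_apply, mul_add])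
    (fun c f g => by ext q; simp [of_apply, mul_left_comm]))
    1 fun f g => by
      rw [one_mul]
      exact norm_of_le _ _ (abs_mul_apply_le f g) (by positivity)

lemma tens_apply (f g : BddFun S) (q : S × S) : tens f g q = f q.1 * g q.2 := rfl

end BddFun

namespace JumpSystem

open BddFun

variable {S ι : Type*} (G : JumpSystem S ι)

/-- Two particles that make the same jumps. -/
def joint : JumpSystem (S × S) ι where
  rate := G.rate
  act e q := (G.act e q.1, G.act e q.2)
  bound := G.bound + G.bound
  sum_le q := by
    rw [ENNReal.coe_add]
    refine le_trans ?_ (add_le_add (G.sum_le q.1) (G.sum_le q.2))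
    rw [← ENNReal.tsum_add]
    refine ENNReal.tsum_le_tsum fun e => ?_
    by_cases h1 : G.act e q.1 = q.1 <;> by_cases h2 : G.act e q.2 = q.2 <;>
      simp [Prod.ext_iff, h1, h2]

/-- Two particles that jump independently. -/
def indep : JumpSystem (S × S) (ι ⊕ ι) where
  rate := Sum.elim G.rate G.rate
  act := Sum.elim (fun e q => (G.act e q.1, q.2)) (fun e q => (q.1, G.act e q.2))
  bound := G.bound + G.bound
  sum_le q := by
    rw [ENNReal.coe_add, ENNReal.summable.tsum_sum ENNReal.summable]
    refine add_le_add (le_trans ?_ (G.sum_le q.1)) (le_trans ?_ (G.sum_le q.2))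
    · refine ENNReal.tsum_le_tsum fun e => ?_
      by_cases h1 : G.act e q.1 = q.1
      · simp [Prod.ext_iff, h1]
      · exact (Set.indicator_le_self _ _ _).trans (by simp [h1])
    · refine ENNReal.tsum_le_tsum fun e => ?_
      by_cases h1 : G.act e q.2 = q.2
      · simp [Prod.ext_iff, h1]
      · exact (Set.indicator_le_self _ _ _).trans (by simp [h1])

lemma summable_rate_mul_mul (f g : BddFun S) (x y : S) :
    Summable fun e => (G.rate e : ℝ) * ((f (G.act e x) - f x) * (g (G.act e y) - g y)) := by
  refine Summable.of_norm_bounded ((G.summable_moveRate x).mul_right (2 * ‖f‖ * (2 * ‖g‖)))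
    fun e => G.abs_rate_mul_le x e (fun h => by simp [h]) ?_
  rw [abs_mul]
  exact mul_le_mul (f.abs_sub_le_two_mul_norm _ _) (g.abs_sub_le_two_mul_norm _ _)
    (abs_nonneg _) (by positivity)

/-- The generator of two particles that make the same jumps: the Leibniz rule fails by the
contributions of the jumps that move both. -/
lemma gen_joint_tens_apply (f g : BddFun S) (q : S × S) :
    G.joint.gen (tens f g) q = G.gen f q.1 * g q.2 + f q.1 * G.gen g q.2 +
      ∑' e, (G.rate e : ℝ) * ((f (G.act e q.1) - f q.1) * (g (G.act e q.2) - g q.2)) := by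
  refine (G.joint.hasSum_gen (tens f g) q).unique ?_
  refine Eq.subst (motive := fun F => HasSum F _) (funext fun e => ?_)
    ((((G.hasSum_gen f q.1).mul_right (g q.2)).add
    ((G.hasSum_gen g q.2).mul_left (f q.1))).add
    (G.summable_rate_mul_mul f g q.1 q.2).hasSum)
  simp only [tens_apply, joint]
  ring

lemma hasSum_gen_indep (F : BddFun (S × S)) (q : S × S) :
    HasSum (fun e => (G.rate e : ℝ) *
      ((F (G.act e q.1, q.2) - F q) + (F (q.1, G.act e q.2) - F q))) (G.indep.gen F q) := by
  have h := G.indep.summable_rate_mul_sub F q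
  have h1 := h.comp_injective (Sum.inl_injective (α := ι) (β := ι))
  have h2 := h.comp_injective (Sum.inr_injective (α := ι) (β := ι))
  have h3 : G.indep.gen F q = _ := h1.tsum_sum (f := fun e => (G.indep.rate e : ℝ) *
    (F (G.indep.act e q) - F q)) h2
  rw [h3]
  refine Eq.subst (motive := fun F => HasSum F _) (funext fun e => ?_) (h1.hasSum.add h2.hasSum)
  simp only [Function.comp, indep, Sum.elim_inl, Sum.elim_inr]
  ring

/-- The generator of two independent particles satisfies the Leibniz rule. -/
lemma gen_indep_tens (f g : BddFun S) :
    G.indep.gen (tens f g) = tens (G.gen f) g + tens f (G.gen g) := by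
  ext q
  refine (G.hasSum_gen_indep (tens f g) q).unique ?_
  refine Eq.subst (motive := fun F => HasSum F _) (funext fun e => ?_)
    (((G.hasSum_gen f q.1).mul_right (g q.2)).add
    ((G.hasSum_gen g q.2).mul_left (f q.1)))
  simp only [tens_apply]
  ring

/-- Duhamel's formula for a product of functions: comparison of a pair of particles with two
independent particles. -/
lemma semi_tens_sub_eq_integral {κ : Type*} (V : JumpSystem (S × S) κ) (f g : BddFun S) (t : ℝ)
    (q : S × S) :
    V.semi t (tens f g) q - G.semi t f q.1 * G.semi t g q.2 =
      ∫ s in (0 : ℝ)..t, V.semi s ((V.gen - G.indep.gen)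
        (tens (G.semi (t - s) f) (G.semi (t - s) g))) q := by
  have hsub : ∀ r, HasDerivAt (fun r : ℝ => t - r) (-1) r := fun r => by
    simpa using (hasDerivAt_id r).const_sub t
  have hcur : ∀ (f : BddFun S) r, HasDerivAt (fun r => G.semi (t - r) f)
      (-(G.gen (G.semi (t - r) f))) r := fun f r => by
    have := ((G.hasDerivAt_semi' (t - r)).scomp r (hsub r)).clm_apply (hasDerivAt_const r f)
    simpa using this
  have hd : ∀ r, HasDerivAt (fun r => V.semi r (tens (G.semi (t - r) f) (G.semi (t - r) g)) q)
      (V.semi r ((V.gen - G.indep.gen) (tens (G.semi (t - r) f) (G.semi (t - r) g))) q) r := by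
    intro r
    have h1 := (tens.hasFDerivAt.comp_hasDerivAt r (hcur f r)).clm_apply (hcur g r)
    have h2 := (V.hasDerivAt_semi r).clm_apply h1
    have h3 : HasDerivAt
        (fun r => V.semi r (tens (G.semi (t - r) f) (G.semi (t - r) g)) q) _ r :=
      (BddFun.eval q).hasFDerivAt.comp_hasDerivAt r h2
    refine h3.congr_deriv ?_
    simp only [Function.comp, _root_.sub_apply, gen_indep_tens, mul_apply_eq_comp, map_sub,
      map_add, map_neg, _root_.neg_apply, BddFun.eval_apply, BddFun.add_apply, BddFun.sub_apply]
    ring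
  have hc1 : ∀ f : BddFun S, Continuous fun r => G.semi (t - r) f := fun f =>
    (G.continuous_semi.comp (continuous_const.sub continuous_id)).clm_apply continuous_const
  have hc : Continuous fun r => V.semi r ((V.gen - G.indep.gen)
      (tens (G.semi (t - r) f) (G.semi (t - r) g))) q := by
    refine V.continuous_semi_apply continuous_id ?_ q
    exact (V.gen - G.indep.gen).continuous.comp ((tens.continuous.comp (hc1 f)).clm_apply (hc1 g))
  rw [intervalIntegral.integral_eq_sub_of_hasDerivAt (fun r _ => hd r) (hc.intervalIntegrable _ _)]
  simp [semi_zero, tens_apply]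

lemma semi_indep_tens (f g : BddFun S) (t : ℝ) (q : S × S) :
    G.indep.semi t (tens f g) q = G.semi t f q.1 * G.semi t g q.2 := by
  have := G.semi_tens_sub_eq_integral G.indep f g t q
  simpa [sub_eq_zero] using this

lemma semi_joint_diag (F : BddFun (S × S)) (f : BddFun S) (h : ∀ x, f x = F (x, x)) (t : ℝ)
    (x : S) : G.joint.semi t F (x, x) = G.semi t f x :=
  (G.semi_comp G.joint (fun x => (x, x)) rfl (fun _ _ => rfl) h t x).symm

lemma semi_joint_fst (F : BddFun (S × S)) (f : BddFun S) (h : ∀ q, F q = f q.1) (t : ℝ)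
    (q : S × S) : G.joint.semi t F q = G.semi t f q.1 :=
  G.joint.semi_comp G Prod.fst rfl (fun _ _ => rfl) h t q

end JumpSystem

/-! ### The stirring system -/

section Stir

open BddFun JumpSystem

variable {S : Type*}

open Classical in
/-- The site that `x` is moved to when the labels of the unordered pair `e` switch places. -/
def swapAt (e : Sym2 S) (x : S) : S :=
  Sym2.lift ⟨fun a b => Equiv.swap a b x, fun a b =>
    show Equiv.swap a b x = Equiv.swap b a x by rw [Equiv.swap_comm]⟩ e

open Classical in
lemma swapAt_mk (a b x : S) : swapAt s(a, b) x = Equiv.swap a b x := rfl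

lemma swapAt_left (a b : S) : swapAt s(a, b) a = b := by classical simp [swapAt_mk]

lemma swapAt_of_notMem {e : Sym2 S} {x : S} (h : x ∉ e) : swapAt e x = x := by
  classical
  induction e with | _ a b => ?_
  rw [Sym2.mem_iff, not_or] at h
  rw [swapAt_mk, Equiv.swap_apply_of_ne_of_ne h.1 h.2]

lemma swapAt_swapAt (e : Sym2 S) (x : S) : swapAt e (swapAt e x) = x := by
  classical
  induction e with | _ a b => ?_
  simp [swapAt_mk]

lemma swapAt_injective (e : Sym2 S) : Function.Injective (swapAt e) :=
  Function.LeftInverse.injective (swapAt_swapAt e)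

/-- A sum over the pairs that contain `x` is a sum over the other elements of the pairs. -/
lemma tsum_sym2_eq {α : Type*} [AddCommMonoid α] [TopologicalSpace α] {F : Sym2 S → α} (x : S)
    (hF : ∀ e, x ∉ e → F e = 0) : ∑' e, F e = ∑' y, F s(x, y) := by
  have hinj : Function.Injective fun y => s(x, y) := fun y z h => Sym2.congr_right.1 h
  refine (hinj.tsum_eq fun e he => ?_).symm
  by_contra hne
  refine he (hF e fun hx => hne ?_)
  obtain ⟨y, rfl⟩ := hx
  exact ⟨y, rfl⟩

variable (p : S → S → ℝ≥0) (hp_symm : ∀ x y, p x y = p y x)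
  (hp_bdd : (⨆ x, ∑' y, (p x y : ℝ≥0∞)) < ∞)

/-- The motion of a label in the stirring process, as a system of jumps. The diagonal pairs have no
effect, but the given bound counts their rates. -/
def stir : JumpSystem S (Sym2 S) where
  rate := Sym2.lift ⟨p, hp_symm⟩
  act := swapAt
  bound := (⨆ x, ∑' y, (p x y : ℝ≥0∞)).toNNReal
  sum_le x := by
    rw [ENNReal.coe_toNNReal hp_bdd.ne, tsum_sym2_eq x]
    · refine le_trans (ENNReal.tsum_le_tsum fun y => ?_)
        (le_iSup (fun x => ∑' y, (p x y : ℝ≥0∞)) x)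
      exact Set.indicator_le_self _ _ _
    · exact fun e he => Set.indicator_of_notMem (by simp [swapAt_of_notMem he]) _

variable {p hp_symm hp_bdd}

local notation "G" => stir p hp_symm hp_bdd

lemma generator_eq (f : BddFun S) : generator p f = (G).gen f := by
  funext x
  rw [gen_apply, tsum_sym2_eq x]
  · refine tsum_congr fun y => ?_
    change _ = (p x y : ℝ) * (f (swapAt s(x, y) x) - f x)
    rw [swapAt_left]
  · intro e he
    change _ * (f (swapAt e x) - f x) = 0
    rw [swapAt_of_notMem he, sub_self, mul_zero]

lemma semigroup_eq (f : BddFun S) (t : ℝ≥0) (x : S) : semigroup p t f x = (G).semi t f x := by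
  have h : ∀ n, (generator p)^[n] f = ((G).gen ^ n) f := fun n => by
    induction n with
    | zero => rfl
    | succ n ih =>
      rw [Function.iterate_succ_apply', ih, generator_eq (hp_symm := hp_symm) (hp_bdd := hp_bdd),
        pow_succ', mul_apply_eq_comp]
  rw [semigroup]
  simp_rw [h]
  exact (hasSum_exp_smul_apply (G).gen t f x).tsum_eq

lemma chainProb_eq (A : Set S) (t : ℝ≥0) (x : S) :
    chainProb p t x A = (G).semi t (ind A) x := semigroup_eq (ind A) t x

lemma isSymmKernel_semi [Countable S] (t : ℝ) : IsSymmKernel ((G).semi t) :=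
  ((G).isSymmKernel_gen swapAt_swapAt).exp (G).bpContinuous_gen t

/-- Two labels never meet. -/
lemma semi_joint_diagonal (t : ℝ) :
    (G).joint.semi t (ind (Set.diagonal S)) = ind (Set.diagonal S) := by
  refine semi_apply_of_gen_eq_zero _ ?_ t
  ext q
  rw [gen_apply, zero_apply]
  convert tsum_zero with e
  have h : (G).joint.act e q ∈ Set.diagonal S ↔ q ∈ Set.diagonal S := (swapAt_injective e).eq_iff
  by_cases hq : q ∈ Set.diagonal S
  · simp [ind_apply, hq, h.2 hq]
  · simp [ind_apply, hq, mt h.1 hq]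

lemma gen_joint_sub_gen_indep_tens (f g : BddFun S) (q : S × S) :
    ((G).joint.gen - (G).indep.gen) (tens f g) q =
      ∑' e, ((G).rate e : ℝ) * ((f (swapAt e q.1) - f q.1) * (g (swapAt e q.2) - g q.2)) := by
  rw [_root_.sub_apply, BddFun.sub_apply, gen_joint_tens_apply, gen_indep_tens]
  simp only [BddFun.add_apply, tens_apply]
  exact add_sub_cancel_left _ _

lemma mul_swapAt_sub_nonpos (f : S → ℝ) (e : Sym2 S) {x y : S} (hxy : x ≠ y) :
    (f (swapAt e x) - f x) * (f (swapAt e y) - f y) ≤ 0 := by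
  by_cases hx : x ∈ e
  · by_cases hy : y ∈ e
    · have he : e = s(x, y) := ((Sym2.mem_and_mem_iff hxy).1 ⟨hx, hy⟩)
      rw [he, swapAt_left, Sym2.eq_swap, swapAt_left]
      nlinarith [sq_nonneg (f x - f y)]
    · simp [swapAt_of_notMem hy]
  · simp [swapAt_of_notMem hx]

/-- Two labels are negatively correlated. -/
lemma semi_joint_tens_le {t : ℝ} (ht : 0 ≤ t) (f : BddFun S) {x y : S} (hxy : x ≠ y) :
    (G).joint.semi t (tens f f) (x, y) ≤ (G).semi t f x * (G).semi t f y := by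
  rw [← sub_nonpos, (G).semi_tens_sub_eq_integral (G).joint f f t (x, y)]
  rw [← neg_nonneg, ← intervalIntegral.integral_neg]
  refine intervalIntegral.integral_nonneg ht fun s hs => ?_
  rw [neg_nonneg]
  set u := (G).semi (t - s) f
  set F := ((G).joint.gen - (G).indep.gen) (tens u u) with hF
  -- off the diagonal the integrand is nonpositive, and two labels never meet
  have hle : ∀ q, F q ≤ (‖F‖ • ind (Set.diagonal S) : BddFun (S × S)) q := by
    intro q
    rw [BddFun.smul_apply, ind_apply]
    by_cases hq : q ∈ Set.diagonal S
    · simpa [hq] using (le_abs_self _).trans (F.abs_apply_le q)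
    · rw [Set.indicator_of_notMem hq, mul_zero, hF, gen_joint_sub_gen_indep_tens]
      refine tsum_nonpos fun e => mul_nonpos_of_nonneg_of_nonpos (NNReal.coe_nonneg _) ?_
      exact mul_swapAt_sub_nonpos u e hq
  refine ((G).joint.semi_mono hs.1 hle (x, y)).trans ?_
  rw [map_smul, semi_joint_diagonal, BddFun.smul_apply, ind_apply,
    Set.indicator_of_notMem (by simpa using hxy), mul_zero]

/-! ### A lower bound for the variance -/

/-- The squared difference of `f` along an unordered pair. -/
def gradSq (f : S → ℝ) (e : Sym2 S) : ℝ :=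
  Sym2.lift ⟨fun a b => (f a - f b) ^ 2, fun a b => by ring⟩ e

lemma gradSq_mk (f : S → ℝ) (a b : S) : gradSq f s(a, b) = (f a - f b) ^ 2 := rfl

lemma gradSq_nonneg (f : S → ℝ) (e : Sym2 S) : 0 ≤ gradSq f e := by
  induction e with | _ a b => exact sq_nonneg _

/-- The second difference of a function of two variables along an unordered pair: for
`Ψ (x, y) = 𝔼 X x * X y` it is the second moment of `X a - X b`. -/
def diffSq (Ψ : S × S → ℝ) (e : Sym2 S) : ℝ :=
  Sym2.lift ⟨fun a b => Ψ (a, a) + Ψ (b, b) - Ψ (a, b) - Ψ (b, a), fun a b => by ring⟩ e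

lemma diffSq_mk (Ψ : S × S → ℝ) (a b : S) :
    diffSq Ψ s(a, b) = Ψ (a, a) + Ψ (b, b) - Ψ (a, b) - Ψ (b, a) := rfl

/-- The difference of the indicators of the two elements of an unordered pair. Its sign depends on
the choice of an order, but its square and its tensor square do not. -/
def dipole (e : Sym2 S) : BddFun S := ind {e.out.1} - ind {e.out.2}

lemma mk_out (e : Sym2 S) : s(e.out.1, e.out.2) = e := Quot.out_eq e

/-- Moving both arguments of `Ψ` differs from moving them one at a time only if both belong to
the pair. -/
lemma second_difference_eq (Ψ : S × S → ℝ) (e : Sym2 S) (q : S × S) :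
    Ψ (swapAt e q.1, swapAt e q.2) - Ψ q - ((Ψ (swapAt e q.1, q.2) - Ψ q) +
      (Ψ (q.1, swapAt e q.2) - Ψ q)) = diffSq Ψ e * tens (dipole e) (dipole e) q := by
  have key : ∀ c d : S, ∀ q : S × S, Ψ (swapAt s(c, d) q.1, swapAt s(c, d) q.2) - Ψ q -
      ((Ψ (swapAt s(c, d) q.1, q.2) - Ψ q) + (Ψ (q.1, swapAt s(c, d) q.2) - Ψ q)) =
      diffSq Ψ s(c, d) * ((ind {c} - ind {d} : BddFun S) q.1 *
        (ind {c} - ind {d} : BddFun S) q.2) := by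
    rintro c d ⟨a, b⟩
    have hswap : ∀ x, x ≠ c → x ≠ d → swapAt s(c, d) x = x := fun x h1 h2 =>
      swapAt_of_notMem (by simp [h1, h2])
    have hl : swapAt s(c, d) c = d := swapAt_left c d
    have hr : swapAt s(c, d) d = c := by rw [Sym2.eq_swap, swapAt_left]
    have hind : ∀ x, x ≠ c → x ≠ d → (ind {c} - ind {d} : BddFun S) x = 0 := fun x h1 h2 => by
      simp [ind_apply, h1, h2]
    by_cases hcd : c = d
    · subst hcd
      simp [swapAt_mk, diffSq_mk]
    have hc1 : (ind {c} - ind {d} : BddFun S) c = 1 := by simp [ind_apply, hcd]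
    have hd1 : (ind {c} - ind {d} : BddFun S) d = -1 := by simp [ind_apply, Ne.symm hcd]
    dsimp only
    rw [diffSq_mk]
    rcases eq_or_ne a c with rfl | ha1
    · rcases eq_or_ne b a with rfl | hb1
      · rw [hl, hc1]; ring
      · rcases eq_or_ne b d with rfl | hb2
        · rw [hl, hr, hc1, hd1]; ring
        · rw [hswap b hb1 hb2, hind b hb1 hb2]; ring
    · rcases eq_or_ne a d with rfl | ha2
      · rcases eq_or_ne b c with rfl | hb1
        · rw [hl, hr, hc1, hd1]; ring
        · rcases eq_or_ne b a with rfl | hb2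
          · rw [hr, hd1]; ring
          · rw [hswap b hb1 hb2, hind b hb1 hb2]; ring
      · rw [hswap a ha1 ha2, hind a ha1 ha2]; ring
  have := key e.out.1 e.out.2 q
  rw [mk_out] at this
  exact this

variable [Countable S]

/-- The integrand in the comparison of two labels with two independent labels factorizes over the
pairs of sites. -/
lemma hasSum_semi_indep_gen_sub (Ψ : BddFun (S × S)) (r : ℝ) (q : S × S) :
    HasSum (fun e => ((G).rate e : ℝ) * diffSq Ψ e *
      ((G).semi r (dipole e) q.1 * (G).semi r (dipole e) q.2))
      ((G).indep.semi r (((G).joint.gen - (G).indep.gen) Ψ) q) := by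
  set F : Sym2 S → BddFun (S × S) := fun e =>
    (((G).rate e : ℝ) * diffSq Ψ e) • tens (dipole e) (dipole e) with hF
  have hFe : ∀ e q, F e q = ((G).rate e : ℝ) * (Ψ (swapAt e q.1, swapAt e q.2) - Ψ q -
      ((Ψ (swapAt e q.1, q.2) - Ψ q) + (Ψ (q.1, swapAt e q.2) - Ψ q))) := fun e q => by
    rw [second_difference_eq, hF, BddFun.smul_apply, mul_assoc]
  have hsum : ∀ q, HasSum (fun e => F e q) (((G).joint.gen - (G).indep.gen) Ψ q) := fun q => by
    refine Eq.subst (motive := fun F => HasSum F _) (funext fun e => ?_)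
      (((G).joint.hasSum_gen Ψ q).sub ((G).hasSum_gen_indep Ψ q))
    rw [hFe]
    change ((G).rate e : ℝ) * (Ψ (swapAt e q.1, swapAt e q.2) - Ψ q) - ((G).rate e : ℝ) *
      ((Ψ (swapAt e q.1, q.2) - Ψ q) + (Ψ (q.1, swapAt e q.2) - Ψ q)) = _
    ring
  have hbound : ∀ e q, |F e q| ≤ (G).moveRate q.1 e * (4 * ‖Ψ‖) := fun e q => by
    rw [hFe]
    refine (G).abs_rate_mul_le q.1 e (fun h => ?_) ?_
    · have h' : swapAt e q.1 = q.1 := h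
      rw [h']; ring
    · have h1 := Ψ.abs_sub_le_two_mul_norm (swapAt e q.1, swapAt e q.2) (swapAt e q.1, q.2)
      have h2 := Ψ.abs_sub_le_two_mul_norm q (q.1, swapAt e q.2)
      rw [abs_le] at *
      constructor <;> linarith [h1.1, h1.2, h2.1, h2.2]
  have key := ((G).indep.bpContinuous_semi r).tendsto (l := atTop)
    (F := fun s : Finset (Sym2 S) => ∑ e ∈ s, F e) (f := ((G).joint.gen - (G).indep.gen) Ψ)
    (C := (G).bound * (4 * ‖Ψ‖)) (fun s => ?_) (fun q => ?_) q
  · simp only [map_sum, BddFun.sum_apply] at key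
    have h2 : ∀ e, (G).indep.semi r (F e) q = ((G).rate e : ℝ) * diffSq Ψ e *
        ((G).semi r (dipole e) q.1 * (G).semi r (dipole e) q.2) := fun e => by
      rw [hF, map_smul, BddFun.smul_apply, semi_indep_tens]
    simp only [h2] at key
    exact key
  · refine norm_le (by positivity) fun q => ?_
    rw [BddFun.sum_apply]
    refine (Finset.abs_sum_le_sum_abs _ _).trans
      ((Finset.sum_le_sum fun e _ => hbound e q).trans ?_)
    rw [← Finset.sum_mul]
    refine mul_le_mul_of_nonneg_right ?_ (by positivity)
    exact (((G).summable_moveRate q.1).sum_le_tsum s fun e _ => (G).moveRate_nonneg _ _).trans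
      ((G).tsum_moveRate_le q.1)
  · simp only [BddFun.sum_apply]
    exact hsum q

/-- The finitely supported function with values `c x` for `x ∈ F`. -/
def restrict (F : Finset S) (c : S → ℝ) : BddFun S := ∑ x ∈ F, c x • ind {x}

/-- By symmetry of the kernel, testing `T_r` of a dipole against `c` is taking the difference of
`T_r c` along the pair. -/
lemma sum_mul_semi_dipole_sq (F : Finset S) (c : S → ℝ) (r : ℝ) (e : Sym2 S) :
    (∑ x ∈ F, c x * (G).semi r (dipole e) x) ^ 2 = gradSq ((G).semi r (restrict F c)) e := by
  conv_rhs => rw [← mk_out e]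
  rw [gradSq_mk]
  congr 1
  simp only [restrict, dipole, map_sum, map_smul, BddFun.sum_apply, BddFun.smul_apply, map_sub,
    BddFun.sub_apply, mul_sub, Finset.sum_sub_distrib]
  congr 1 <;> exact Finset.sum_congr rfl fun x _ => by rw [isSymmKernel_semi]

lemma hasSum_sum_semi_indep (Ψ : BddFun (S × S)) (F : Finset S) (c : S → ℝ) (r : ℝ) :
    HasSum (fun e => ((G).rate e : ℝ) * diffSq Ψ e * gradSq ((G).semi r (restrict F c)) e)
      (∑ x ∈ F, ∑ y ∈ F, c x * c y *
        (G).indep.semi r (((G).joint.gen - (G).indep.gen) Ψ) (x, y)) := by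
  have h := hasSum_sum (s := F) fun x _ => hasSum_sum (s := F) fun y _ =>
    (hasSum_semi_indep_gen_sub (p := p) (hp_symm := hp_symm) (hp_bdd := hp_bdd) Ψ r
      (x, y)).mul_left (c x * c y)
  refine Eq.subst (motive := fun F => HasSum F _) (funext fun e => ?_) h
  rw [← sum_mul_semi_dipole_sq, sq, Finset.sum_mul_sum, Finset.mul_sum]
  refine Finset.sum_congr rfl fun x _ => ?_
  rw [Finset.mul_sum]
  exact Finset.sum_congr rfl fun y _ => by ring

omit [Countable S] in
/-- By negative correlation, the probability that exactly one of two labels is in `B` is at least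
what it is for independent labels. -/
lemma le_diffSq_semi_joint {t : ℝ} (ht : 0 ≤ t) (B : Set S) {a b : S} (hab : a ≠ b) :
    (G).semi t (ind B) a * (1 - (G).semi t (ind B) b) +
      (G).semi t (ind B) b * (1 - (G).semi t (ind B) a) ≤
    diffSq ((G).joint.semi t (tens (ind B) (ind B))) s(a, b) := by
  have hd : ∀ x, ind B x = tens (ind B) (ind B) (x, x) := fun x => by
    by_cases hx : x ∈ B <;> simp [tens_apply, ind_apply, hx]
  have h1 := (G).semi_joint_diag (tens (ind B) (ind B)) (ind B) hd t
  have h2 := semi_joint_tens_le (p := p) (hp_symm := hp_symm) (hp_bdd := hp_bdd) ht (ind B) hab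
  have h3 := semi_joint_tens_le (p := p) (hp_symm := hp_symm) (hp_bdd := hp_bdd) ht (ind B)
    hab.symm
  rw [diffSq_mk, h1, h1]
  linarith

omit [Countable S] in
lemma diffSq_semi_joint_nonneg {t : ℝ} (ht : 0 ≤ t) (B : Set S) (e : Sym2 S) :
    0 ≤ diffSq ((G).joint.semi t (tens (ind B) (ind B))) e := by
  induction e with | _ a b => ?_
  rcases eq_or_ne a b with rfl | hab
  · rw [diffSq_mk]; simp
  · refine le_trans ?_ (le_diffSq_semi_joint ht B hab)
    have h1 := fun x => (G).semi_ind_nonneg ht B x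
    have h2 := fun x => (G).semi_ind_le_one ht B x
    exact add_nonneg (mul_nonneg (h1 a) (by linarith [h2 b]))
      (mul_nonneg (h1 b) (by linarith [h2 a]))

end Stir

section Energy

open BddFun JumpSystem

variable {S : Type*} [Countable S] {p : S → S → ℝ≥0} {hp_symm : ∀ x y, p x y = p y x}
  {hp_bdd : (⨆ x, ∑' y, (p x y : ℝ≥0∞)) < ∞}

local notation "G" => stir p hp_symm hp_bdd

omit [Countable S] in
lemma continuous_gradSq_semi (f : BddFun S) (e : Sym2 S) :
    Continuous fun r => gradSq ((G).semi r f) e := by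
  induction e with | _ a b => ?_
  simp only [gradSq_mk]
  exact (((G).continuous_semi_apply continuous_id continuous_const a).sub
    ((G).continuous_semi_apply continuous_id continuous_const b)).pow 2

/-- A lower bound for the variance of the number of the labels from a finite set that are in `B`.
The covariances are expanded by Duhamel's formula. -/
lemma le_sum_cov (F : Finset S) (c : S → ℝ) (B : Set S) (E₀ : Finset (Sym2 S)) {κ R t : ℝ}
    (hR : 0 ≤ R) (hRt : R ≤ t)
    (hκ : ∀ e ∈ E₀, ¬ e.IsDiag → ∀ s, t - R ≤ s →
      κ ≤ diffSq ((G).joint.semi s (tens (ind B) (ind B))) e) :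
    κ * ∑ e ∈ E₀, (G).rate e * ∫ r in (0 : ℝ)..R, gradSq ((G).semi r (restrict F c)) e ≤
      ∑ x ∈ F, ∑ y ∈ F, c x * c y * ((G).joint.semi t (tens (ind B) (ind B)) (x, y) -
        (G).semi t (ind B) x * (G).semi t (ind B) y) := by
  set Ψ : ℝ → BddFun (S × S) := fun s => (G).joint.semi s (tens (ind B) (ind B)) with hΨ
  set I : ℝ → ℝ := fun r => ∑ x ∈ F, ∑ y ∈ F, c x * c y *
    (G).indep.semi r (((G).joint.gen - (G).indep.gen) (Ψ (t - r))) (x, y) with hI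
  set J : ℝ → ℝ := fun r =>
    κ * ∑ e ∈ E₀, (G).rate e * gradSq ((G).semi r (restrict F c)) e with hJ
  have hIc' : ∀ q, Continuous fun r =>
      (G).indep.semi r (((G).joint.gen - (G).indep.gen) (Ψ (t - r))) q := fun q => by
    refine (G).indep.continuous_semi_apply continuous_id ?_ q
    exact ((G).joint.gen - (G).indep.gen).continuous.comp
      (((G).joint.continuous_semi.comp (continuous_const.sub continuous_id)).clm_apply
        continuous_const)
  have hIc : Continuous I := continuous_finsetSum _ fun x _ => continuous_finsetSum _ fun y _ =>
    continuous_const.mul (hIc' (x, y))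
  have hJc : Continuous J := continuous_const.mul (continuous_finsetSum _ fun e _ =>
    continuous_const.mul (continuous_gradSq_semi _ e))
  have hIsum : ∀ r, HasSum (fun e => ((G).rate e : ℝ) * diffSq (Ψ (t - r)) e *
      gradSq ((G).semi r (restrict F c)) e) (I r) := fun r => hasSum_sum_semi_indep _ F c r
  have hterm : ∀ r, r ≤ t → ∀ e, 0 ≤ ((G).rate e : ℝ) * diffSq (Ψ (t - r)) e *
      gradSq ((G).semi r (restrict F c)) e := fun r hr e =>
    mul_nonneg (mul_nonneg (NNReal.coe_nonneg _) (diffSq_semi_joint_nonneg (by linarith) B e))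
      (gradSq_nonneg _ e)
  have hright : ∑ x ∈ F, ∑ y ∈ F, c x * c y * (Ψ t (x, y) -
      (G).semi t (ind B) x * (G).semi t (ind B) y) = ∫ r in (0 : ℝ)..t, I r := by
    have hi : ∀ x y, Continuous fun r => c x * c y *
        (G).indep.semi r (((G).joint.gen - (G).indep.gen) (Ψ (t - r))) (x, y) := fun x y =>
      continuous_const.mul (hIc' (x, y))
    rw [hI, intervalIntegral.integral_finsetSum fun x _ =>
      (continuous_finsetSum F fun y _ => hi x y).intervalIntegrable _ _]
    refine Finset.sum_congr rfl fun x _ => ?_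
    rw [intervalIntegral.integral_finsetSum fun y _ => (hi x y).intervalIntegrable _ _]
    refine Finset.sum_congr rfl fun y _ => ?_
    rw [intervalIntegral.integral_const_mul,
      ← (G).indep.semi_sub_semi_eq_integral (G).joint (tens (ind B) (ind B)) t (x, y),
      semi_indep_tens]
  have hleft : κ * ∑ e ∈ E₀, (G).rate e *
      ∫ r in (0 : ℝ)..R, gradSq ((G).semi r (restrict F c)) e = ∫ r in (0 : ℝ)..R, J r := by
    have hi : ∀ e, Continuous fun r =>
        ((G).rate e : ℝ) * gradSq ((G).semi r (restrict F c)) e := fun e =>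
      continuous_const.mul (continuous_gradSq_semi _ e)
    rw [intervalIntegral.integral_const_mul, intervalIntegral.integral_finsetSum fun e _ =>
      (hi e).intervalIntegrable _ _]
    simp_rw [intervalIntegral.integral_const_mul]
  -- the integrand is nonnegative, and on `[0, R]` it dominates `J`
  rw [hright, hleft, ← intervalIntegral.integral_add_adjacent_intervals
    (hIc.intervalIntegrable 0 R) (hIc.intervalIntegrable R t)]
  have h1 : 0 ≤ ∫ r in R..t, I r := intervalIntegral.integral_nonneg hRt fun r hr =>
    (hIsum r).nonneg (hterm r hr.2)
  have h2 : ∫ r in (0 : ℝ)..R, J r ≤ ∫ r in (0 : ℝ)..R, I r := by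
    refine intervalIntegral.integral_mono_on hR (hJc.intervalIntegrable _ _)
      (hIc.intervalIntegrable _ _) fun r hr => ?_
    refine le_trans ?_ (sum_le_hasSum E₀ (fun e _ => hterm r (hr.2.trans hRt) e) (hIsum r))
    rw [hJ]
    dsimp only
    rw [Finset.mul_sum]
    refine Finset.sum_le_sum fun e he => ?_
    by_cases hd : e.IsDiag
    · have : gradSq ((G).semi r (restrict F c)) e = 0 := by
        induction e with | _ a b => ?_
        rw [Sym2.mk_isDiag_iff] at hd
        rw [gradSq_mk, hd, sub_self, sq, mul_zero]
      simp [this]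
    · rw [mul_left_comm, ← mul_assoc]
      exact mul_le_mul_of_nonneg_right (mul_le_mul_of_nonneg_left
        (hκ e he hd _ (by linarith [hr.2])) (NNReal.coe_nonneg _)) (gradSq_nonneg _ e)
  linarith

omit [Countable S] in
lemma restrict_ind_apply (F : Finset S) (H : Set S) (z : S) :
    restrict F (ind H) z = ind (↑F ∩ H) z := by
  rw [restrict, sum_smul_ind_apply, ind_apply, ← Set.indicator_indicator]
  rfl

omit [Countable S] in
lemma restrict_ind (F : Finset S) (H : Set S) :
    restrict F (ind H) = ind (↑F ∩ H) := BddFun.ext (restrict_ind_apply F H)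

lemma tendsto_integral_gradSq (H : Set S) {R : ℝ} (hR : 0 ≤ R) (e : Sym2 S) :
    Tendsto (fun F : Finset S => ∫ r in (0 : ℝ)..R, gradSq ((G).semi r (restrict F (ind H))) e)
      atTop (𝓝 (∫ r in (0 : ℝ)..R, gradSq ((G).semi r (ind H)) e)) := by
  simp_rw [restrict_ind]
  have hone : ∀ A : Set S, ‖ind A‖ ≤ 1 := fun A =>
    norm_of_le _ _ _ zero_le_one
  have hlim : ∀ r z, Tendsto (fun F : Finset S => (G).semi r (ind (↑F ∩ H)) z) atTop
      (𝓝 ((G).semi r (ind H) z)) := fun r z => by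
    refine ((G).bpContinuous_semi r).tendsto (C := 1) (fun F => hone _) (fun z => ?_) z
    refine tendsto_const_nhds.congr' ?_
    filter_upwards [eventually_ge_atTop {z}] with F hF
    have hz : z ∈ (F : Set S) := hF (Finset.mem_singleton_self z)
    rw [ind_apply, ind_apply, ← Set.indicator_indicator, Set.indicator_of_mem hz]
  refine intervalIntegral.tendsto_integral_filter_of_dominated_convergence (fun _ => 1)
    (Eventually.of_forall fun F =>
      (continuous_gradSq_semi _ e).aestronglyMeasurable.restrict)
    (Eventually.of_forall fun F => Eventually.of_forall fun r hr => ?_)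
    (continuous_const.intervalIntegrable _ _) (Eventually.of_forall fun r _ => ?_)
  · rw [Set.uIoc_of_le hR] at hr
    rw [Real.norm_of_nonneg (gradSq_nonneg _ e)]
    induction e with | _ a b => ?_
    rw [gradSq_mk]
    have h0 := fun z => (G).semi_ind_nonneg hr.1.le (↑F ∩ H) z
    have h1 := fun z => (G).semi_ind_le_one hr.1.le (↑F ∩ H) z
    rw [sq_le_one_iff_abs_le_one, abs_le]
    constructor <;> linarith [h0 a, h0 b, h1 a, h1 b]
  · induction e with | _ a b => ?_
    simp only [gradSq_mk]
    exact ((hlim r a).sub (hlim r b)).pow 2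

/-! ### The energy identity -/

omit [Countable S] in
/-- Each pair is counted at both of its elements. -/
lemma tsum_rate_mul_sq (u : BddFun S) (e : Sym2 S) :
    ∑' x, ENNReal.ofReal (((G).rate e : ℝ) * ((u (swapAt e x) - u x) * (u (swapAt e x) - u x))) ≤
      ENNReal.ofReal (2 * (G).rate e * gradSq u e) := by
  classical
  induction e with | _ a b => ?_
  rw [tsum_eq_sum (s := {a, b}) fun x hx => ?_]
  · rcases eq_or_ne a b with rfl | hab
    · simp [swapAt_mk]
    · rw [Finset.sum_pair hab, ← ENNReal.ofReal_add, swapAt_left]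
      · rw [Sym2.eq_swap (a := a), swapAt_left, Sym2.eq_swap (a := b), gradSq_mk]
        exact ENNReal.ofReal_le_ofReal (by linarith)
      all_goals exact mul_nonneg (NNReal.coe_nonneg _) (mul_self_nonneg _)
  · rw [swapAt_of_notMem (by simpa using hx)]
    simp

/-- The total variance of the indicators of `x` being occupied by a label of `H` is bounded by
the dissipated energy. -/
lemma tsum_variance_le_energy (H : Set S) {t : ℝ} (ht : 0 ≤ t) :
    ∑' x, ENNReal.ofReal ((G).semi t (ind H) x * (1 - (G).semi t (ind H) x)) ≤
      ∑' e, ENNReal.ofReal (2 * ((G).rate e *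
        ∫ r in (0 : ℝ)..t, gradSq ((G).semi r (ind H)) e)) := by
  set u : ℝ → BddFun S := fun r => (G).semi r (ind H) with hu
  set Φ : ℝ → BddFun (S × S) := fun r => ((G).joint.gen - (G).indep.gen) (tens (u r) (u r))
    with hΦ
  set g : ℝ → BddFun S := fun r => of (fun x => Φ r (x, x)) ‖Φ r‖ fun x => (Φ r).abs_apply_le _
    with hg
  have hgsum : ∀ r x, HasSum (fun e => ((G).rate e : ℝ) *
      ((u r (swapAt e x) - u r x) * (u r (swapAt e x) - u r x))) (g r x) := fun r x => by
    have h : g r x = _ := gen_joint_sub_gen_indep_tens (u r) (u r) (x, x)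
    rw [h]
    exact ((G).summable_rate_mul_mul (u r) (u r) x x).hasSum
  have hgnn : ∀ r x, 0 ≤ g r x := fun r x => (hgsum r x).nonneg fun e =>
    mul_nonneg (NNReal.coe_nonneg _) (mul_self_nonneg _)
  have huc : Continuous u := (G).continuous_semi.clm_apply continuous_const
  have hΦc : Continuous Φ := ((G).joint.gen - (G).indep.gen).continuous.comp
    ((tens.continuous.comp huc).clm_apply huc)
  have hcont : ∀ x, Continuous fun s => (G).semi s (g (t - s)) x := fun x => by
    have h : ∀ s, (G).semi s (g (t - s)) x = (G).joint.semi s (Φ (t - s)) (x, x) := fun s =>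
      ((G).semi_joint_diag (Φ (t - s)) (g (t - s)) (fun _ => rfl) s x).symm
    simp_rw [h]
    exact (G).joint.continuous_semi_apply continuous_id
      (hΦc.comp (continuous_const.sub continuous_id)) _
  have hvar : ∀ x, ENNReal.ofReal (u t x * (1 - u t x)) =
      ∫⁻ s in Set.Ioc 0 t, ENNReal.ofReal ((G).semi s (g (t - s)) x) := by
    intro x
    have hd : ∀ x, ind H x = tens (ind H) (ind H) (x, x) := fun x => by
      by_cases hx : x ∈ H <;> simp [tens_apply, ind_apply, hx]
    have h := (G).semi_tens_sub_eq_integral (G).joint (ind H) (ind H) t (x, x)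
    rw [(G).semi_joint_diag _ _ hd] at h
    have h2 : u t x * (1 - u t x) = ∫ s in (0 : ℝ)..t, (G).semi s (g (t - s)) x := by
      rw [mul_sub, mul_one]
      refine h.trans (intervalIntegral.integral_congr fun s _ => ?_)
      exact (G).semi_joint_diag (Φ (t - s)) (g (t - s)) (fun _ => rfl) s x
    rw [h2, intervalIntegral.integral_of_le ht, ofReal_integral_eq_lintegral_ofReal]
    · exact (hcont x).integrableOn_Ioc
    · refine (ae_restrict_mem measurableSet_Ioc).mono fun s hs => ?_
      exact (G).semi_nonneg hs.1.le (hgnn _) x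
  have hdiss : ∀ r, ∑' x, ENNReal.ofReal (g r x) ≤
      ∑' e, ENNReal.ofReal (2 * (G).rate e * gradSq (u r) e) := fun r => by
    have h : ∀ x, ENNReal.ofReal (g r x) = ∑' e, ENNReal.ofReal (((G).rate e : ℝ) *
        ((u r (swapAt e x) - u r x) * (u r (swapAt e x) - u r x))) := fun x => by
      rw [← (hgsum r x).tsum_eq, ENNReal.ofReal_tsum_of_nonneg _ (hgsum r x).summable]
      exact fun e => mul_nonneg (NNReal.coe_nonneg _) (mul_self_nonneg _)
    simp_rw [h]
    rw [ENNReal.tsum_comm]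
    exact ENNReal.tsum_le_tsum fun e => tsum_rate_mul_sq (u r) e
  calc ∑' x, ENNReal.ofReal (u t x * (1 - u t x))
      = ∫⁻ s in Set.Ioc 0 t, ∑' x, ENNReal.ofReal ((G).semi s (g (t - s)) x) := by
        rw [lintegral_tsum fun x => (hcont x).measurable.ennreal_ofReal.aemeasurable]
        exact tsum_congr hvar
    _ ≤ ∫⁻ s in Set.Ioc 0 t, ∑' e, ENNReal.ofReal (2 * (G).rate e * gradSq (u (t - s)) e) := by
        refine setLIntegral_mono_ae' measurableSet_Ioc (Eventually.of_forall fun s hs => ?_)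
        refine le_trans (le_of_eq ?_) (hdiss (t - s))
        -- the semigroup preserves the counting measure
        have h := (isSymmKernel_semi (p := p) (hp_symm := hp_symm) (hp_bdd := hp_bdd)
          s).tsum_mul_apply ((G).bpContinuous_semi s) (fun f hf => (G).semi_nonneg hs.1.le hf)
          (f := ind Set.univ) (g := g (t - s)) (ind_nonneg _) (hgnn _)
        rw [semi_one] at h
        simpa [ind_apply] using h
    _ = ∑' e, ∫⁻ s in Set.Ioc 0 t, ENNReal.ofReal (2 * (G).rate e * gradSq (u (t - s)) e) := by
        refine lintegral_tsum fun e => Measurable.aemeasurable ?_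
        exact (continuous_const.mul ((continuous_gradSq_semi _ e).comp
          (continuous_const.sub continuous_id))).measurable.ennreal_ofReal
    _ = _ := by
        refine tsum_congr fun e => ?_
        have hc : Continuous fun s => 2 * ((G).rate e : ℝ) * gradSq (u (t - s)) e :=
          continuous_const.mul ((continuous_gradSq_semi (p := p) (hp_symm := hp_symm)
            (hp_bdd := hp_bdd) (ind H) e).comp (continuous_const.sub continuous_id))
        rw [← ofReal_integral_eq_lintegral_ofReal hc.integrableOn_Ioc
          (Eventually.of_forall fun s => mul_nonneg (by positivity) (gradSq_nonneg _ e)),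
          ← intervalIntegral.integral_of_le ht, intervalIntegral.integral_const_mul,
          intervalIntegral.integral_comp_sub_left (fun s => gradSq (u s) e), sub_self, sub_zero,
          mul_assoc]

/-- By the semigroup property and symmetry, `⟨η, T_t (1 - η)⟩ = ⟨T_{t/2} η, 1 - T_{t/2} η⟩`. -/
lemma tsum_mul_semi_compl (H : Set S) {t : ℝ} (ht : 0 ≤ t) :
    ∑' x, ENNReal.ofReal (ind H x * (1 - (G).semi t (ind H) x)) =
      ∑' x, ENNReal.ofReal ((G).semi (t / 2) (ind H) x * (1 - (G).semi (t / 2) (ind H) x)) := by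
  have ht' : 0 ≤ t / 2 := by positivity
  have h := (isSymmKernel_semi (p := p) (hp_symm := hp_symm) (hp_bdd := hp_bdd)
    (t / 2)).tsum_mul_apply ((G).bpContinuous_semi _) (fun f hf => (G).semi_nonneg ht' hf)
    (f := ind H) (g := (G).semi (t / 2) (ind Hᶜ)) (ind_nonneg _)
    ((G).semi_ind_nonneg ht' _)
  rw [← mul_apply_eq_comp, ← semi_add, add_halves] at h
  simpa only [semi_ind_compl] using h

/-- If the expected number of sites of `H` that are empty is unbounded, then so is the dissipated
energy. -/
lemma exists_energy_gt (H : Set S)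
    (h : ∀ M : ℝ, ∃ t : ℝ, 0 ≤ t ∧
      ENNReal.ofReal M < ∑' x, ENNReal.ofReal (ind H x * (1 - (G).semi t (ind H) x))) (M : ℝ) :
    ∃ (E₀ : Finset (Sym2 S)) (R : ℝ), 0 ≤ R ∧
      M < ∑ e ∈ E₀, (G).rate e * ∫ r in (0 : ℝ)..R, gradSq ((G).semi r (ind H)) e := by
  obtain ⟨t, ht, hM⟩ := h (2 * M)
  rw [tsum_mul_semi_compl H ht] at hM
  have h1 := hM.trans_le (tsum_variance_le_energy H (by positivity))
  rw [ENNReal.tsum_eq_iSup_sum, lt_iSup_iff] at h1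
  obtain ⟨E₀, hE⟩ := h1
  refine ⟨E₀, t / 2, by positivity, ?_⟩
  rw [← ENNReal.ofReal_sum_of_nonneg fun e _ => ?_] at hE
  · have h2 := lt_of_not_ge fun h => hE.not_ge (ENNReal.ofReal_le_ofReal h)
    rw [← Finset.mul_sum] at h2
    linarith
  · refine mul_nonneg zero_le_two (mul_nonneg (NNReal.coe_nonneg _) ?_)
    exact intervalIntegral.integral_nonneg (by positivity) fun r _ => gradSq_nonneg _ e

end Energy

/-! ### The labels of the stirring process -/

section Labels

open BddFun JumpSystem

variable {S : Type*} {p : S → S → ℝ≥0} {hp_symm : ∀ x y, p x y = p y x}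
  {hp_bdd : (⨆ x, ∑' y, (p x y : ℝ≥0∞)) < ∞}

local notation "G" => stir p hp_symm hp_bdd

/-- The jump of a label at a time when the clocks of the pairs in `ρ` ring, if at most the pair
`e` would move it. -/
lemma eq_swapAt_of_jump {ρ : Set (Sym2 S)} {a z : S} (h1 : ∀ b, s(a, b) ∈ ρ → z = b)
    (h2 : (∀ b, s(a, b) ∉ ρ) → z = a) (e : Sym2 S) (he : swapAt e a ≠ a → e ∈ ρ)
    (hunique : ∀ e' ∈ ρ, swapAt e' a ≠ a → e' = e) : z = swapAt e a := by
  by_cases hne : swapAt e a = a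
  · rw [hne]
    by_cases hex : ∃ b, s(a, b) ∈ ρ
    · obtain ⟨b, hb⟩ := hex
      rw [h1 b hb]
      by_contra hba
      refine hba ?_
      rw [← swapAt_left a b, hunique _ hb (by rwa [swapAt_left]), hne]
    · exact h2 fun b hb => hex ⟨b, hb⟩
  · have hmem : a ∈ e := by
      by_contra h
      exact hne (swapAt_of_notMem h)
    obtain ⟨b, rfl⟩ := hmem
    rw [swapAt_left]
    exact h1 b (he hne)

lemma IsLabelPath.isPath_joint {R : Sym2 S → Set ℝ≥0} {x y : S} {f g : ℝ≥0 → S}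
    (hf : IsLabelPath R x f) (hg : IsLabelPath R y g) :
    (G).joint.IsPath R fun t => (f t, g t) where
  right_continuous t := by
    filter_upwards [hf.right_continuous t, hg.right_continuous t] with s h1 h2
    rw [h1, h2]
  jump t ht := by
    obtain ⟨a, ha, ha1, ha2⟩ := hf.jump t ht
    obtain ⟨b, hb, hb1, hb2⟩ := hg.jump t ht
    refine ⟨(a, b), ?_, fun e he _ hu => ?_, fun hno => ?_⟩
    · filter_upwards [ha, hb] with s h1 h2
      rw [h1, h2]
    · have hu' : ∀ e', t ∈ R e' → ¬ (swapAt e' a = a ∧ swapAt e' b = b) → e' = e :=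
        fun e' h1 h2 => hu e' h1 fun h => h2 (Prod.ext_iff.1 h)
      exact Prod.ext
        (eq_swapAt_of_jump (ρ := {e | t ∈ R e}) ha1 ha2 e (fun _ => he)
          fun e' h1 h2 => hu' e' h1 fun h => h2 h.1)
        (eq_swapAt_of_jump (ρ := {e | t ∈ R e}) hb1 hb2 e (fun _ => he)
          fun e' h1 h2 => hu' e' h1 fun h => h2 h.2)
    · have hno' : ∀ e', t ∈ R e' → swapAt e' a = a ∧ swapAt e' b = b :=
        fun e' h => Prod.ext_iff.1 (hno e' h)
      have hdiag : ∀ c : S, swapAt s(c, c) c = c := fun c => swapAt_left c c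
      refine Prod.ext ?_ ?_
      · rw [eq_swapAt_of_jump (ρ := {e | t ∈ R e}) ha1 ha2 s(a, a) (fun h => absurd (hdiag a) h)
          fun e' h1 h2 => absurd (hno' e' h1).1 h2, hdiag]
      · rw [eq_swapAt_of_jump (ρ := {e | t ∈ R e}) hb1 hb2 s(b, b) (fun h => absurd (hdiag b) h)
          fun e' h1 h2 => absurd (hno' e' h1).2 h2, hdiag]

namespace IsStirringProcess

variable [Countable S] {Ω : Type*} [MeasurableSpace Ω] {P : Measure Ω}
  {N : Sym2 S → ℝ≥0 → Ω → ℕ} {ξ : ℝ≥0 → S → Ω → S}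

lemma measurable_comp (h : IsStirringProcess p N ξ P) {α : Type*} [MeasurableSpace α]
    (f : S → α) (t : ℝ≥0) (x : S) : Measurable fun ω => f (ξ t x ω) := by
  let _ : MeasurableSpace S := ⊤
  have hm : Measurable (ξ t x) := measurable_to_countable' fun y => h.measurable t x y
  exact (measurable_from_top (f := f)).comp hm

lemma measurable_comp_pair (h : IsStirringProcess p N ξ P) {α : Type*} [MeasurableSpace α]
    (f : S × S → α) (t : ℝ≥0) (x y : S) : Measurable fun ω => f (ξ t x ω, ξ t y ω) := by
  let _ : MeasurableSpace S := ⊤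
  have hm : ∀ x, Measurable (ξ t x) := fun x =>
    measurable_to_countable' fun y => h.measurable t x y
  exact (measurable_of_countable f).comp ((hm x).prodMk (hm y))

variable [IsProbabilityMeasure P]

lemma integral_pair (h : IsStirringProcess p N ξ P) (F : BddFun (S × S)) (t : ℝ≥0) (x y : S) :
    ∫ ω, F (ξ t x ω, ξ t y ω) ∂P = (G).joint.semi t F (x, y) := by
  have : Countable (Sym2 S) := inferInstanceAs (Countable (Quot _))
  refine integral_eq_semi (N := N) (fun e => ?_) h.indep
    (Z := fun t ω => (ξ t x ω, ξ t y ω)) ?_ ?_ F t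
  · induction e with | _ a b => exact h.poisson a b
  · filter_upwards [h.path] with ω hω
    rw [(hω x).start, (hω y).start]
  · filter_upwards [h.path] with ω hω
    exact (hω x).isPath_joint (hω y)

lemma integral_label (h : IsStirringProcess p N ξ P) (f : BddFun S) (t : ℝ≥0) (x : S) :
    ∫ ω, f (ξ t x ω) ∂P = (G).semi t f x := by
  have h1 : ∀ q : S × S, tens f (ind Set.univ) q = f q.1 := fun q => by
    simp [tens_apply, ind_apply]
  rw [← (G).semi_joint_fst (tens f (ind Set.univ)) f h1 t (x, x), ← h.integral_pair]
  simp [h1]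

lemma integrable_comp (h : IsStirringProcess p N ξ P) (f : BddFun S) (t : ℝ≥0) (x : S) :
    Integrable (fun ω => f (ξ t x ω)) P :=
  Integrable.of_bound (h.measurable_comp f t x).aestronglyMeasurable ‖f‖
    (Eventually.of_forall fun _ => f.abs_apply_le _)

lemma lintegral_label (h : IsStirringProcess p N ξ P) {f : BddFun S} (hf : ∀ z, 0 ≤ f z)
    (t : ℝ≥0) (x : S) :
    ∫⁻ ω, ENNReal.ofReal (f (ξ t x ω)) ∂P = ENNReal.ofReal ((G).semi t f x) := by
  rw [← h.integral_label, ofReal_integral_eq_lintegral_ofReal (h.integrable_comp f t x)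
    (Eventually.of_forall fun _ => hf _)]

include hp_symm hp_bdd in
lemma ae_injective (h : IsStirringProcess p N ξ P) (t : ℝ≥0) :
    ∀ᵐ ω ∂P, Function.Injective fun x => ξ t x ω := by
  have key : ∀ x y, x ≠ y → ∀ᵐ ω ∂P, ξ t x ω ≠ ξ t y ω := by
    intro x y hxy
    have h1 := h.integral_pair (hp_symm := hp_symm) (hp_bdd := hp_bdd) (ind (Set.diagonal S)) t x y
    rw [semi_joint_diagonal, ind_apply, Set.indicator_of_notMem (by simpa using hxy),
      integral_eq_zero_iff_of_nonneg (fun _ => ind_nonneg _ _)] at h1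
    · filter_upwards [h1] with ω hω heq
      simp [ind_apply, heq] at hω
    · exact Integrable.of_bound (h.measurable_comp_pair _ t x y).aestronglyMeasurable 1
        (Eventually.of_forall fun _ => ((ind _).abs_apply_le _).trans
          (norm_of_le _ _ _ zero_le_one))
  have hall : ∀ᵐ ω ∂P, ∀ x y, x ≠ y → ξ t x ω ≠ ξ t y ω := by
    rw [ae_all_iff]; intro x
    rw [ae_all_iff]; intro y
    by_cases hxy : x = y
    · exact Eventually.of_forall fun ω hne => absurd hxy hne
    · exact (key x y hxy).mono fun ω hω _ => hω
  filter_upwards [hall] with ω hω x y hxy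
  by_contra hne
  exact hω x y hne hxy

/-- The expected number of labels from a set that are at a given site. -/
lemma lintegral_tsum_label (h : IsStirringProcess p N ξ P) (H : Set S) (t : ℝ≥0) (z : S) :
    ∫⁻ ω, ∑' u, ENNReal.ofReal (ind H u * ind {z} (ξ t u ω)) ∂P =
      ENNReal.ofReal ((G).semi t (ind H) z) := by
  have ht : (0 : ℝ) ≤ t := t.coe_nonneg
  have hm : ∀ u, Measurable fun ω => ENNReal.ofReal (ind {z} (ξ t u ω)) := fun u =>
    (h.measurable_comp _ t u).ennreal_ofReal
  simp_rw [ENNReal.ofReal_mul (ind_nonneg H _)]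
  rw [lintegral_tsum fun u => ((hm u).const_mul _).aemeasurable]
  simp_rw [lintegral_const_mul _ (hm _), h.lintegral_label (hp_symm := hp_symm)
    (hp_bdd := hp_bdd) (ind_nonneg {z}), ← ENNReal.ofReal_mul (ind_nonneg H _)]
  rw [(isSymmKernel_semi _).tsum_mul_apply ((G).bpContinuous_semi _)
    (fun f hf => (G).semi_nonneg ht hf) (ind_nonneg _) (ind_nonneg _),
    tsum_eq_single z fun u hu => by simp [ind_apply, hu]]
  simp [ind_apply]

include hp_symm hp_bdd in
/-- Almost surely every site carries a label. -/
lemma ae_surjective (h : IsStirringProcess p N ξ P) (t : ℝ≥0) :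
    ∀ᵐ ω ∂P, ∀ z, ∃ u, ξ t u ω = z := by
  rw [ae_all_iff]
  intro z
  -- the number of labels at `z` is at most one, with expectation one
  set n : Ω → ℝ≥0∞ := fun ω => ∑' u, ENNReal.ofReal (ind Set.univ u * ind {z} (ξ t u ω)) with hn
  have h1 : ∫⁻ ω, n ω ∂P = 1 := by
    have := h.lintegral_tsum_label (hp_symm := hp_symm) (hp_bdd := hp_bdd) Set.univ t z
    rw [semi_one] at this
    simpa [hn, ind_apply] using this
  have hle : n ≤ᵐ[P] fun _ => 1 := by
    filter_upwards [h.ae_injective (hp_symm := hp_symm) (hp_bdd := hp_bdd) t] with ω hω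
    by_cases hex : ∃ u, ξ t u ω = z
    · obtain ⟨u, hu⟩ := hex
      rw [hn]
      dsimp only
      rw [tsum_eq_single u fun v hv => ?_]
      · simp [ind_apply, hu]
      · have : ξ t v ω ≠ z := fun hv' => hv (hω (hv'.trans hu.symm))
        simp [ind_apply, this]
    · have : ∀ u, ξ t u ω ≠ z := fun u hu => hex ⟨u, hu⟩
      simp [hn, ind_apply, this]
  have heq := ae_eq_of_ae_le_of_lintegral_le hle (by simp [h1]) aemeasurable_const
    (by simp [h1])
  filter_upwards [heq] with ω hω
  by_contra hex
  have : ∀ u, ξ t u ω ≠ z := fun u hu => hex ⟨u, hu⟩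
  simp [hn, ind_apply, this] at hω

/-- A bound for the expected number of the sites of `H` that carry no label from `H`. -/
lemma lintegral_exclusion_le (h : IsStirringProcess p N ξ P) (H : Set S) (t : ℝ≥0) :
    ∫⁻ ω, ∑' x : H, ENNReal.ofReal (1 - exclusion ξ (ind H) t x ω) ∂P ≤
      ∑' x, ENNReal.ofReal (ind H x * (1 - (G).semi t (ind H) x)) := by
  have hle : ∀ᵐ ω ∂P, ∀ z, ENNReal.ofReal (1 - exclusion ξ (ind H) t z ω) ≤
      ∑' u, ENNReal.ofReal (ind Hᶜ u * ind {z} (ξ t u ω)) := by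
    filter_upwards [h.ae_surjective (hp_symm := hp_symm) (hp_bdd := hp_bdd) t] with ω hω z
    have hL : ξ t (labelAt ξ t z ω) ω = z := by
      rw [labelAt, dif_pos (hω z)]
      exact (hω z).choose_spec
    -- the summand of the label that occupies `z`
    refine le_trans (le_of_eq ?_) (ENNReal.le_tsum (labelAt ξ t z ω))
    rw [hL, exclusion]
    by_cases hm : labelAt ξ t z ω ∈ H <;> simp [ind_apply, hm]
  calc _ ≤ ∫⁻ ω, ∑' x : H, ∑' u, ENNReal.ofReal (ind Hᶜ u * ind {(x : S)} (ξ t u ω)) ∂P :=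
        lintegral_mono_ae (hle.mono fun ω hω => ENNReal.tsum_le_tsum fun x => hω x)
    _ = ∑' x : H, ENNReal.ofReal ((G).semi t (ind Hᶜ) x) := by
        rw [lintegral_tsum fun x => Measurable.aemeasurable (Measurable.tsum fun u =>
          ((h.measurable_comp _ t u).const_mul _).ennreal_ofReal)]
        exact tsum_congr fun x => h.lintegral_tsum_label Hᶜ t x
    _ = _ := by
        rw [tsum_subtype H fun x => ENNReal.ofReal ((G).semi t (ind Hᶜ) x)]
        refine tsum_congr fun x => ?_
        by_cases hx : x ∈ H <;> simp [ind_apply, hx, ← semi_ind_compl]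

end IsStirringProcess

end Labels

/-! ### Sums of negatively correlated random variables -/

section NegativeCorrelation

variable {ι Ω : Type*} [Countable ι] [MeasurableSpace Ω] {P : Measure Ω} [IsProbabilityMeasure P]

/-- An almost surely convergent series of negatively correlated random variables with summable
expectations and variances is square integrable, and its variance is at most the sum of the
variances. -/
lemma memLp_two_and_variance_le {X : ι → Ω → ℝ} {W : Ω → ℝ} {q : ι → ℝ}
    (hX : ∀ i, MemLp (X i) 2 P) (hcov : ∀ i j, i ≠ j → cov[X i, X j; P] ≤ 0)
    (hvar : ∀ i, Var[X i; P] ≤ q i) (hq : Summable q) (hm : Summable fun i => P[X i])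
    (hW : ∀ᵐ ω ∂P, HasSum (fun i => X i ω) (W ω)) :
    MemLp W 2 P ∧ Var[W; P] ≤ ∑' i, q i := by
  set m := ∑' i, P[X i] with hm_def
  have hq0 : ∀ i, 0 ≤ q i := fun i => (variance_nonneg _ _).trans (hvar i)
  have hQ : 0 ≤ ∑' i, q i := tsum_nonneg hq0
  have hsumLp : ∀ F : Finset ι, MemLp (∑ i ∈ F, X i) 2 P := fun F =>
    memLp_finsetSum' _ fun i _ => hX i
  have hWm : AEStronglyMeasurable W P := by
    refine aestronglyMeasurable_of_tendsto_ae (atTop : Filter (Finset ι))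
      (fun F => (hsumLp F).aestronglyMeasurable) (hW.mono fun ω hω => ?_)
    simpa only [HasSum, SummationFilter.unconditional_filter, Finset.sum_apply] using hω
  have hF : ∀ F : Finset ι, Var[∑ i ∈ F, X i; P] ≤ ∑' i, q i := fun F => by
    classical
    rw [variance_sum' fun i _ => hX i]
    refine le_trans (Finset.sum_le_sum fun i hi => ?_) (hq.sum_le_tsum F fun i _ => hq0 i)
    rw [← Finset.add_sum_erase _ _ hi, covariance_self (hX i).aestronglyMeasurable.aemeasurable]
    have : ∑ j ∈ F.erase i, cov[X i, X j; P] ≤ 0 := Finset.sum_nonpos fun j hj =>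
      hcov i j (Finset.ne_of_mem_erase hj).symm
    linarith [hvar i]
  -- Fatou's lemma, for the partial sums
  have hfatou : ∫⁻ ω, ENNReal.ofReal ((W ω - m) ^ 2) ∂P ≤ ENNReal.ofReal (∑' i, q i) := by
    set Y : Finset ι → Ω → ℝ≥0∞ := fun F ω =>
      ENNReal.ofReal (((∑ i ∈ F, X i) ω - P[∑ i ∈ F, X i]) ^ 2) with hY
    have hlim : ∀ᵐ ω ∂P, liminf (fun F => Y F ω) atTop = ENNReal.ofReal ((W ω - m) ^ 2) := by
      filter_upwards [hW] with ω hω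
      refine Tendsto.liminf_eq (ENNReal.tendsto_ofReal (Tendsto.pow (Tendsto.sub ?_ ?_) 2))
      · simpa only [HasSum, SummationFilter.unconditional_filter, Finset.sum_apply] using hω
      · refine hm.hasSum.congr fun F => ?_
        simp only [Finset.sum_apply]
        rw [integral_finsetSum _ fun i _ => (hX i).integrable one_le_two]
    rw [← lintegral_congr_ae hlim]
    refine (lintegral_liminf_le' fun F => ?_).trans ?_
    · exact (((hsumLp F).aestronglyMeasurable.aemeasurable.sub_const _).pow_const 2).ennreal_ofReal
    · refine liminf_le_of_frequently_le' (Eventually.frequently (Eventually.of_forall fun F => ?_))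
      rw [hY]
      dsimp only
      rw [← evariance_eq_lintegral_ofReal, ← (hsumLp F).ofReal_variance_eq]
      exact ENNReal.ofReal_le_ofReal (hF F)
  have hWc : AEStronglyMeasurable (fun ω => W ω - m) P := hWm.sub aestronglyMeasurable_const
  have hint : Integrable (fun ω => (W ω - m) ^ 2) P :=
    ⟨hWc.pow 2, (hasFiniteIntegral_iff_ofReal (Eventually.of_forall fun ω => sq_nonneg _)).2
      (hfatou.trans_lt ENNReal.ofReal_lt_top)⟩
  refine ⟨?_, ?_⟩
  · have h1 := ((memLp_two_iff_integrable_sq hWc).2 hint).add (memLp_const m)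
    refine h1.congr_norm hWm (Eventually.of_forall fun ω => ?_)
    simp
  · rw [← variance_sub_const hWm m]
    refine (variance_le_expectation_sq hWc).trans ?_
    change ∫ ω, (W ω - m) ^ 2 ∂P ≤ _
    rw [integral_eq_lintegral_of_nonneg_ae (Eventually.of_forall fun ω => sq_nonneg _) (hWc.pow 2)]
    exact ENNReal.toReal_le_of_le_ofReal hQ hfatou

/-- A lower bound for the variance of a series of negatively correlated random variables, up to a
remainder of variance at most one. -/
lemma eventually_variance_sum_le {X : ι → Ω → ℝ} {W : Ω → ℝ} {q : ι → ℝ}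
    (hX : ∀ i, MemLp (X i) 2 P) (hcov : ∀ i j, i ≠ j → cov[X i, X j; P] ≤ 0)
    (hvar : ∀ i, Var[X i; P] ≤ q i) (hq : Summable q) (hm : Summable fun i => P[X i])
    (hW : ∀ᵐ ω ∂P, HasSum (fun i => X i ω) (W ω)) :
    ∀ᶠ F in (atTop : Filter (Finset ι)),
      Var[∑ i ∈ F, X i; P] ≤ 2 * Var[W; P] + 2 := by
  have h1 : ∀ᶠ F in (atTop : Filter (Finset ι)), ∑' i : {i // i ∉ F}, q i < 1 :=
    (tendsto_tsum_compl_atTop_zero q).eventually_lt_const one_pos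
  filter_upwards [h1] with F hF
  have hWL := (memLp_two_and_variance_le hX hcov hvar hq hm hW).1
  have hSL : MemLp (∑ i ∈ F, X i) 2 P := memLp_finsetSum' _ fun i _ => hX i
  have h2 := (memLp_two_and_variance_le (X := fun i : {i // i ∉ F} => X i)
    (W := W - ∑ i ∈ F, X i) (fun i => hX i) (fun i j hij => hcov i j fun h => hij (Subtype.ext h))
    (fun i => hvar i) (hq.subtype _) (hm.subtype _) (hW.mono fun ω hω => by
      rw [F.hasSum_compl_iff (f := fun i => X i ω)]
      simpa using hω)).2
  -- `Var (W - Z) ≤ 2 Var W + 2 Var Z`, because `Var (W + Z)` is nonnegative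
  have h3 : ∑ i ∈ F, X i = W - (W - ∑ i ∈ F, X i) := by rw [sub_sub_cancel]
  have h4 := variance_sub hWL (hWL.sub hSL)
  have h5 := variance_add hWL (hWL.sub hSL)
  have h6 := variance_nonneg (W + (W - ∑ i ∈ F, X i)) P
  rw [h3, h4]
  linarith

end NegativeCorrelation

/-! ### The current -/

section Current

open BddFun JumpSystem

variable {S : Type*} [Countable S] {p : S → S → ℝ≥0} {hp_symm : ∀ x y, p x y = p y x}
  {hp_bdd : (⨆ x, ∑' y, (p x y : ℝ≥0∞)) < ∞}
  {Ω : Type*} [MeasurableSpace Ω] {P : Measure Ω} [IsProbabilityMeasure P]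
  {N : Sym2 S → ℝ≥0 → Ω → ℕ} {ξ : ℝ≥0 → S → Ω → S}

local notation "G" => stir p hp_symm hp_bdd

/-- The contribution to the current into `B` of the label that starts at `x`, if `x` is in the set
`H` of occupied sites: `1_B(ξ_t^x) - 1_B(x)`, which is `-1` if the label leaves `B`. -/
def flow (ξ : ℝ≥0 → S → Ω → S) (H B : Set S) (t : ℝ≥0) (x : S) (ω : Ω) : ℝ :=
  ind H x * ind B (ξ t x ω) - ind H x * ind B x

/-- The indicator of the event that the label that starts at `x` is on the other side at time
`t`. -/
def crossing (ξ : ℝ≥0 → S → Ω → S) (B : Set S) (t : ℝ≥0) (x : S) (ω : Ω) : ℝ :=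
  ind Bᶜ x * ind B (ξ t x ω) + ind B x * ind Bᶜ (ξ t x ω)

omit [Countable S] [MeasurableSpace Ω] in
lemma crossing_nonneg (B : Set S) (t : ℝ≥0) (x : S) (ω : Ω) : 0 ≤ crossing ξ B t x ω :=
  add_nonneg (mul_nonneg (ind_nonneg _ _) (ind_nonneg _ _))
    (mul_nonneg (ind_nonneg _ _) (ind_nonneg _ _))

omit [Countable S] [MeasurableSpace Ω] in
lemma abs_flow_le_crossing (H B : Set S) (t : ℝ≥0) (x : S) (ω : Ω) :
    |flow ξ H B t x ω| ≤ crossing ξ B t x ω := by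
  by_cases h1 : x ∈ H <;> by_cases h2 : x ∈ B <;> by_cases h3 : ξ t x ω ∈ B <;>
    simp [flow, crossing, ind_apply, h1, h2, h3]

omit [Countable S] [MeasurableSpace Ω] in
lemma flow_sq_le_crossing (H B : Set S) (t : ℝ≥0) (x : S) (ω : Ω) :
    flow ξ H B t x ω ^ 2 ≤ crossing ξ B t x ω := by
  by_cases h1 : x ∈ H <;> by_cases h2 : x ∈ B <;> by_cases h3 : ξ t x ω ∈ B <;>
    simp [flow, crossing, ind_apply, h1, h2, h3]

namespace IsStirringProcess

omit [IsProbabilityMeasure P] in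
lemma measurable_flow (h : IsStirringProcess p N ξ P) (H B : Set S) (t : ℝ≥0) (x : S) :
    Measurable (flow ξ H B t x) :=
  ((h.measurable_comp _ t x).const_mul _).sub_const _

omit [IsProbabilityMeasure P] in
lemma measurable_crossing (h : IsStirringProcess p N ξ P) (B : Set S) (t : ℝ≥0) (x : S) :
    Measurable (crossing ξ B t x) :=
  ((h.measurable_comp _ t x).const_mul _).add ((h.measurable_comp _ t x).const_mul _)

lemma memLp_flow (h : IsStirringProcess p N ξ P) (H B : Set S) (t : ℝ≥0) (x : S) :
    MemLp (flow ξ H B t x) 2 P := by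
  refine MemLp.of_bound (h.measurable_flow H B t x).aestronglyMeasurable 1
    (Eventually.of_forall fun ω => ?_)
  by_cases h1 : x ∈ H <;> by_cases h2 : x ∈ B <;> by_cases h3 : ξ t x ω ∈ B <;>
    simp [flow, ind_apply, h1, h2, h3]

lemma integrable_crossing (h : IsStirringProcess p N ξ P) (B : Set S) (t : ℝ≥0) (x : S) :
    Integrable (crossing ξ B t x) P :=
  ((h.integrable_comp _ t x).const_mul _).add ((h.integrable_comp _ t x).const_mul _)

lemma covariance_flow (h : IsStirringProcess p N ξ P) (H B : Set S) (t : ℝ≥0) (x y : S) :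
    cov[flow ξ H B t x, flow ξ H B t y; P] = ind H x * ind H y *
      ((G).joint.semi t (tens (ind B) (ind B)) (x, y) -
        (G).semi t (ind B) x * (G).semi t (ind B) y) := by
  have hi : ∀ x, Integrable (fun ω => ind H x * ind B (ξ t x ω)) P := fun x =>
    (h.integrable_comp _ t x).const_mul _
  have hL : ∀ x, MemLp (fun ω => ind B (ξ t x ω)) 2 P := fun x =>
    MemLp.of_bound (h.measurable_comp _ t x).aestronglyMeasurable ‖ind B‖
      (Eventually.of_forall fun ω => abs_apply_le _ _)
  unfold flow
  rw [covariance_sub_const_left (hi x), covariance_sub_const_right (hi y),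
    covariance_const_mul_left, covariance_const_mul_right, covariance_eq_sub (hL x) (hL y),
    h.integral_label, h.integral_label, ← h.integral_pair, ← mul_assoc]
  rfl

include hp_symm hp_bdd in
lemma covariance_flow_nonpos (h : IsStirringProcess p N ξ P) (H B : Set S) (t : ℝ≥0) {x y : S}
    (hxy : x ≠ y) :
    cov[flow ξ H B t x, flow ξ H B t y; P] ≤ 0 := by
  rw [h.covariance_flow (hp_symm := hp_symm) (hp_bdd := hp_bdd)]
  exact mul_nonpos_of_nonneg_of_nonpos (mul_nonneg (ind_nonneg _ _) (ind_nonneg _ _))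
    (sub_nonpos.2 (semi_joint_tens_le t.coe_nonneg _ hxy))

lemma variance_flow_le (h : IsStirringProcess p N ξ P) (H B : Set S) (t : ℝ≥0) (x : S) :
    Var[flow ξ H B t x; P] ≤ P[crossing ξ B t x] := by
  refine (variance_le_expectation_sq (h.measurable_flow H B t x).aestronglyMeasurable).trans ?_
  exact integral_mono (h.memLp_flow H B t x).integrable_sq (h.integrable_crossing B t x)
    (flow_sq_le_crossing H B t x)

include hp_symm hp_bdd in
/-- By symmetry, as many labels are expected to move from `B` to its complement as in the other
direction. -/
lemma tsum_lintegral_crossing_lt_top (h : IsStirringProcess p N ξ P) (B : Set S)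
    (t : ℝ≥0) (hcur : ∫⁻ ω, ∑' x : B, Bᶜ.indicator (1 : S → ℝ≥0∞) (ξ t x ω) ∂P < ∞) :
    ∑' x, ∫⁻ ω, ENNReal.ofReal (crossing ξ B t x ω) ∂P < ∞ := by
  have hm : ∀ (A : Set S) x, Measurable fun ω => ENNReal.ofReal (ind A (ξ t x ω)) := fun A x =>
    (h.measurable_comp _ t x).ennreal_ofReal
  have h1 : ∀ x, ∫⁻ ω, ENNReal.ofReal (crossing ξ B t x ω) ∂P =
      ENNReal.ofReal (ind Bᶜ x * (G).semi t (ind B) x) +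
        ENNReal.ofReal (ind B x * (G).semi t (ind Bᶜ) x) := fun x => by
    simp_rw [crossing, ENNReal.ofReal_add (mul_nonneg (ind_nonneg Bᶜ x) (ind_nonneg B _))
      (mul_nonneg (ind_nonneg B x) (ind_nonneg Bᶜ _)), ENNReal.ofReal_mul (ind_nonneg _ x)]
    rw [lintegral_add_left ((hm B x).const_mul _), lintegral_const_mul _ (hm B x),
      lintegral_const_mul _ (hm Bᶜ x), h.lintegral_label (ind_nonneg _),
      h.lintegral_label (ind_nonneg _)]
  have h2 : ∑' x, ENNReal.ofReal (ind B x * (G).semi t (ind Bᶜ) x) < ∞ := by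
    refine lt_of_eq_of_lt ?_ hcur
    have h3 : ∀ (x : S) ω, Bᶜ.indicator (1 : S → ℝ≥0∞) (ξ t x ω) =
        ENNReal.ofReal (ind Bᶜ (ξ t x ω)) := fun x ω => by
      by_cases hx : ξ t x ω ∈ B <;> simp [ind_apply, hx]
    simp_rw [h3]
    rw [lintegral_tsum fun x : B => (hm Bᶜ x).aemeasurable]
    simp_rw [h.lintegral_label (hp_symm := hp_symm) (hp_bdd := hp_bdd) (ind_nonneg Bᶜ)]
    rw [tsum_subtype B fun x => ENNReal.ofReal ((G).semi t (ind Bᶜ) x)]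
    refine tsum_congr fun x => ?_
    by_cases hx : x ∈ B <;> simp [ind_apply, hx]
  simp_rw [h1]
  rw [ENNReal.tsum_add, (isSymmKernel_semi _).tsum_mul_apply ((G).bpContinuous_semi _)
    (fun f hf => (G).semi_nonneg t.coe_nonneg hf) (ind_nonneg Bᶜ) (ind_nonneg B)]
  simp_rw [mul_comm ((G).semi t (ind Bᶜ) _)]
  exact ENNReal.add_lt_top.2 ⟨h2, h2⟩

variable {B : Set S} {t : ℝ≥0}

omit [IsProbabilityMeasure P] in
lemma ae_summable_crossing (h : IsStirringProcess p N ξ P)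
    (hc : ∑' x, ∫⁻ ω, ENNReal.ofReal (crossing ξ B t x ω) ∂P < ∞) :
    ∀ᵐ ω ∂P, Summable fun x => crossing ξ B t x ω := by
  have hm : ∀ x, Measurable fun ω => ENNReal.ofReal (crossing ξ B t x ω) := fun x =>
    (h.measurable_crossing B t x).ennreal_ofReal
  rw [← lintegral_tsum fun x => (hm x).aemeasurable] at hc
  filter_upwards [ae_lt_top (Measurable.tsum hm) hc.ne] with ω hω
  have := ENNReal.summable_toReal hω.ne
  simpa only [ENNReal.toReal_ofReal (crossing_nonneg B t _ ω)] using this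

omit [IsProbabilityMeasure P] in
lemma summable_integral_crossing (h : IsStirringProcess p N ξ P)
    (hc : ∑' x, ∫⁻ ω, ENNReal.ofReal (crossing ξ B t x ω) ∂P < ∞) :
    Summable fun x => P[crossing ξ B t x] := by
  refine (ENNReal.summable_toReal hc.ne).congr fun x => ?_
  rw [integral_eq_lintegral_of_nonneg_ae (Eventually.of_forall (crossing_nonneg B t x))
    (h.measurable_crossing B t x).aestronglyMeasurable]

lemma summable_integral_flow (h : IsStirringProcess p N ξ P) (H : Set S)
    (hc : ∑' x, ∫⁻ ω, ENNReal.ofReal (crossing ξ B t x ω) ∂P < ∞) :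
    Summable fun x => P[flow ξ H B t x] := by
  refine Summable.of_norm_bounded (h.summable_integral_crossing hc) fun x => ?_
  refine (norm_integral_le_integral_norm _).trans ?_
  exact integral_mono ((h.memLp_flow H B t x).integrable one_le_two).norm
    (h.integrable_crossing B t x) (abs_flow_le_crossing H B t x)

end IsStirringProcess

omit [Countable S] [MeasurableSpace Ω] in
lemma summable_current_and_hasSum_flow {H B : Set S} {t : ℝ≥0} {ω : Ω}
    (hω : Summable fun x => crossing ξ B t x ω) :
    ((Summable fun x : ↥Bᶜ => ind H x * B.indicator (1 : S → ℝ) (ξ t x ω)) ∧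
      Summable fun x : B => ind H x * Bᶜ.indicator (1 : S → ℝ) (ξ t x ω)) ∧
    HasSum (fun x => flow ξ H B t x ω) (current ξ (ind H) Bᶜ B t ω) := by
  have hflow : Summable fun x => flow ξ H B t x ω :=
    Summable.of_norm_bounded hω fun x => abs_flow_le_crossing H B t x ω
  have e1 : (fun x => flow ξ H B t x ω) ∘ (Subtype.val : ↥Bᶜ → S) =
      fun x : ↥Bᶜ => ind H x * B.indicator (1 : S → ℝ) (ξ t x ω) := by
    funext x
    have : (x : S) ∉ B := x.2
    simp [flow, ind_apply, this]
  have e2 : (fun x => flow ξ H B t x ω) ∘ (Subtype.val : B → S) =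
      fun x : B => -(ind H x * Bᶜ.indicator (1 : S → ℝ) (ξ t x ω)) := by
    funext x
    have : (x : S) ∈ B := x.2
    by_cases h1 : ξ t x ω ∈ B <;> simp [flow, ind_apply, this, h1]
  have s1 : Summable ((fun x => flow ξ H B t x ω) ∘ (Subtype.val : ↥Bᶜ → S)) :=
    hflow.subtype Bᶜ
  have s2 : Summable ((fun x => flow ξ H B t x ω) ∘ (Subtype.val : B → S)) := hflow.subtype B
  rw [e1] at s1
  rw [e2] at s2
  refine ⟨⟨s1, by simpa using s2.neg⟩, ?_⟩
  rw [current, sub_eq_add_neg, ← tsum_neg]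
  refine HasSum.add_isCompl (s := Bᶜ) (t := B) isCompl_compl.symm ?_ ?_
  · exact Eq.subst (motive := fun F => HasSum F _) e1.symm s1.hasSum
  · exact Eq.subst (motive := fun F => HasSum F _) e2.symm s2.hasSum

end Current

/-! ### Balanced partitions -/

section Balanced

open BddFun JumpSystem

variable {S : Type*} {p : S → S → ℝ≥0} {hp_symm : ∀ x y, p x y = p y x}
  {hp_bdd : (⨆ x, ∑' y, (p x y : ℝ≥0∞)) < ∞}

local notation "G" => stir p hp_symm hp_bdd

/-- For a balanced partition the locations of two labels, relative to the partition, become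
random. -/
lemma IsBalanced.exists_le_diffSq {B : Set S} (h : IsBalanced p Bᶜ) :
    ∃ κ : ℝ, 0 < κ ∧ ∀ E₀ : Finset (Sym2 S), ∃ T : ℝ≥0, ∀ e ∈ E₀, ¬ e.IsDiag → ∀ s : ℝ, T ≤ s →
      κ ≤ diffSq ((G).joint.semi s (tens (ind B) (ind B))) e := by
  obtain ⟨c, hc, hbal⟩ := h
  have hev : ∀ x, ∀ᶠ t : ℝ≥0 in atTop,
      c < (G).semi t (ind B) x ∧ c < 1 - (G).semi t (ind B) x := fun x => by
    have hb : ∀ t : ℝ≥0, chainProb p t x Bᶜ = 1 - (G).semi t (ind B) x := fun t => by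
      rw [chainProb_eq (hp_symm := hp_symm) (hp_bdd := hp_bdd), semi_ind_compl]
    have h0 : ∀ t : ℝ≥0, 0 ≤ chainProb p t x Bᶜ := fun t => by
      rw [hb, sub_nonneg]; exact (G).semi_ind_le_one t.coe_nonneg _ _
    have h1 : ∀ t : ℝ≥0, chainProb p t x Bᶜ ≤ 1 := fun t => by
      rw [hb]; linarith [(G).semi_ind_nonneg t.coe_nonneg B x]
    filter_upwards [eventually_lt_of_lt_liminf (hbal x).1 (isBoundedUnder_of ⟨0, h0⟩),
      eventually_lt_of_limsup_lt (hbal x).2 (isBoundedUnder_of ⟨1, h1⟩)] with t h2 h3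
    rw [hb] at h2 h3
    exact ⟨by linarith, h2⟩
  refine ⟨2 * c ^ 2, by positivity, fun E₀ => ?_⟩
  have hall : ∀ᶠ t : ℝ≥0 in atTop, ∀ e ∈ E₀, ¬ e.IsDiag →
      2 * c ^ 2 ≤ diffSq ((G).joint.semi t (tens (ind B) (ind B))) e := by
    rw [eventually_all_finset]
    intro e _
    induction e with | _ a b => ?_
    filter_upwards [hev a, hev b] with t ha hb hne
    rw [Sym2.mk_isDiag_iff] at hne
    refine le_trans ?_ (le_diffSq_semi_joint t.coe_nonneg B hne)
    nlinarith [mul_lt_mul'' ha.1 hb.2 hc.le hc.le, mul_lt_mul'' hb.1 ha.2 hc.le hc.le]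
  obtain ⟨T, hT⟩ := eventually_atTop.1 hall
  exact ⟨T, fun e he hd s hs => hT ⟨s, T.coe_nonneg.trans hs⟩ hs e he hd⟩

end Balanced

/-! ### Growth of the variance -/

section Growth

open BddFun JumpSystem

variable {S : Type*} [Countable S] {p : S → S → ℝ≥0} (hp_symm : ∀ x y, p x y = p y x)
  (hp_bdd : (⨆ x, ∑' y, (p x y : ℝ≥0∞)) < ∞)
  {Ω : Type*} [MeasurableSpace Ω] {P : Measure Ω} [IsProbabilityMeasure P]
  {N : Sym2 S → ℝ≥0 → Ω → ℕ} {ξ : ℝ≥0 → S → Ω → S}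

local notation "G" => stir p hp_symm hp_bdd

include hp_symm hp_bdd in
/-- The variance of the current dominates the energy dissipated up to time `R`, if the indicators
of `B` at the locations of two labels differ enough after time `t - R`. -/
lemma IsStirringProcess.le_variance_current (h : IsStirringProcess p N ξ P) {H B : Set S}
    {κ R : ℝ} {t : ℝ≥0} {E₀ : Finset (Sym2 S)} (hR : 0 ≤ R) (hRt : R ≤ t)
    (hc : ∑' x, ∫⁻ ω, ENNReal.ofReal (crossing ξ B t x ω) ∂P < ∞)
    (hκ : ∀ e ∈ E₀, ¬ e.IsDiag → ∀ s, t - R ≤ s →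
      κ ≤ diffSq ((G).joint.semi s (tens (ind B) (ind B))) e) :
    κ * ∑ e ∈ E₀, (G).rate e * ∫ r in (0 : ℝ)..R, gradSq ((G).semi r (ind H)) e ≤
      2 * Var[current ξ (ind H) Bᶜ B t; P] + 2 := by
  have hlim : Tendsto (fun F : Finset S => κ * ∑ e ∈ E₀, (G).rate e *
      ∫ r in (0 : ℝ)..R, gradSq ((G).semi r (restrict F (ind H))) e) atTop
      (𝓝 (κ * ∑ e ∈ E₀, (G).rate e * ∫ r in (0 : ℝ)..R, gradSq ((G).semi r (ind H)) e)) :=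
    (tendsto_finsetSum _ fun e _ => (tendsto_integral_gradSq H hR e).const_mul _).const_mul _
  have hvar := eventually_variance_sum_le (h.memLp_flow H B t)
    (fun x y hxy => h.covariance_flow_nonpos (hp_symm := hp_symm) (hp_bdd := hp_bdd) H B t hxy)
    (h.variance_flow_le H B t)
    (h.summable_integral_crossing hc) (h.summable_integral_flow H hc)
    ((h.ae_summable_crossing hc).mono fun ω hω => (summable_current_and_hasSum_flow hω).2)
  refine le_of_tendsto hlim (hvar.mono fun F hF => le_trans ?_ hF)
  rw [variance_sum' fun x _ => h.memLp_flow H B t x]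
  simp_rw [h.covariance_flow (hp_symm := hp_symm) (hp_bdd := hp_bdd)]
  exact le_sum_cov F (ind H) B E₀ hR hRt hκ

include hp_symm hp_bdd in
lemma IsStirringProcess.tendsto_variance_current (h : IsStirringProcess p N ξ P) {H B : Set S}
    (hbal : IsBalanced p Bᶜ)
    (hc : ∀ t, ∑' x, ∫⁻ ω, ENNReal.ofReal (crossing ξ B t x ω) ∂P < ∞)
    (hvar : (⨆ t : ℝ≥0, ∫⁻ ω, ∑' x : H,
      ENNReal.ofReal (1 - exclusion ξ (ind H) t x ω) ∂P) = ∞) :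
    Tendsto (fun t : ℝ≥0 => Var[current ξ (ind H) Bᶜ B t; P]) atTop atTop := by
  obtain ⟨κ, hκ, hdiff⟩ := hbal.exists_le_diffSq (hp_symm := hp_symm) (hp_bdd := hp_bdd)
  have henergy := exists_energy_gt (hp_symm := hp_symm) (hp_bdd := hp_bdd) H fun M => by
    obtain ⟨t, ht⟩ := lt_iSup_iff.1 (hvar ▸ ENNReal.ofReal_lt_top : ENNReal.ofReal M < _)
    exact ⟨t, t.coe_nonneg, ht.trans_le (h.lintegral_exclusion_le H t)⟩
  rw [tendsto_atTop]
  intro M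
  -- an energy larger than `(2 M + 2) / κ` makes the variance at least `M`
  obtain ⟨E₀, R, hR, hM⟩ := henergy ((2 * M + 2) / κ)
  obtain ⟨T, hT⟩ := hdiff E₀
  filter_upwards [eventually_ge_atTop (T + ⟨R, hR⟩)] with t ht
  have ht' : (T : ℝ) + R ≤ t := by exact_mod_cast ht
  have h1 := h.le_variance_current hp_symm hp_bdd (H := H) (E₀ := E₀) hR
    (by linarith [T.coe_nonneg]) (hc t)
    fun e he hd s hs => hT e he hd s (by linarith)
  rw [div_lt_iff₀' hκ] at hM
  linarith

end Growth

end SEP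

end

theorem proposition3 {S : Type*} [Countable S]
    {Ω : Type*} [MeasurableSpace Ω] (P : Measure Ω) [IsProbabilityMeasure P]
    -- symmetric jump rates with bounded total rate out of each site
    (p : S → S → ℝ≥0) (hp_symm : ∀ x y, p x y = p y x)
    (hp_bdd : (⨆ x, ∑' y, (p x y : ℝ≥0∞)) < ∞)
    -- the stirring process
    (N : Sym2 S → ℝ≥0 → Ω → ℕ) (ξ : ℝ≥0 → S → Ω → S)
    (hξ : SEP.IsStirringProcess p N ξ P)
    -- a balanced partition and an initial configuration of zeros and ones
    (A B : Set S) (hAB : IsCompl A B) (hbal : SEP.IsBalanced p A)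
    (η : S → ℝ) (hη : ∀ x, η x = 0 ∨ η x = 1)
    -- the expected number of labels that move from `B` to `A` is finite at all times
    (hcur : ∀ t, ∫⁻ ω, ∑' x : B, A.indicator (1 : S → ℝ≥0∞) (ξ t x ω) ∂P < ∞)
    -- the expected number of initially occupied sites that are then empty is unbounded
    (hvar : (⨆ t : ℝ≥0, ∫⁻ ω, ∑' x : {x : S // η x = 1},
      ENNReal.ofReal (1 - SEP.exclusion ξ η t x ω) ∂P) = ∞) :
    -- the current is well defined and square integrable, and its variance tends to infinity
    (∀ t, ∀ᵐ ω ∂P,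
      (Summable fun x : A => η x * B.indicator (1 : S → ℝ) (ξ t x ω)) ∧
      (Summable fun x : B => η x * A.indicator (1 : S → ℝ) (ξ t x ω))) ∧
    (∀ t, MemLp (SEP.current ξ η A B t) 2 P) ∧
    Tendsto (fun t : ℝ≥0 => Var[SEP.current ξ η A B t; P]) atTop atTop := by
  obtain rfl : A = Bᶜ := hAB.eq_compl
  have hH : η = SEP.BddFun.ind {x | η x = 1} := by
    funext x
    rcases hη x with h | h <;> simp [SEP.BddFun.ind_apply, h]
  have hc := fun t => hξ.tsum_lintegral_crossing_lt_top (hp_symm := hp_symm) (hp_bdd := hp_bdd)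
    B t (hcur t)
  have hvar' : (⨆ t : ℝ≥0, ∫⁻ ω, ∑' x : {x | η x = 1},
      ENNReal.ofReal (1 - SEP.exclusion ξ η t x ω) ∂P) = ∞ := hvar
  generalize {x | η x = 1} = H at hH hvar'
  subst hH
  refine ⟨fun t => ?_, fun t => ?_, hξ.tendsto_variance_current hp_symm hp_bdd hbal hc hvar'⟩
  · exact (hξ.ae_summable_crossing (hc t)).mono fun ω hω =>
      (SEP.summable_current_and_hasSum_flow hω).1
  · exact (SEP.memLp_two_and_variance_le (hξ.memLp_flow H B t)
      (fun x y hxy => hξ.covariance_flow_nonpos (hp_symm := hp_symm) (hp_bdd := hp_bdd) H B t hxy)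
      (hξ.variance_flow_le H B t) (hξ.summable_integral_crossing (hc t))
      (hξ.summable_integral_flow H (hc t))
      ((hξ.ae_summable_crossing (hc t)).mono fun ω hω =>
        (SEP.summable_current_and_hasSum_flow hω).2)).1
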